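/- Let $d\ge 1$, $s>d$, and let $\Omega\subset\mathbb R^d$ be closed with positive Lebesgue measure and with $\partial\Omega$ of class $C^1$ (locally the zero set of a $C^1$ function with non-vanishing differential). Let $V:\Omega\to[0,\infty)$ be continuous; if $\Omega$ is unbounded, assume also that $V(x)\to+\infty$ as $|x|\to\infty$ and that $\int_\Omega e^{-MV}\,dx<\infty$ for some $M>0$. For $\vec X_N=(x_1,\dots,x_N)\in\Omega^N$ put $$\mathcal H_N(\vec X_N)=\sum_{1\le i\ne j\le N}\frac1{|x_i-x_j|^{s}}+N^{s/d}\sum_{i=1}^N V(x_i)\in[0,+\infty],$$ which is $+\infty$ if two of the points coincide. Let $\mathrm{Config}$ be the space of locally finite point configurations in $\mathbb R^d$ (counted with multiplicity), identified with the Radon measures $\mathcal C=\sum_{p\in\mathcal C}\delta_p$, with the topology of vague convergence and its Borel $\sigma$-algebra; let $\theta_u\cdot\mathcal C=\sum_{p\in\mathcal C}\delta_{p-u}$ and $K_R=[-R/2,R/2]^d$. Let $$\mathrm{emp}(\vec X_N)=\frac1N\sum_{i=1}^N\delta_{x_i},\qquad \overline{\mathrm{Emp}}_N(\vec X_N)=\int_\Omega\delta_{\left(x,\;\theta_{N^{1/d}x}\cdot\sum_{i=1}^N\delta_{N^{1/d}x_i}\right)}dx$$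 be the empirical measure on $\Omega$ and the tagged empirical process, a measure on $\Omega\times\mathrm{Config}$. A tagged process is a measure $\bar P$ on $\Omega\times\mathrm{Config}$ of the form $dx\otimes\bar P^x(d\mathcal C)$, where $dx$ is the Lebesgue measure on $\Omega$ and the $\bar P^x$ are probability measures on $\mathrm{Config}$. It is stationary if for a.e. $x\in\Omega$ the law $\bar P^x$ is invariant under all the maps $\theta_u$, $u\in\mathbb R^d$. For a probability measure $P$ on $\mathrm{Config}$ let $$\mathrm{Intens}(P)=\mathbb E_P\Big[\liminf_{R\to\infty}\frac{|\mathcal C\cap K_R|}{R^d}\Big],\qquad \mathbb W_s(P)=\liminf_{R\to\infty}\frac1{R^d}\,\mathbb E_P\Big[\sum_{p\ne q\in\mathcal C\cap K_R}\frac1{|p-q|^s}\Big],$$ the last sum being over ordered pairs of distinct points, and being $+\infty$ if $\mathcal C$ has a multiple point in $K_R$. For a tagged process $\bar P$ let $$\overline{\mathrm{Intens}}(\bar P)=\mathrm{Intens}(\bar P^x)\,dx,\qquad \overline{\mathbb W}_s(\bar P)=\int_\Omega\mathbb W_s(\bar P^x)\,dx,\qquad \overline{\mathbb V}(\bar P)=\int_\Omega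 V\,d\,\overline{\mathrm{Intens}}(\bar P).$$ Tagged processes are said to converge, $\bar P_k\to\bar P$, if $\int F\,d\bar P_k\to\int F\,d\bar P$ for every bounded continuous $F$ on $\Omega\times\mathrm{Config}$ with $|F(x,\mathcal C)|\le g(x)$ for some Lebesgue-integrable $g$ on $\Omega$ (if $|\Omega|<\infty$: for every bounded continuous $F$). For every $N\ge1$ let $\vec X_N\in\Omega^N$, and assume that $\liminf_{N\to\infty}\mathcal H_N(\vec X_N)/N^{1+s/d}<+\infty$. Then: 1. There are a subsequence $(N_k)$, a probability measure $\mu$ on $\Omega$ and a stationary tagged process $\bar P$ with $\int_\Omega\mathrm{Intens}(\bar P^x)\,dx=1$ such that $\mathrm{emp}(\vec X_{N_k})\to\mu$ weakly, $\overline{\mathrm{Emp}}_{N_k}(\vec X_{N_k})\to\bar P$, $\overline{\mathrm{Intens}}(\bar P)=\mu$, and $$\liminf_{N\to\infty}\frac{\mathcal H_N(\vec X_N)}{N^{1+s/d}}\ \ge\ \overline{\mathbb W}_s(\bar P)+\overline{\mathbb V}(\bar P).$$ 2. ($\Gamma$-liminf inequality) For every subsequence $(N_k)$ and every tagged process $\bar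 P$ with $\overline{\mathrm{Emp}}_{N_k}(\vec X_{N_k})\to\bar P$, $$\liminf_{k\to\infty}\frac{\mathcal H_{N_k}(\vec X_{N_k})}{N_k^{1+s/d}}\ \ge\ \overline{\mathbb W}_s(\bar P)+\overline{\mathbb V}(\bar P).$$ -/

import Mathlib

open MeasureTheory ProbabilityTheory Filter Topology
open scoped ENNReal NNReal BoundedContinuousFunction CompactlySupported

noncomputable section

namespace RieszGas

/-- The Euclidean space `ℝ^d`. -/
abbrev E (d : ℕ) : Type := EuclideanSpace ℝ (Fin d)

/-! ### Point configurations -/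

/-- A locally finite point configuration in `ℝ^d`, with multiplicities: `mult p` is the mass that
the Radon measure `∑_{p ∈ C} δ_p` gives to the singleton `{p}`. -/
@[ext]
structure Config (d : ℕ) where
  mult : E d → ℕ
  locallyFinite : ∀ r : ℝ, (Function.support mult ∩ Metric.closedBall 0 r).Finite

namespace Config

variable {d : ℕ}

/-- The integral `∫ φ dC = ∑_{p ∈ C} φ(p)`; the sum is finite for `φ` of compact support. -/
def pairing (C : Config d) (φ : C_c(E d, ℝ)) : ℝ := ∑' p, (C.mult p : ℝ) * φ p

/-- The topology of vague convergence. -/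
instance : TopologicalSpace (Config d) :=
  TopologicalSpace.induced (fun C : Config d => C.pairing) inferInstance

instance : MeasurableSpace (Config d) := borel _

instance : BorelSpace (Config d) := ⟨rfl⟩

/-- The configuration `∑_i δ_{x_i}` of a finite family of points. -/
def ofPoints {N : ℕ} (x : Fin N → E d) : Config d where
  mult p := (Finset.univ.filter fun i => x i = p).card
  locallyFinite r := by
    refine ((Set.finite_range x).subset ?_).inter_of_left _
    intro p hp
    rw [Function.mem_support, Finset.card_ne_zero] at hp
    obtain ⟨i, hi⟩ := hp
    exact ⟨i, (Finset.mem_filter.1 hi).2⟩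

/-- `θ_u · C = ∑_{p ∈ C} δ_{p - u}`: the configuration `C` centered at `u`. -/
def translate (u : E d) (C : Config d) : Config d where
  mult p := C.mult (p + u)
  locallyFinite r := by
    refine Set.Finite.of_finite_image (f := fun p => p + u)
      ((C.locallyFinite (r + ‖u‖)).subset ?_) (add_left_injective u).injOn
    rintro _ ⟨p, ⟨hp, hr⟩, rfl⟩
    refine ⟨hp, ?_⟩
    rw [mem_closedBall_zero_iff] at hr ⊢
    exact (norm_add_le p u).trans (by linarith)

/-- The number `|C ∩ A|` of points of `C` in `A`, counted with multiplicity. -/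
def count (C : Config d) (A : Set (E d)) : ℝ≥0∞ :=
  ∑' p, A.indicator (fun p => (C.mult p : ℝ≥0∞)) p

/-- The number of ordered pairs of distinct points of `C` (two points at the same location are
distinct points), the first located at `p` and the second at `q`. -/
def pairs (C : Config d) (p q : E d) : ℕ :=
  open Classical in C.mult p * (C.mult q - if p = q then 1 else 0)

theorem continuous_translate (u : E d) : Continuous (Config.translate u) := by
  refine continuous_induced_rng.2 (continuous_pi fun φ => ?_)
  let ψ : C_c(E d, ℝ) :=
    ⟨⟨fun p => φ (p - u), by fun_prop⟩, φ.hasCompactSupport.comp_homeomorph (Homeomorph.subRight u)⟩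
  have h : (fun C : Config d => (Config.translate u C).pairing φ) = fun C => C.pairing ψ := by
    funext C
    refine (Equiv.tsum_eq (Equiv.addRight u) _).symm.trans ?_ |>.symm
    exact tsum_congr fun p => by simp [Config.translate, show ψ (p + u) = φ p from congrArg φ (add_sub_cancel_right p u)]
  exact h.symm ▸ (continuous_apply ψ).comp
    (continuous_induced_dom (f := fun C : Config d => C.pairing))

theorem pairing_ofPoints {N : ℕ} (x : Fin N → E d) (φ : C_c(E d, ℝ)) :
    (ofPoints x).pairing φ = ∑ i, φ (x i) := by
  classical
  rw [Config.pairing, tsum_eq_sum (s := Finset.univ.image x)]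
  · rw [Finset.sum_comp (fun p => φ p) x]
    simp [ofPoints]
  · intro p hp
    have : (ofPoints x).mult p = 0 := by
      simp only [ofPoints, Finset.card_eq_zero, Finset.filter_eq_empty_iff]
      exact fun i _ h => hp (Finset.mem_image.2 ⟨i, Finset.mem_univ i, h⟩)
    simp [this]

theorem translate_ofPoints {N : ℕ} (x : Fin N → E d) (u : E d) :
    (ofPoints x).translate u = ofPoints fun i => x i - u := by
  ext p
  simp [Config.translate, ofPoints, sub_eq_iff_eq_add]

end Config

variable {d : ℕ}

/-- The hypercube `K_R` with center `0` and sidelength `R`. -/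
def cube (d : ℕ) (R : ℝ) : Set (E d) := {p | ∀ i, |p i| ≤ R / 2}

/-- The density `liminf_{R → ∞} |C ∩ K_R| / R^d`. -/
def dens (C : Config d) : ℝ≥0∞ :=
  liminf (fun R : ℝ => C.count (cube d R) / ENNReal.ofReal R ^ d) atTop

/-- The Riesz kernel `|x - y|^{-s}`, with the value `+∞` at `x = y` (for `s > 0`). -/
def rieszKernel (s : ℝ) (x y : E d) : ℝ≥0∞ := edist x y ^ (-s)

/-- The Riesz interaction `Int[A, B](C)`: the sum of `|p - q|^{-s}` over the pairs of distinct
points `p ∈ C ∩ A`, `q ∈ C ∩ B`. -/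
def interaction (s : ℝ) (A B : Set (E d)) (C : Config d) : ℝ≥0∞ :=
  ∑' p : A, ∑' q : B, (C.pairs p q : ℝ≥0∞) * rieszKernel s (p : E d) (q : E d)

/-! ### Random point configurations -/

/-- Stationarity: invariance of the law under all the translations of `ℝ^d`. -/
def IsStationary (P : Measure (Config d)) : Prop :=
  ∀ u : E d, P.map (Config.translate u) = P

/-- The intensity `E_P[Dens(C)]`. -/
def intens (P : Measure (Config d)) : ℝ≥0∞ := ∫⁻ C, dens C ∂P

/-- The Riesz energy `liminf_{R → ∞} R^{-d} E_P[Int[K_R, K_R](C)]`. -/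
def rieszW (s : ℝ) (P : Measure (Config d)) : ℝ≥0∞ :=
  liminf (fun R : ℝ =>
    (∫⁻ C, interaction s (cube d R) (cube d R) C ∂P) / ENNReal.ofReal R ^ d) atTop

/-! ### Random tagged point configurations -/

/-- The Lebesgue measure on `Ω`, as a measure on the subtype. -/
def leb (Ω : Set (E d)) : Measure Ω := Measure.comap Subtype.val volume

theorem sigmaFinite_leb {Ω : Set (E d)} (hΩ : MeasurableSet Ω) : SigmaFinite (leb Ω) := by
  have h2 : (leb Ω).map Subtype.val = volume.restrict Ω := map_comap_subtype_coe hΩ volume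
  exact SigmaFinite.of_map (leb Ω) measurable_subtype_coe.aemeasurable (h2 ▸ inferInstance)

/-- A measure on `Ω × Config` whose first marginal is the Lebesgue measure on `Ω`, given through
its disintegration `x ↦ P̄^x` into probability measures on `Config`. -/
structure TaggedProcess (Ω : Set (E d)) where
  fiber : Kernel Ω (Config d)
  isMarkov : IsMarkovKernel fiber

namespace TaggedProcess

variable {Ω : Set (E d)}

/-- The measure `dx ⊗ P̄^x` on `Ω × Config`. -/
def toMeasure (P : TaggedProcess Ω) : Measure (Ω × Config d) :=
  (leb Ω) ⊗ₘ P.fiber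

/-- The intensity measure, with density `x ↦ Intens(P̄^x)` on `Ω`. -/
def intensity (P : TaggedProcess Ω) : Measure Ω :=
  (leb Ω).withDensity fun x => intens (P.fiber x)

/-- Stationary tagged processes whose intensity measure has total mass one. -/
def IsStationaryOne (P : TaggedProcess Ω) : Prop :=
  (∀ᵐ x ∂leb Ω, IsStationary (P.fiber x)) ∧ ∫⁻ x, intens (P.fiber x) ∂leb Ω = 1

/-- The Riesz energy `∫_Ω W_s(P̄^x) dx`. -/
def rieszW (s : ℝ) (P : TaggedProcess Ω) : ℝ≥0∞ := ∫⁻ x, RieszGas.rieszW s (P.fiber x) ∂leb Ω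

/-- The energy `∫ V d Intens(P̄)` due to the external field `V ≥ 0`. -/
def potential (V : Ω → ℝ) (P : TaggedProcess Ω) : ℝ≥0∞ :=
  ∫⁻ x, ENNReal.ofReal (V x) ∂P.intensity

end TaggedProcess

/-! ### The `N`-particle system -/

variable {Ω : Set (E d)}

/-- `H_N(x_1, …, x_N) = ∑_{i ≠ j} |x_i - x_j|^{-s} + N^{s/d} ∑_i V(x_i)`, which is `+∞` if two of
the points coincide. -/
def hamiltonian (s : ℝ) (V : Ω → ℝ) {N : ℕ} (x : Fin N → Ω) : ℝ≥0∞ :=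
  (∑ i, ∑ j ∈ Finset.univ.filter (fun j => i ≠ j), rieszKernel s (x i : E d) (x j : E d)) +
    (N : ℝ≥0∞) ^ (s / d) * ∑ i, ENNReal.ofReal (V (x i))

/-- The rescaled energy `H_N(x_1, …, x_N) / N^{1 + s/d}`. -/
def energyPerPoint (s : ℝ) (V : Ω → ℝ) {N : ℕ} (x : Fin N → Ω) : ℝ≥0∞ :=
  hamiltonian s V x / (N : ℝ≥0∞) ^ (1 + s / d)

/-- The empirical measure `(1/N) ∑_i δ_{x_i}` on `Ω`. -/
def emp {N : ℕ} (x : Fin N → Ω) : Measure Ω := (N : ℝ≥0∞)⁻¹ • ∑ i, Measure.dirac (x i)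

/-- The configuration `∑_i δ_{N^{1/d} x_i}` at microscopic scale. -/
def rescaled {N : ℕ} (x : Fin N → Ω) : Config d :=
  Config.ofPoints fun i => ((N : ℝ) ^ (1 / d : ℝ)) • (x i : E d)

/-- The tagged configuration `(y, θ_{N^{1/d} y} · X_N')`. -/
def tagged {N : ℕ} (x : Fin N → Ω) (y : Ω) : Ω × Config d :=
  (y, (rescaled x).translate (((N : ℝ) ^ (1 / d : ℝ)) • (y : E d)))

theorem measurable_tagged {N : ℕ} (x : Fin N → Ω) : Measurable (tagged x) := by
  refine measurable_id.prodMk (Continuous.measurable ?_)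
  refine continuous_induced_rng.2 (continuous_pi fun φ => ?_)
  simp only [Function.comp_def, rescaled, Config.translate_ofPoints, Config.pairing_ofPoints]
  fun_prop

/-- The tagged empirical process `∫_Ω δ_{(y, θ_{N^{1/d} y} · X_N')} dy`. -/
def taggedEmp {N : ℕ} (x : Fin N → Ω) : Measure (Ω × Config d) :=
  (leb Ω).map (tagged x)

/-! ### Convergence and regularity -/

/-- Weak convergence of (finite) measures. -/
def TendstoWeakly {α : Type*} [TopologicalSpace α] [MeasurableSpace α]
    (m : ℕ → Measure α) (m' : Measure α) : Prop :=
  ∀ f : α →ᵇ ℝ, Tendsto (fun k => ∫ a, f a ∂m k) atTop (𝓝 (∫ a, f a ∂m'))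

/-- Weak convergence of measures on `Ω × Config` whose first marginal is the Lebesgue measure on
`Ω`. As `Ω` may have infinite volume, the bounded continuous test functions are required to be
dominated by an integrable function of the tag; if `Ω` has finite volume, then all bounded
continuous functions are of this kind. -/
def TendstoTagged (m : ℕ → Measure (Ω × Config d)) (m' : Measure (Ω × Config d)) : Prop :=
  ∀ F : (Ω × Config d) →ᵇ ℝ,
    (∃ g : Ω → ℝ, Integrable g (leb Ω) ∧ ∀ z, |F z| ≤ g z.1) →
    Tendsto (fun k => ∫ z, F z ∂m k) atTop (𝓝 (∫ z, F z ∂m'))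

/-- The boundary of `Ω` is `C¹`: near each of its points it is the zero set of a `C¹` function
with non-vanishing differential. -/
def HasC1Boundary (Ω : Set (E d)) : Prop :=
  ∀ p ∈ frontier Ω, ∃ U : Set (E d), IsOpen U ∧ p ∈ U ∧ ∃ g : E d → ℝ,
    ContDiffOn ℝ 1 g U ∧ fderiv ℝ g p ≠ 0 ∧ frontier Ω ∩ U = {x ∈ U | g x = 0}

end RieszGas

end

/-! Zoom in by N^{1/d}. By homogeneity of the kernel, the energy per point becomes the average pair
interaction of the microscopic configuration plus the average of V over the points
(`energyPerPoint_eq`). Everything else is compactness and lower semicontinuity, once the local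
number of points is controlled.

The control comes from a bump η of integral one supported in the ball of radius 1/2, through the
smoothed count G(C) = ∑ η(p) (`mollifier`). Two points seen by the same bump are at distance at most
1, where |p - q|^{-s} is at least 1. Hence the second moment of G under the tagged empirical process
is bounded by the energy (`lintegral_sq_pairing_rescaled_le`), and integrals of G against cut-off
functions of the tag pass to the limit (`TendstoTagged.tendsto_integral_mul`).

Compactness: the vague topology is Polish (`coords_isClosedEmbedding`), and the mean number of
points in a microscopic ball is bounded with no assumption on the energy. Prokhorov's theorem, after
making Lebesgue measure on Ω finite by a positive weight, gives a limit, which is then disintegrated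
(`exists_tendstoTagged`). Stationarity: translating the configuration by u amounts to moving the tag
by u / N^{1/d}, which is invisible in the limit by continuity of translations in L¹
(`ae_isStationary_of_tendstoTagged`).

Intensity: it is defined through an almost sure lower density, so its identity with E[G] is an
ergodic theorem (`IsStationary.intens_eq`). The bound by E[G] is Fatou's lemma. The converse takes
the element g of least norm in the closed convex hull type set `countDominated`: it is translation
invariant, has mean E[G], and lies below the density by a maximal inequality. The empirical measure
differs little from its smoothing at scale N^{-1/d}; the smoothed mass leaking out of Ω vanishes by
Cauchy–Schwarz, and V prevents mass from escaping to infinity. So the empirical measures converge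
weakly to the intensity of the limit.

Energy: a pair of points is seen in a window of side R from a set of tags of volume at most (R +
2)^d / N. Truncating the kernel gives continuous functions of the configuration, whose integrals are
lower semicontinuous; letting the truncation level, then R, tend to infinity gives the bound on the
interaction (`TaggedProcess.rieszW_le_liminf`). The potential part follows from weak convergence
(`limit_properties`). -/

noncomputable section

namespace RieszGas

variable {d : ℕ}

namespace Config

/-! ### Configurations as measures -/

/-- The Radon measure `∑_{p ∈ C} δ_p`. -/
def toMeasure (C : Config d) : Measure (E d) :=
  Measure.sum fun p => (C.mult p : ℝ≥0∞) • Measure.dirac p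

theorem lintegral_toMeasure (C : Config d) (f : E d → ℝ≥0∞) :
    ∫⁻ p, f p ∂C.toMeasure = ∑' p, (C.mult p : ℝ≥0∞) * f p := by
  simp [toMeasure, lintegral_sum_measure, lintegral_smul_measure]

theorem toMeasure_apply (C : Config d) {A : Set (E d)} (hA : MeasurableSet A) :
    C.toMeasure A = C.count A := by
  rw [← lintegral_indicator_one hA, lintegral_toMeasure]
  refine tsum_congr fun p => ?_
  by_cases hp : p ∈ A <;> simp [hp]

theorem toMeasure_singleton (C : Config d) (p : E d) : C.toMeasure {p} = C.mult p := by
  classical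
  rw [toMeasure_apply _ (measurableSet_singleton p), count, tsum_eq_single p]
  · simp
  · intro q hq
    simp [hq]

/-- The number of points in a bounded set is a natural number. -/
theorem exists_nat_eq_toMeasure (C : Config d) {A : Set (E d)} (hA : MeasurableSet A)
    (hb : Bornology.IsBounded A) : ∃ n : ℕ, C.toMeasure A = n := by
  obtain ⟨r, hr⟩ := hb.subset_closedBall 0
  rw [toMeasure_apply C hA, count, tsum_eq_sum (s := (C.locallyFinite r).toFinset)]
  · refine ⟨∑ p ∈ (C.locallyFinite r).toFinset, A.indicator C.mult p, ?_⟩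
    push_cast
    refine Finset.sum_congr rfl fun p _ => ?_
    by_cases hp : p ∈ A <;> simp [hp]
  · intro p hp
    by_contra h
    apply hp
    have hpA : p ∈ A := by
      by_contra h'
      simp [h'] at h
    rw [Set.Finite.mem_toFinset]
    refine ⟨fun h0 => h ?_, hr hpA⟩
    simp [hpA, h0]

theorem toMeasure_lt_top (C : Config d) {A : Set (E d)} (hb : Bornology.IsBounded A) :
    C.toMeasure A < ∞ := by
  obtain ⟨r, hr⟩ := hb.subset_closedBall 0
  obtain ⟨n, hn⟩ := C.exists_nat_eq_toMeasure (Metric.isClosed_closedBall.measurableSet)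
    (Metric.isBounded_closedBall (x := (0 : E d)) (r := r))
  exact (measure_mono hr).trans_lt (hn ▸ ENNReal.natCast_lt_top n)

instance (C : Config d) : IsFiniteMeasureOnCompacts C.toMeasure :=
  ⟨fun _ hK => C.toMeasure_lt_top hK.isBounded⟩

theorem integrable (C : Config d) (φ : C_c(E d, ℝ)) : Integrable φ C.toMeasure :=
  φ.continuous.integrable_of_hasCompactSupport φ.hasCompactSupport

theorem pairing_eq_integral (C : Config d) (φ : C_c(E d, ℝ)) :
    C.pairing φ = ∫ p, φ p ∂C.toMeasure := by
  have h := (hasSum_integral_measure (C.integrable φ)).tsum_eq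
  rw [toMeasure, ← h, pairing]
  exact tsum_congr fun p => by simp [integral_smul_measure]

theorem ofReal_pairing (C : Config d) (φ : C_c(E d, ℝ)) (hφ : ∀ p, 0 ≤ φ p) :
    ENNReal.ofReal (C.pairing φ) = ∫⁻ p, ENNReal.ofReal (φ p) ∂C.toMeasure := by
  rw [pairing_eq_integral, ofReal_integral_eq_lintegral_ofReal (C.integrable φ) (ae_of_all _ hφ)]

theorem pairing_nonneg (C : Config d) {φ : C_c(E d, ℝ)} (hφ : ∀ p, 0 ≤ φ p) : 0 ≤ C.pairing φ := by
  rw [pairing_eq_integral]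
  exact integral_nonneg hφ

/-- An error measured against a cutoff χ costs ε times the number of points seen by χ, which is
controlled in the vague topology. -/
theorem abs_pairing_sub_le (C : Config d) {φ ψ χ : C_c(E d, ℝ)} {ε : ℝ}
    (h : ∀ p, |φ p - ψ p| ≤ ε * χ p) : |C.pairing φ - C.pairing ψ| ≤ ε * C.pairing χ := by
  simp only [pairing_eq_integral]
  rw [← integral_sub (C.integrable φ) (C.integrable ψ), ← integral_const_mul]
  exact (abs_integral_le_integral_abs).trans
    (integral_mono ((C.integrable φ).sub (C.integrable ψ)).abs ((C.integrable χ).const_mul ε) h)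

theorem toMeasure_ofPoints {N : ℕ} (x : Fin N → E d) :
    (ofPoints x).toMeasure = ∑ i, Measure.dirac (x i) := by
  classical
  ext A hA
  rw [toMeasure_apply _ hA, count, Measure.finsetSum_apply]
  rw [tsum_eq_sum (s := Finset.univ.image x)]
  · simp only [Measure.dirac_apply' _ hA]
    rw [Finset.sum_comp (fun p => A.indicator (1 : E d → ℝ≥0∞) p) x]
    refine Finset.sum_congr rfl fun p _ => ?_
    by_cases hp : p ∈ A <;> simp [hp, ofPoints]
  · intro p hp
    have : (ofPoints x).mult p = 0 := by
      simp only [ofPoints, Finset.card_eq_zero, Finset.filter_eq_empty_iff]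
      exact fun i _ h => hp (Finset.mem_image.2 ⟨i, Finset.mem_univ i, h⟩)
    by_cases hp : p ∈ A <;> simp [hp, this]

theorem lintegral_ofPoints {N : ℕ} (x : Fin N → E d) (f : E d → ℝ≥0∞) :
    ∫⁻ p, f p ∂(ofPoints x).toMeasure = ∑ i, f (x i) := by
  simp [toMeasure_ofPoints, lintegral_finsetSum_measure]

theorem lintegral_translate (C : Config d) (u : E d) (f : E d → ℝ≥0∞) :
    ∫⁻ p, f p ∂(C.translate u).toMeasure = ∫⁻ p, f (p - u) ∂C.toMeasure := by
  rw [lintegral_toMeasure, lintegral_toMeasure, ← (Equiv.subRight u).tsum_eq]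
  exact tsum_congr fun p => by simp [translate]

theorem translate_translate (C : Config d) (u v : E d) :
    (C.translate u).translate v = C.translate (u + v) := by
  ext p
  simp [translate, add_assoc, add_comm v u]

theorem count_mono (C : Config d) {A B : Set (E d)} (h : A ⊆ B) : C.count A ≤ C.count B :=
  ENNReal.tsum_le_tsum fun p => Set.indicator_le_indicator_of_subset h (fun _ => zero_le) p

end Config

/-! ### Cutoff functions -/

/-- The shift `p ↦ φ (p - u)` of a test function. -/
def shift (u : E d) (φ : C_c(E d, ℝ)) : C_c(E d, ℝ) :=
  ⟨⟨fun p => φ (p - u), by fun_prop⟩, φ.hasCompactSupport.comp_homeomorph (Homeomorph.subRight u)⟩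

@[simp]
theorem shift_apply (u : E d) (φ : C_c(E d, ℝ)) (p : E d) : shift u φ p = φ (p - u) := rfl

theorem Config.pairing_translate (C : Config d) (u : E d) (φ : C_c(E d, ℝ)) :
    (C.translate u).pairing φ = C.pairing (shift u φ) := by
  rw [Config.pairing, Config.pairing, ← (Equiv.subRight u).tsum_eq]
  exact tsum_congr fun p => by simp [Config.translate]

/-- A continuous function equal to one on the ball of radius `R` and to zero outside the ball of
radius `R + 1`. -/
def cutoffFun (R : ℝ) (p : E d) : ℝ := max 0 (min 1 (R + 1 - ‖p‖))

theorem cutoffFun_continuous (R : ℝ) : Continuous (cutoffFun (d := d) R) := by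
  unfold cutoffFun; fun_prop

theorem cutoffFun_nonneg (R : ℝ) (p : E d) : 0 ≤ cutoffFun R p := le_max_left _ _

theorem cutoffFun_le_one (R : ℝ) (p : E d) : cutoffFun R p ≤ 1 :=
  max_le zero_le_one (min_le_left _ _)

theorem cutoffFun_eq_one {R : ℝ} {p : E d} (h : ‖p‖ ≤ R) : cutoffFun R p = 1 := by
  rw [cutoffFun, min_eq_left (by linarith), max_eq_right zero_le_one]

theorem cutoffFun_eq_zero {R : ℝ} {p : E d} (h : R + 1 ≤ ‖p‖) : cutoffFun R p = 0 := by
  rw [cutoffFun, max_eq_left]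
  exact (min_le_right _ _).trans (by linarith)

theorem cutoffFun_mono {R R' : ℝ} (h : R ≤ R') (p : E d) : cutoffFun R p ≤ cutoffFun R' p := by
  unfold cutoffFun; gcongr

/-- `cutoffFun` as a compactly supported function. -/
def cutoff (d : ℕ) (R : ℝ) : C_c(E d, ℝ) :=
  ⟨⟨cutoffFun R, cutoffFun_continuous R⟩, by
    refine HasCompactSupport.of_support_subset_isCompact (isCompact_closedBall (0 : E d) (R + 1)) ?_
    intro p hp
    by_contra h
    rw [mem_closedBall_zero_iff, not_le] at h
    exact hp (cutoffFun_eq_zero h.le)⟩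

@[simp]
theorem cutoff_apply (R : ℝ) (p : E d) : cutoff d R p = cutoffFun R p := rfl

/-- A test function vanishes outside of some ball with integer radius. -/
theorem exists_nat_eq_zero (φ : C_c(E d, ℝ)) : ∃ n : ℕ, ∀ p, (n : ℝ) < ‖p‖ → φ p = 0 := by
  obtain ⟨r, hr⟩ := φ.hasCompactSupport.isCompact.isBounded.subset_closedBall 0
  obtain ⟨n, hn⟩ := exists_nat_ge r
  refine ⟨n, fun p hp => by_contra fun h => ?_⟩
  have := hr (subset_tsupport _ h)
  rw [mem_closedBall_zero_iff] at this
  linarith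

theorem exists_bound (φ : C_c(E d, ℝ)) : ∃ B : ℝ, 0 ≤ B ∧ ∀ p, |φ p| ≤ B := by
  obtain ⟨B, hB⟩ := φ.continuous.bounded_above_of_compact_support φ.hasCompactSupport
  exact ⟨B, (norm_nonneg _).trans (hB 0), hB⟩

theorem Config.continuous_pairing (φ : C_c(E d, ℝ)) : Continuous fun C : Config d => C.pairing φ :=
  (continuous_apply φ).comp (continuous_induced_dom (f := fun C : Config d => C.pairing))

theorem Config.toMeasure_closedBall_le (C : Config d) (R : ℝ) :
    C.toMeasure (Metric.closedBall 0 R) ≤ ENNReal.ofReal (C.pairing (cutoff d R)) := by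
  rw [Config.ofReal_pairing _ _ (cutoffFun_nonneg R),
    ← lintegral_indicator_one Metric.isClosed_closedBall.measurableSet]
  refine lintegral_mono fun p => ?_
  by_cases hp : p ∈ Metric.closedBall (0 : E d) R
  · simp [hp, cutoffFun_eq_one (mem_closedBall_zero_iff.1 hp)]
  · simp [hp]

/-! ### The vague topology -/

/-- A set of configurations with bounded numbers of points in bounded sets is relatively compact:
ultrafilter version. -/
theorem Config.exists_le_nhds_of_ultrafilter (l : Ultrafilter (Config d)) (M : ℕ → ℝ)
    (hM : ∀ n : ℕ, ∀ᶠ C in (l : Filter (Config d)), C.pairing (cutoff d n) ≤ M n) :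
    ∃ C₀ : Config d, (l : Filter (Config d)) ≤ 𝓝 C₀ := by
  classical
  -- Along an ultrafilter, a count that takes finitely many values is eventually constant.
  have hcount : ∀ A : Set (E d), MeasurableSet A → Bornology.IsBounded A →
      ∃ k : ℕ, ∀ᶠ C in (l : Filter (Config d)), C.toMeasure A = (k : ℝ≥0∞) := by
    intro A hA hb
    obtain ⟨r, hr⟩ := hb.subset_closedBall 0
    obtain ⟨n, hn⟩ := exists_nat_ge r
    have h1 : ∀ᶠ C in (l : Filter (Config d)), ∃ k : Fin (⌈M n⌉₊ + 1), C.toMeasure A = ((k : ℕ) : ℝ≥0∞) := by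
      filter_upwards [hM n] with C hC
      obtain ⟨k, hk⟩ := C.exists_nat_eq_toMeasure hA hb
      have h2 : C.toMeasure A ≤ ENNReal.ofReal (M n) :=
        (measure_mono (hr.trans (Metric.closedBall_subset_closedBall hn))).trans
          ((C.toMeasure_closedBall_le n).trans (ENNReal.ofReal_le_ofReal hC))
      have h3 : (k : ℝ≥0∞) ≤ (⌈M n⌉₊ : ℝ≥0∞) := by
        rw [← hk, ← ENNReal.ofReal_natCast]
        exact h2.trans (ENNReal.ofReal_le_ofReal (Nat.le_ceil _))
      exact ⟨⟨k, Nat.lt_succ_of_le (by exact_mod_cast h3)⟩, hk⟩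
    obtain ⟨k, hk⟩ := Ultrafilter.eventually_exists_iff.1 h1
    exact ⟨k, hk⟩
  have hball : ∀ (p : E d) (r : ℝ), ∃ k : ℕ, ∀ᶠ C in (l : Filter (Config d)),
      C.toMeasure (Metric.closedBall p r) = (k : ℝ≥0∞) := fun p r =>
    hcount _ Metric.isClosed_closedBall.measurableSet Metric.isBounded_closedBall
  choose k hk using hball
  have kmono : ∀ p r r', r ≤ r' → k p r ≤ k p r' := by
    intro p r r' h
    obtain ⟨C, h1, h2⟩ := ((hk p r).and (hk p r')).exists
    have : (k p r : ℝ≥0∞) ≤ k p r' := by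
      rw [← h1, ← h2]
      exact measure_mono (Metric.closedBall_subset_closedBall h)
    exact_mod_cast this
  -- The multiplicity of the limit at p is the least eventual count over balls around p. Counts
  -- being natural numbers, it is attained at some radius ρ p and constant below it.
  have hmin : ∀ p : E d, ∃ ρ : ℝ, 0 < ρ ∧ ∀ r, 0 < r → k p ρ ≤ k p r := by
    intro p
    have hne : ∃ n : ℕ, ∃ r : ℝ, 0 < r ∧ k p r = n := ⟨_, 1, one_pos, rfl⟩
    obtain ⟨ρ, hρ, h⟩ := Nat.find_spec hne
    exact ⟨ρ, hρ, fun r hr => h ▸ Nat.find_min' hne ⟨r, hr, rfl⟩⟩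
  choose ρ hρ hmin using hmin
  have keq : ∀ p r, 0 < r → r ≤ ρ p → k p r = k p (ρ p) := fun p r h h' =>
    le_antisymm (kmono p _ _ h') (hmin p r h)
  -- Small disjoint balls around p and q inside the ball of radius ρ p already have total count at
  -- most that of p alone, which leaves nothing for q.
  have hiso : ∀ p q, q ∈ Metric.ball p (ρ p) → q ≠ p → k q (ρ q) = 0 := by
    intro p q hq hne
    have hd : 0 < dist q p := dist_pos.2 hne
    rw [Metric.mem_ball] at hq
    set r := min (ρ q) (min (dist q p / 3) (ρ p - dist q p)) with hr
    have hr0 : 0 < r := lt_min (hρ q) (lt_min (by positivity) (by linarith))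
    set r' := min (ρ p) (dist q p / 3) with hr'
    have hr0' : 0 < r' := lt_min (hρ p) (by positivity)
    obtain ⟨C, ⟨h1, h2⟩, h3⟩ := (((hk q r).and (hk p r')).and (hk p (ρ p))).exists
    have hdisj : Disjoint (Metric.closedBall q r) (Metric.closedBall p r') := by
      apply Metric.closedBall_disjoint_closedBall
      have a1 : r ≤ dist q p / 3 := (min_le_right _ _).trans (min_le_left _ _)
      have a2 : r' ≤ dist q p / 3 := min_le_right _ _
      linarith
    have hsub : Metric.closedBall q r ∪ Metric.closedBall p r' ⊆ Metric.closedBall p (ρ p) := by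
      refine Set.union_subset (Metric.closedBall_subset_closedBall' ?_)
        (Metric.closedBall_subset_closedBall (min_le_left _ _))
      have : r ≤ ρ p - dist q p := (min_le_right _ _).trans (min_le_right _ _)
      linarith
    have h4 : (k q r : ℝ≥0∞) + k p r' ≤ k p (ρ p) := by
      rw [← h1, ← h2, ← h3, ← measure_union hdisj Metric.isClosed_closedBall.measurableSet]
      exact measure_mono hsub
    have h5 : k q r + k p r' ≤ k p (ρ p) := by exact_mod_cast h4
    rw [keq q r hr0 (min_le_left _ _), keq p r' hr0' (min_le_left _ _)] at h5
    omega
  -- By compactness finitely many balls of radius ρ cover, and each contains at most its own center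
  -- as a point of positive multiplicity.
  have hfin : ∀ R : ℝ,
      (Function.support (fun p => k p (ρ p)) ∩ Metric.closedBall 0 R).Finite := by
    intro R
    obtain ⟨t, -, ht⟩ := (isCompact_closedBall (0 : E d) R).elim_nhds_subcover
      (fun p => Metric.ball p (ρ p)) fun p _ => Metric.ball_mem_nhds p (hρ p)
    refine t.finite_toSet.subset ?_
    rintro q ⟨hq, hqR⟩
    obtain ⟨p, hp, hqp⟩ := Set.mem_iUnion₂.1 (ht hqR)
    by_contra hqt
    exact hq (hiso p q hqp fun h => hqt (h ▸ hp))
  let C₀ : Config d := ⟨fun p => k p (ρ p), hfin⟩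
  refine ⟨C₀, ?_⟩
  rw [nhds_induced, ← tendsto_iff_comap, tendsto_pi_nhds]
  intro φ
  obtain ⟨n, hn⟩ := exists_nat_eq_zero φ
  set S := (hfin (n + 1)).toFinset with hS
  have hMn : (0 : ℝ) ≤ max 0 (M (n + 1)) := le_max_left _ _
  rw [Metric.tendsto_nhds]
  intro e he
  -- The error will be ε times the number of points near the ball of radius n + 1, itself eventually
  -- at most `M (n + 1)`.
  obtain ⟨ε, hε, hεe⟩ : ∃ ε : ℝ, 0 < ε ∧ ε * max 0 (M (n + 1)) < e := by
    refine ⟨e / (max 0 (M (n + 1)) + 1), by positivity, ?_⟩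
    rw [div_mul_eq_mul_div, div_lt_iff₀ (by positivity)]
    nlinarith
  have hδ : ∀ p : E d, ∃ δ : ℝ, 0 < δ ∧ δ ≤ ρ p / 3 ∧ δ ≤ 1 ∧
      ∀ q ∈ Metric.closedBall p δ, |φ q - φ p| ≤ ε := by
    intro p
    obtain ⟨δ, hδ, h⟩ := Metric.continuous_iff.1 φ.continuous p ε hε
    refine ⟨min (δ / 2) (min (ρ p / 3) 1), ?_, ?_, ?_, fun q hq => ?_⟩
    · have := hρ p
      positivity
    · exact (min_le_right _ _).trans (min_le_left _ _)
    · exact (min_le_right _ _).trans (min_le_right _ _)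
    · refine (h q ?_).le
      exact (Metric.mem_closedBall.1 hq).trans_lt ((min_le_left _ _).trans_lt (by linarith))
  choose δ hδ0 hδρ hδ1 hδφ using hδ
  have hSk : ∀ q, ‖q‖ ≤ n + 1 → q ∉ S → k q (ρ q) = 0 := by
    intro q hq hqS
    by_contra h
    exact hqS ((hfin (n + 1)).mem_toFinset.2 ⟨h, mem_closedBall_zero_iff.2 hq⟩)
  have hSmem : ∀ p ∈ S, k p (ρ p) ≠ 0 := fun p hp => ((hfin (n + 1)).mem_toFinset.1 hp).1
  have hdisj : ∀ p ∈ S, ∀ q ∈ S, p ≠ q →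
      Disjoint (Metric.closedBall p (δ p)) (Metric.closedBall q (δ q)) := by
    intro p hp q hq hne
    apply Metric.closedBall_disjoint_closedBall
    have h1 : ρ p ≤ dist q p := by
      by_contra h
      exact hSmem q hq (hiso p q (Metric.mem_ball.2 (not_le.1 h)) hne.symm)
    have h2 : ρ q ≤ dist p q := by
      by_contra h
      exact hSmem p hp (hiso q p (Metric.mem_ball.2 (not_le.1 h)) hne)
    have := hδρ p
    have := hδρ q
    have := hρ p
    rw [dist_comm] at h1
    linarith
  -- The part of the support of φ away from the limit points: it is covered by finitely many balls
  -- that eventually contain no point at all.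
  set B : Set (E d) := Metric.closedBall 0 n \ ⋃ p ∈ S, Metric.ball p (δ p) with hB
  have hBc : IsCompact B :=
    (isCompact_closedBall (0 : E d) n).diff (isOpen_biUnion fun p _ => Metric.isOpen_ball)
  obtain ⟨t, htB, ht⟩ := hBc.elim_nhds_subcover
      (fun p => Metric.ball p (ρ p)) fun p _ => Metric.ball_mem_nhds p (hρ p)
  have hev1 : ∀ᶠ C in (l : Filter (Config d)), ∀ p ∈ t,
      C.toMeasure (Metric.closedBall p (ρ p)) = 0 := by
    rw [eventually_all_finset]
    intro p hp
    filter_upwards [hk p (ρ p)] with C hC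
    rw [hC, hSk p]
    · simp
    · have := (htB p hp).1
      rw [mem_closedBall_zero_iff] at this
      linarith
    · intro hpS
      exact (htB p hp).2 (Set.mem_biUnion hpS (Metric.mem_ball_self (hδ0 p)))
  have hev2 : ∀ᶠ C in (l : Filter (Config d)), ∀ p ∈ S,
      C.toMeasure (Metric.closedBall p (δ p)) = (k p (ρ p) : ℝ≥0∞) := by
    rw [eventually_all_finset]
    intro p _
    filter_upwards [hk p (δ p)] with C hC
    rw [hC, keq p _ (hδ0 p) ((hδρ p).trans (by linarith [hρ p]))]
  have hC₀ : C₀.pairing φ = ∑ p ∈ S, (k p (ρ p) : ℝ) * φ p := by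
    refine tsum_eq_sum fun p hp => ?_
    by_cases hpn : ‖p‖ ≤ n + 1
    · simp [C₀, hSk p hpn hp]
    · rw [hn p (by linarith), mul_zero]
  filter_upwards [hev1, hev2, hM (n + 1)] with C h1 h2 h3
  have hCB : C.toMeasure B = 0 := by
    refine measure_mono_null ht ((measure_biUnion_null_iff t.countable_toSet).2 fun p hp => ?_)
    exact measure_mono_null Metric.ball_subset_closedBall (h1 p hp)
  have hint : ∀ p ∈ S, Integrable
      ((Metric.closedBall p (δ p)).indicator fun _ => φ p) C.toMeasure := fun p _ =>
    (integrable_indicator_iff Metric.isClosed_closedBall.measurableSet).2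
      (integrableOn_const (C.toMeasure_lt_top Metric.isBounded_closedBall).ne)
  have hsum : ∑ p ∈ S, (k p (ρ p) : ℝ) * φ p =
      ∫ q, ∑ p ∈ S, (Metric.closedBall p (δ p)).indicator (fun _ => φ p) q ∂C.toMeasure := by
    rw [integral_finsetSum _ hint]
    refine Finset.sum_congr rfl fun p hp => ?_
    rw [integral_indicator_const _ Metric.isClosed_closedBall.measurableSet, Measure.real, h2 p hp]
    simp
  -- Eventually every point of C in the support of φ lies in one of the small disjoint balls around
  -- the limit points, on which φ is constant up to ε.
  have hae : ∀ᵐ q ∂C.toMeasure,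
      |φ q - ∑ p ∈ S, (Metric.closedBall p (δ p)).indicator (fun _ => φ p) q| ≤
        ε * cutoff d (n + 1 : ℕ) q := by
    have : ∀ᵐ q ∂C.toMeasure, q ∉ B := measure_eq_zero_iff_ae_notMem.1 hCB
    filter_upwards [this] with q hq
    by_cases hex : ∃ p ∈ S, q ∈ Metric.closedBall p (δ p)
    · obtain ⟨p, hp, hqp⟩ := hex
      rw [Finset.sum_eq_single_of_mem p hp, Set.indicator_of_mem hqp]
      · by_cases hqn : ‖q‖ ≤ (n + 1 : ℕ)
        · rw [cutoff_apply, cutoffFun_eq_one hqn, mul_one]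
          exact hδφ p q hqp
        · push_cast at hqn
          have : φ p = 0 := hn p (by
            have h1 := Metric.mem_closedBall.1 hqp
            have h2 := norm_le_norm_add_norm_sub' q p
            rw [← dist_eq_norm] at h2
            linarith [hδ1 p])
          rw [this, hn q (by linarith)]
          simpa using mul_nonneg hε.le (cutoffFun_nonneg _ q)
      · intro p' hp' hne
        exact Set.indicator_of_notMem (Set.disjoint_left.1 (hdisj p hp p' hp' hne.symm) hqp) _
    · push Not at hex
      rw [Finset.sum_eq_zero fun p hp => Set.indicator_of_notMem (hex p hp) _]
      have : φ q = 0 := by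
        apply hn
        by_contra hqn
        refine hq ⟨mem_closedBall_zero_iff.2 (not_lt.1 hqn), ?_⟩
        simp only [Set.mem_iUnion, not_exists]
        exact fun p hp h => hex p hp (Metric.ball_subset_closedBall h)
      rw [this]
      simpa using mul_nonneg hε.le (cutoffFun_nonneg _ q)
  rw [Real.dist_eq, hC₀, hsum, Config.pairing_eq_integral,
    ← integral_sub (C.integrable φ) (integrable_finsetSum _ hint)]
  refine (abs_integral_le_integral_abs.trans (integral_mono_ae
    ((C.integrable φ).sub (integrable_finsetSum _ hint)).abs
    ((C.integrable (cutoff d (n + 1 : ℕ))).const_mul ε) hae)).trans_lt ?_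
  rw [integral_const_mul, ← Config.pairing_eq_integral]
  refine lt_of_le_of_lt ?_ hεe
  gcongr
  exact h3.trans (le_max_right _ _)

/-! ### The space of configurations is Polish -/

/-- A countable family of test functions that determines the vague topology. -/
def testFun (n m : ℕ) : C_c(E d, ℝ) :=
  ⟨TopologicalSpace.denseSeq C(E d, ℝ) n * (cutoff d m).toContinuousMap,
    (cutoff d m).hasCompactSupport.mul_left⟩

/-- Since φ = φ · cutoff, approximating φ uniformly on a ball bounds the error by ε times the cutoff
itself. The index m depends on φ only, so the number of points involved stays fixed as ε tends to
zero. -/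
theorem exists_testFun (φ : C_c(E d, ℝ)) :
    ∃ m : ℕ, ∀ ε : ℝ, 0 < ε → ∃ n : ℕ, ∀ p, |φ p - testFun n m p| ≤ ε * cutoff d m p := by
  obtain ⟨m, hm⟩ := exists_nat_eq_zero φ
  refine ⟨m, fun ε hε => ?_⟩
  have h1 : {f : C(E d, ℝ) | ∀ p ∈ Metric.closedBall (0 : E d) (m + 1), |φ p - f p| < ε} ∈
      𝓝 φ.toContinuousMap := by
    have h := ContinuousMap.tendsto_iff_forall_isCompact_tendstoUniformlyOn.1
      (tendsto_id (x := 𝓝 φ.toContinuousMap)) _ (isCompact_closedBall (0 : E d) (m + 1))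
    exact Metric.tendstoUniformlyOn_iff.1 h ε hε
  obtain ⟨_, hf, n, rfl⟩ := mem_closure_iff_nhds.1
    (TopologicalSpace.denseRange_denseSeq C(E d, ℝ) φ.toContinuousMap) _ h1
  refine ⟨n, fun p => ?_⟩
  have h2 : φ p = φ p * cutoffFun m p := by
    by_cases hp : ‖p‖ ≤ m
    · rw [cutoffFun_eq_one hp, mul_one]
    · rw [hm p (not_le.1 hp), zero_mul]
  change |φ p - TopologicalSpace.denseSeq C(E d, ℝ) n p * cutoffFun m p| ≤ ε * cutoffFun m p
  rw [h2, ← sub_mul, abs_mul, abs_of_nonneg (cutoffFun_nonneg _ _)]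
  by_cases hp : ‖p‖ ≤ m + 1
  · exact mul_le_mul_of_nonneg_right (hf p (mem_closedBall_zero_iff.2 hp)).le (cutoffFun_nonneg _ _)
  · rw [cutoffFun_eq_zero (not_le.1 hp).le]
    simp

theorem Config.pairing_injective : Function.Injective fun C : Config d => C.pairing := by
  intro C C' h
  have h1 : C.toMeasure = C'.toMeasure :=
    Measure.ext_of_integral_eq_on_compactlySupported fun φ => by
      simpa only [Config.pairing_eq_integral] using congrFun h φ
  ext p
  have h2 := C.toMeasure_singleton p
  rw [h1, C'.toMeasure_singleton p] at h2
  exact_mod_cast h2.symm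

/-- The coordinates of a configuration given by the countable family of test functions. -/
def coords (C : Config d) : (ℕ × ℕ → ℝ) × (ℕ → ℝ) :=
  (fun nm => C.pairing (testFun nm.1 nm.2), fun n => C.pairing (cutoff d n))

/-- The cutoffs belong to the coordinates because they bound the errors made when φ is replaced by a
member of the countable family. -/
theorem coords_injective : Function.Injective (coords (d := d)) := by
  intro C C' h
  refine Config.pairing_injective (funext fun φ => eq_of_forall_dist_le fun e he => ?_)
  obtain ⟨m, hm⟩ := exists_testFun φ
  have hnn : 0 ≤ C.pairing (cutoff d m) := C.pairing_nonneg (cutoffFun_nonneg _)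
  obtain ⟨n, hn⟩ := hm (e / (2 * (C.pairing (cutoff d m) + 1))) (by positivity)
  have h1 := C.abs_pairing_sub_le hn
  have h2 := C'.abs_pairing_sub_le hn
  have h0 : C.pairing (cutoff d m) = C'.pairing (cutoff d m) := congrFun (congrArg Prod.snd h) m
  rw [← h0] at h2
  have h3 : C.pairing (testFun n m) = C'.pairing (testFun n m) :=
    congrFun (congrArg Prod.fst h) (n, m)
  rw [← h3] at h2
  have h4 : e / (2 * (C.pairing (cutoff d m) + 1)) * C.pairing (cutoff d m) ≤ e / 2 := by
    rw [div_mul_eq_mul_div, div_le_div_iff₀ (by positivity) two_pos]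
    nlinarith
  rw [Real.dist_eq]
  change |C.pairing φ - C'.pairing φ| ≤ e
  rw [abs_sub_comm] at h2
  exact (abs_sub_le _ (C.pairing (testFun n m)) _).trans (by linarith)

theorem coords_continuous : Continuous (coords (d := d)) :=
  (continuous_pi fun _ => Config.continuous_pairing _).prodMk
    (continuous_pi fun _ => Config.continuous_pairing _)

/-- The map is proper: an ultrafilter whose coordinates converge has bounded counts in balls, so it
converges. Hence the configurations form a closed subset of a countable product of lines. -/
theorem coords_isClosedEmbedding : IsClosedEmbedding (coords (d := d)) := by
  have hp : IsProperMap (coords (d := d)) := by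
    refine isProperMap_iff_ultrafilter.2 ⟨coords_continuous, fun l y hy => ?_⟩
    have hb : ∀ n : ℕ, ∀ᶠ C in (l : Filter (Config d)), C.pairing (cutoff d n) ≤ y.2 n + 1 := by
      intro n
      have h := ((continuous_apply n).tendsto _).comp ((continuous_snd.tendsto y).comp hy)
      filter_upwards [h.eventually_le_const (lt_add_one (y.2 n))] with C hC using hC
    obtain ⟨C, hC⟩ := Config.exists_le_nhds_of_ultrafilter l _ hb
    have hi : Function.Injective (coords (d := d)) := coords_injective
    exact ⟨C, tendsto_nhds_unique (coords_continuous.continuousAt.tendsto.mono_left hC) hy, hC⟩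
  exact IsClosedEmbedding.of_continuous_injective_isClosedMap coords_continuous coords_injective
    hp.isClosedMap

instance : PolishSpace (Config d) := coords_isClosedEmbedding.polishSpace

/-- These are the compact sets used to prove tightness. -/
theorem isCompact_setOf_pairing_le (M : ℕ → ℝ) :
    IsCompact {C : Config d | ∀ n : ℕ, C.pairing (cutoff d n) ≤ M n} := by
  refine isCompact_iff_ultrafilter_le_nhds'.2 fun l hl => ?_
  have hb : ∀ n : ℕ, ∀ᶠ C in (l : Filter (Config d)), C.pairing (cutoff d n) ≤ M n := fun n => by
    filter_upwards [hl] with C hC using hC n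
  obtain ⟨C, hC⟩ := Config.exists_le_nhds_of_ultrafilter l _ hb
  have hcl : IsClosed {C : Config d | ∀ n : ℕ, C.pairing (cutoff d n) ≤ M n} := by
    simp only [Set.ofPred_forall]
    exact isClosed_iInter fun n => isClosed_le (Config.continuous_pairing _) continuous_const
  exact ⟨C, isClosed_iff_ultrafilter.1 hcl C l hC hl, hC⟩

/-! ### Joint continuity of pairings and translations -/

/-- Joint continuity of the pairing of configurations with continuous families of test functions. -/
theorem Config.continuous_pairing_family {T : Type*} [TopologicalSpace T] (ψ : T → C_c(E d, ℝ))
    (hψ : Continuous fun z : T × E d => ψ z.1 z.2)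
    (hsupp : ∀ t₀, ∃ R : ℝ, ∀ᶠ t in 𝓝 t₀, ∀ p, R < ‖p‖ → ψ t p = 0) :
    Continuous fun z : T × Config d => z.2.pairing (ψ z.1) := by
  -- Near (t₀, C₀) the family is frozen at t₀. The error is e / (2M) times a count of points that
  -- stays below M near C₀.
  refine continuous_of_locally_uniform_approx_of_continuousAt fun z₀ u hu => ?_
  obtain ⟨e, he, heu⟩ := Metric.mem_uniformity_dist.1 hu
  obtain ⟨t₀, C₀⟩ := z₀
  obtain ⟨R, hR⟩ := hsupp t₀
  set M := C₀.pairing (cutoff d R) + 1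
  have hM : 0 < M := by
    have : 0 ≤ C₀.pairing (cutoff d R) := C₀.pairing_nonneg (cutoffFun_nonneg _)
    positivity
  have hε : 0 < e / (2 * M) := by positivity
  have h1 : ∀ᶠ t in 𝓝 t₀, ∀ p ∈ Metric.closedBall (0 : E d) R, |ψ t p - ψ t₀ p| < e / (2 * M) := by
    refine (isCompact_closedBall (0 : E d) R).eventually_forall_of_forall_eventually fun p _ => ?_
    have hc : Continuous fun z : T × E d => |ψ z.1 z.2 - ψ t₀ z.2| := by fun_prop
    exact (hc.tendsto (t₀, p)).eventually_lt_const (by simpa using hε)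
  have h2 : ∀ᶠ C in 𝓝 C₀, C.pairing (cutoff d R) < M :=
    ((Config.continuous_pairing _).tendsto C₀).eventually_lt_const (lt_add_one _)
  refine ⟨_, (h1.and hR).prod_nhds h2, fun z => z.2.pairing (ψ t₀),
    ((Config.continuous_pairing _).comp continuous_snd).continuousAt, ?_⟩
  rintro ⟨t, C⟩ ⟨⟨h3, h4⟩, h5⟩
  apply heu
  rw [Real.dist_eq]
  refine (C.abs_pairing_sub_le (ε := e / (2 * M)) (χ := cutoff d R) fun p => ?_).trans_lt ?_
  · by_cases hp : ‖p‖ ≤ R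
    · rw [cutoff_apply, cutoffFun_eq_one hp, mul_one]
      exact (h3 p (mem_closedBall_zero_iff.2 hp)).le
    · rw [h4 p (not_le.1 hp), hR.self_of_nhds p (not_le.1 hp), sub_self, abs_zero]
      exact mul_nonneg hε.le (cutoffFun_nonneg _ _)
  · calc e / (2 * M) * C.pairing (cutoff d R) ≤ e / (2 * M) * M := by gcongr
      _ = e / 2 := by field_simp
      _ < e := by linarith

theorem Config.continuous_translate_prod :
    Continuous fun z : E d × Config d => z.2.translate z.1 := by
  refine continuous_induced_rng.2 (continuous_pi fun φ => ?_)
  have h : (fun z : E d × Config d => (z.2.translate z.1).pairing φ) =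
      fun z => z.2.pairing (shift z.1 φ) := funext fun z => z.2.pairing_translate z.1 φ
  change Continuous fun z : E d × Config d => (z.2.translate z.1).pairing φ
  rw [h]
  refine Config.continuous_pairing_family (fun u => shift u φ) ?_ fun u₀ => ?_
  · simp only [shift_apply]
    fun_prop
  · obtain ⟨n, hn⟩ := exists_nat_eq_zero φ
    -- One unit of margin accommodates the supports of all shifts by u in the unit ball around u₀.
    refine ⟨n + ‖u₀‖ + 1, ?_⟩
    filter_upwards [Metric.ball_mem_nhds u₀ one_pos] with u hu p hp
    refine hn _ ?_
    rw [Metric.mem_ball, dist_eq_norm] at hu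
    have h1 := norm_le_norm_add_norm_sub' p u
    have h2 := norm_le_norm_add_norm_sub' u u₀
    linarith

theorem Config.measurable_translate_prod :
    Measurable fun z : E d × Config d => z.2.translate z.1 :=
  Config.continuous_translate_prod.measurable

/-! ### Double integrals against a configuration -/

/-- The test function `q ↦ ψ (p, q)` for `ψ` of compact support. -/
def slice (ψ : C_c(E d × E d, ℝ)) (p : E d) : C_c(E d, ℝ) :=
  ⟨⟨fun q => ψ (p, q), by fun_prop⟩, by
    refine HasCompactSupport.of_support_subset_isCompact
      (ψ.hasCompactSupport.isCompact.image continuous_snd) fun q hq => ?_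
    exact ⟨(p, q), subset_tsupport _ hq, rfl⟩⟩

@[simp]
theorem slice_apply (ψ : C_c(E d × E d, ℝ)) (p q : E d) : slice ψ p q = ψ (p, q) := rfl

theorem exists_support_prod (ψ : C_c(E d × E d, ℝ)) :
    ∃ R : ℝ, ∀ p q, R < ‖p‖ ∨ R < ‖q‖ → ψ (p, q) = 0 := by
  obtain ⟨R, hR⟩ := ψ.hasCompactSupport.isCompact.isBounded.subset_closedBall 0
  refine ⟨R, fun p q h => by_contra fun h' => ?_⟩
  have := hR (subset_tsupport _ h')
  rw [mem_closedBall_zero_iff, Prod.norm_mk] at this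
  rcases h with h | h
  · exact absurd ((le_max_left _ _).trans this) (not_le.2 h)
  · exact absurd ((le_max_right _ _).trans this) (not_le.2 h)

theorem continuous_pairing_section (ψ : C_c(E d × E d, ℝ)) :
    Continuous fun z : E d × Config d => z.2.pairing (slice ψ z.1) := by
  obtain ⟨R, hR⟩ := exists_support_prod ψ
  exact Config.continuous_pairing_family _ ψ.continuous
    fun _ => ⟨R, Eventually.of_forall fun p q hq => hR p q (Or.inr hq)⟩

/-- The test function `p ↦ ∫ ψ (p, q) dC(q)`. -/
def integrateSnd (ψ : C_c(E d × E d, ℝ)) (C : Config d) : C_c(E d, ℝ) :=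
  ⟨⟨fun p => C.pairing (slice ψ p),
    (continuous_pairing_section ψ).comp (by fun_prop : Continuous fun p : E d => (p, C))⟩, by
    obtain ⟨R, hR⟩ := exists_support_prod ψ
    refine HasCompactSupport.of_support_subset_isCompact (isCompact_closedBall (0 : E d) R)
      fun p hp => ?_
    by_contra h
    rw [mem_closedBall_zero_iff, not_le] at h
    refine hp ?_
    simp [Config.pairing, hR p _ (Or.inl h)]⟩

@[simp]
theorem integrateSnd_apply (ψ : C_c(E d × E d, ℝ)) (C : Config d) (p : E d) :
    integrateSnd ψ C p = C.pairing (slice ψ p) := rfl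

/-- The double integral `∬ ψ dC dC`. -/
def doublePairing (ψ : C_c(E d × E d, ℝ)) (C : Config d) : ℝ := C.pairing (integrateSnd ψ C)

/-- Joint continuity is used twice: first for the inner integral as a function of (p, C), then for
the outer one with the test function depending on C itself, along the diagonal. -/
theorem continuous_doublePairing (ψ : C_c(E d × E d, ℝ)) :
    Continuous (doublePairing ψ) := by
  obtain ⟨R, hR⟩ := exists_support_prod ψ
  have h := Config.continuous_pairing_family (integrateSnd ψ)
    (by
      simp only [integrateSnd_apply]
      exact (continuous_pairing_section ψ).comp (continuous_snd.prodMk continuous_fst))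
    fun _ => ⟨R, Eventually.of_forall fun C p hp => by
      simp [Config.pairing, hR p _ (Or.inl hp)]⟩
  exact h.comp (by fun_prop : Continuous fun C : Config d => (C, C))

/-! ### Cubes and densities -/

theorem isClosed_cube (R : ℝ) : IsClosed (cube d R) := by
  simp only [cube, Set.ofPred_forall]
  exact isClosed_iInter fun i => isClosed_le (by fun_prop) continuous_const

theorem measurableSet_cube (R : ℝ) : MeasurableSet (cube d R) := (isClosed_cube R).measurableSet

theorem cube_mono {R R' : ℝ} (h : R ≤ R') : cube d R ⊆ cube d R' :=
  fun _ hp i => (hp i).trans (by linarith)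

theorem volume_cube (R : ℝ) : volume (cube d R) = ENNReal.ofReal R ^ d := by
  have h : cube d R = (fun x : E d => WithLp.ofLp x) ⁻¹'
      (Set.univ.pi fun _ => Set.Icc (-(R / 2)) (R / 2)) := by
    ext p
    simp [cube, abs_le, Pi.le_def, forall_and]
  rw [h, (PiLp.volume_preserving_ofLp (Fin d)).measure_preimage
    (MeasurableSet.univ_pi fun _ => measurableSet_Icc).nullMeasurableSet, volume_pi_pi]
  simp

theorem abs_apply_le_norm (p : E d) (i : Fin d) : |p i| ≤ ‖p‖ := PiLp.norm_apply_le p i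

theorem norm_le_of_mem_cube {R : ℝ} {p : E d} (hp : p ∈ cube d R) : ‖p‖ ≤ d * (R / 2) := by
  have h1 : ‖p‖ ≤ ∑ i, |p i| := by
    rw [EuclideanSpace.norm_eq]
    refine Real.sqrt_le_iff.2 ⟨by positivity, ?_⟩
    simp only [Real.norm_eq_abs]
    exact Finset.sum_sq_le_sq_sum_of_nonneg fun i _ => abs_nonneg _
  refine h1.trans ((Finset.sum_le_sum fun i _ => hp i).trans ?_)
  simp

theorem sub_mem_cube {R r : ℝ} {p u : E d} (hp : p ∈ cube d R) (hu : ‖u‖ ≤ r) :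
    p - u ∈ cube d (R + 2 * r) := fun i => by
  have h1 := hp i
  have h2 := (abs_apply_le_norm u i).trans hu
  have h3 := abs_sub (p i) (u i)
  simp only [PiLp.sub_apply]
  linarith

/-- A real side R lies between n + L and n + L + 1 with n = ⌊R⌋ - L. Both the fixed margin L and the
rounding disappear because n / (n + L + 1) tends to 1. -/
theorem liminf_count_le_dens (C : Config d) (L : ℕ) :
    liminf (fun n : ℕ => C.count (cube d ((n + L : ℕ) : ℝ)) / (n : ℝ≥0∞) ^ d) atTop ≤ dens C := by
  refine le_of_forall_lt fun y hy => ?_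
  obtain ⟨z, hyz, hz⟩ := exists_between hy
  have hz0 : z ≠ ∞ := (hz.trans_le le_top).ne
  have h1 := eventually_lt_of_lt_liminf hz
  have ht : Tendsto (fun n : ℕ => z * (((n : ℝ) / (n + (L + 1 : ℕ))).toNNReal : ℝ≥0∞) ^ d) atTop
      (𝓝 (z * ((1 : ℝ).toNNReal : ℝ≥0∞) ^ d)) := by
    have h2 : Tendsto (fun n : ℕ => (n : ℝ) / (n + (L + 1 : ℕ))) atTop (𝓝 1) :=
      tendsto_natCast_div_add_atTop _
    refine ENNReal.Tendsto.const_mul ?_ (Or.inr hz0)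
    exact ((ENNReal.continuous_pow d).tendsto _).comp
      (ENNReal.tendsto_coe.2 ((continuous_real_toNNReal.tendsto 1).comp h2))
  obtain ⟨w, hy2, hwz⟩ := exists_between hyz
  have h3 := ht.eventually_const_lt (u := w) (by simpa using hwz)
  refine hy2.trans_le (le_liminf_of_le (by isBoundedDefault) ?_)
  have h4 : Tendsto (fun R : ℝ => ⌊R⌋₊ - L) atTop atTop :=
    (tendsto_sub_atTop_nat L).comp tendsto_nat_floor_atTop
  filter_upwards [h4.eventually h1, h4.eventually h3, h4.eventually (eventually_ge_atTop 1),
    eventually_ge_atTop (L + 1 : ℝ)] with R h5 h6 h7 h8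
  set n := ⌊R⌋₊ - L with hn
  have hR0 : 0 < R := lt_of_lt_of_le (by positivity) h8
  have h9 : n + L = ⌊R⌋₊ := by omega
  have h10 : ((n + L : ℕ) : ℝ) ≤ R := h9 ▸ Nat.floor_le hR0.le
  have h11 : R ≤ n + (L + 1 : ℕ) := by
    have := (Nat.lt_floor_add_one R).le
    rw [← h9] at this
    push_cast at this ⊢
    linarith
  have hn0 : (n : ℝ≥0∞) ≠ 0 := by simp; omega
  refine h6.le.trans ?_
  rw [ENNReal.le_div_iff_mul_le (Or.inl (by simp [hR0])) (Or.inl (by simp))]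
  calc z * ((((n : ℝ) / (n + (L + 1 : ℕ))).toNNReal : ℝ≥0∞) ^ d) * ENNReal.ofReal R ^ d
      = z * (ENNReal.ofReal ((n : ℝ) / (n + (L + 1 : ℕ))) * ENNReal.ofReal R) ^ d := by
        rw [mul_assoc, ← mul_pow]; rfl
    _ ≤ z * (n : ℝ≥0∞) ^ d := by
        gcongr
        rw [← ENNReal.ofReal_mul (by positivity), ← ENNReal.ofReal_natCast n]
        refine ENNReal.ofReal_le_ofReal ?_
        rw [div_mul_eq_mul_div, div_le_iff₀ (by positivity)]
        gcongr
    _ ≤ C.count (cube d ((n + L : ℕ) : ℝ)) := by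
        have := h5.le
        rwa [ENNReal.le_div_iff_mul_le (Or.inl (by simp [hn0])) (Or.inl (by simp))] at this
    _ ≤ C.count (cube d R) := C.count_mono (cube_mono h10)

theorem dens_le_liminf_nat (C : Config d) :
    dens C ≤ liminf (fun n : ℕ => C.count (cube d n) / (n : ℝ≥0∞) ^ d) atTop := by
  have h : dens C ≤ liminf (fun R : ℝ => C.count (cube d R) / ENNReal.ofReal R ^ d)
      (map (Nat.cast : ℕ → ℝ) atTop) := liminf_le_liminf_of_le tendsto_natCast_atTop_atTop
  simpa [liminf, limsInf, Filter.map_map, Function.comp_def, ENNReal.ofReal_natCast] using h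

/-! ### A mollifier of unit mass -/

theorem exists_mollifier (d : ℕ) : ∃ η : C_c(E d, ℝ), (∀ p, 0 ≤ η p) ∧
    (∀ p, 1 / 2 < ‖p‖ → η p = 0) ∧ ∫⁻ p, ENNReal.ofReal (η p) = 1 := by
  let φ : C_c(E d, ℝ) := ⟨⟨fun p => max 0 (1 / 2 - ‖p‖), by fun_prop⟩, by
    refine HasCompactSupport.of_support_subset_isCompact (isCompact_closedBall (0 : E d) (1 / 2)) ?_
    intro p hp
    by_contra h
    rw [mem_closedBall_zero_iff, not_le] at h
    exact hp (max_eq_left (by linarith))⟩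
  have hφ0 : ∀ p, 0 ≤ φ p := fun p => le_max_left _ _
  have hint : Integrable φ (volume : Measure (E d)) :=
    φ.continuous.integrable_of_hasCompactSupport φ.hasCompactSupport
  have hpos : 0 < ∫ p, φ p := by
    refine φ.continuous.integral_pos_of_hasCompactSupport_nonneg_nonzero φ.hasCompactSupport hφ0
      (x := 0) ?_
    change max 0 (1 / 2 - ‖(0 : E d)‖) ≠ 0
    rw [norm_zero]
    norm_num
  refine ⟨(∫ p, φ p)⁻¹ • φ, fun p => ?_, fun p hp => ?_, ?_⟩
  · exact mul_nonneg (inv_nonneg.2 hpos.le) (hφ0 p)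
  · have : φ p = 0 := max_eq_left (by linarith)
    simp [this]
  · simp only [CompactlySupportedContinuousMap.smul_apply, smul_eq_mul]
    rw [← ofReal_integral_eq_lintegral_ofReal (hint.const_mul _)
      (ae_of_all _ fun p => mul_nonneg (inv_nonneg.2 hpos.le) (hφ0 p)), integral_const_mul,
      inv_mul_cancel₀ hpos.ne', ENNReal.ofReal_one]

/-- A fixed mollifier: nonnegative, of integral one, supported in the ball of radius `1 / 2`. -/
def mollifier (d : ℕ) : C_c(E d, ℝ) := (exists_mollifier d).choose

theorem mollifier_nonneg (p : E d) : 0 ≤ mollifier d p := (exists_mollifier d).choose_spec.1 p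

theorem mollifier_eq_zero {p : E d} (hp : 1 / 2 < ‖p‖) : mollifier d p = 0 :=
  (exists_mollifier d).choose_spec.2.1 p hp

theorem lintegral_mollifier : ∫⁻ p, ENNReal.ofReal (mollifier d p) = 1 :=
  (exists_mollifier d).choose_spec.2.2

theorem measurable_mollifier_sub :
    Measurable fun z : E d × E d => ENNReal.ofReal (mollifier d (z.2 - z.1)) := by
  have : Continuous fun z : E d × E d => mollifier d (z.2 - z.1) := by fun_prop
  exact this.measurable.ennreal_ofReal

theorem ofReal_pairing_translate (C : Config d) (u : E d) :
    ENNReal.ofReal ((C.translate u).pairing (mollifier d)) =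
      ∫⁻ p, ENNReal.ofReal (mollifier d (p - u)) ∂C.toMeasure := by
  rw [Config.ofReal_pairing _ _ mollifier_nonneg, Config.lintegral_translate]

theorem setLIntegral_pairing_translate (C : Config d) {A : Set (E d)} :
    ∫⁻ u in A, ENNReal.ofReal ((C.translate u).pairing (mollifier d)) =
      ∫⁻ p, (∫⁻ u in A, ENNReal.ofReal (mollifier d (p - u))) ∂C.toMeasure := by
  simp only [ofReal_pairing_translate]
  exact lintegral_lintegral_swap (f := fun u p => ENNReal.ofReal (mollifier d (p - u)))
    measurable_mollifier_sub.aemeasurable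

/-- By Fubini each point p contributes the mass of η(p - ·) on the cube: at most one, and zero
unless p is within 1/2 of the cube. With the reverse bound below, integrals of the smoothed count
and counts agree up to a boundary layer. -/
theorem setLIntegral_pairing_le_count (C : Config d) (R : ℝ) :
    ∫⁻ u in cube d R, ENNReal.ofReal ((C.translate u).pairing (mollifier d)) ≤
      C.count (cube d (R + 1)) := by
  rw [setLIntegral_pairing_translate, ← Config.toMeasure_apply _ (measurableSet_cube _),
    ← lintegral_indicator_one (measurableSet_cube _)]
  refine lintegral_mono fun p => ?_
  by_cases hp : p ∈ cube d (R + 1)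
  · rw [Set.indicator_of_mem hp]
    refine (setLIntegral_le_lintegral _ _).trans ?_
    rw [lintegral_sub_left_eq_self (fun u => ENNReal.ofReal (mollifier d u)), lintegral_mollifier]
    rfl
  · rw [Set.indicator_of_notMem hp]
    refine (setLIntegral_eq_zero (measurableSet_cube _) fun u hu => ?_).le
    rw [mollifier_eq_zero, ENNReal.ofReal_zero]
    · rfl
    · by_contra h
      apply hp
      have := sub_mem_cube hu (u := u - p) (r := 1 / 2) (by rw [norm_sub_rev]; exact not_lt.1 h)
      rw [sub_sub_cancel] at this
      convert this using 1
      ring_nf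

theorem count_le_setLIntegral_pairing (C : Config d) (R : ℝ) :
    C.count (cube d R) ≤
      ∫⁻ u in cube d (R + 1), ENNReal.ofReal ((C.translate u).pairing (mollifier d)) := by
  rw [setLIntegral_pairing_translate, ← Config.toMeasure_apply _ (measurableSet_cube _),
    ← lintegral_indicator_one (measurableSet_cube _)]
  refine lintegral_mono fun p => ?_
  by_cases hp : p ∈ cube d R
  · rw [Set.indicator_of_mem hp, ← lintegral_indicator (measurableSet_cube _)]
    refine le_trans ?_ (lintegral_mono (f := fun u => ENNReal.ofReal (mollifier d (p - u)))
      fun u => ?_)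
    · rw [lintegral_sub_left_eq_self (fun u => ENNReal.ofReal (mollifier d u)), lintegral_mollifier]
      rfl
    · by_cases hu : u ∈ cube d (R + 1)
      · rw [Set.indicator_of_mem hu]
      · have h0 : mollifier d (p - u) = 0 := by
          refine mollifier_eq_zero (by_contra fun h => hu ?_)
          have := sub_mem_cube hp (u := p - u) (r := 1 / 2) (not_lt.1 h)
          rw [sub_sub_cancel] at this
          convert this using 1
          ring_nf
        simp [h0]
  · rw [Set.indicator_of_notMem hp]
    exact zero_le

/-! ### A covering lemma -/

/-- The constant in the maximal inequality. -/
def coverConst (d : ℕ) : ℝ≥0∞ :=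
  ENNReal.ofReal ((5 * (d + 1)) ^ d) * volume (Metric.ball (0 : E d) 1)

theorem coverConst_ne_top : coverConst d ≠ ∞ :=
  ENNReal.mul_ne_top ENNReal.ofReal_ne_top measure_ball_lt_top.ne

/-- Vitali's covering argument. The cubes with large averages sit in balls of comparable size; a
disjoint subfamily of these balls has fivefold enlargements covering S, and the integral of H over
the disjoint union bounds the total volume. The balls reach at most (d + 1) L beyond the cube of
side T. -/
theorem mul_volume_le_of_large_averages (H : E d → ℝ≥0∞) (c : ℝ≥0∞) (T : ℝ) (L : ℕ) (S : Set (E d))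
    (hST : S ⊆ cube d T)
    (hS : ∀ u ∈ S, ∃ n : ℕ, 1 ≤ n ∧ n ≤ L ∧
      c * (n : ℝ≥0∞) ^ d ≤ ∫⁻ w in cube d n, H (u + w)) :
    c * volume S ≤ coverConst d * ∫⁻ v in cube d (T + 2 * ((d + 1) * L)), H v := by
  choose! n hn1 hnL hn using hS
  have hD : (0 : ℝ) < d + 1 := by positivity
  -- A cube of side n lies in the ball of radius d n / 2; the factor d + 1 also keeps the radius
  -- positive when d = 0.
  set r : E d → ℝ := fun u => (d + 1) * n u with hr
  obtain ⟨U, hUS, hdisj, hcov⟩ := Vitali.exists_disjoint_subfamily_covering_enlargement_closedBall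
    S (fun u => u) r ((d + 1) * L) (fun u hu => by
      have : (n u : ℝ) ≤ L := by exact_mod_cast hnL u hu
      simp only [hr]; gcongr) 5 (by norm_num)
  have hr0 : ∀ u ∈ S, 0 < r u := fun u hu => by
    have : (1 : ℝ) ≤ n u := by exact_mod_cast hn1 u hu
    simp only [hr]; positivity
  have hUc : U.Countable := hdisj.countable_of_nonempty_interior fun u hu =>
    ⟨u, Metric.ball_subset_interior_closedBall (Metric.mem_ball_self (hr0 u (hUS hu)))⟩
  have hScov : S ⊆ ⋃ b ∈ U, Metric.closedBall b (5 * r b) := by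
    intro u hu
    obtain ⟨b, hb, hub⟩ := hcov u hu
    exact Set.mem_biUnion hb (hub (Metric.mem_closedBall_self (hr0 u hu).le))
  have hvol : ∀ b : E d, volume (Metric.closedBall b (5 * r b)) =
      coverConst d * (n b : ℝ≥0∞) ^ d := by
    intro b
    rw [Measure.addHaar_closedBall _ _ (by simp only [hr]; positivity), coverConst,
      finrank_euclideanSpace_fin]
    have : (5 * r b) ^ d = (5 * (d + 1)) ^ d * (n b : ℝ) ^ d := by
      simp only [hr]; rw [← mul_pow]; ring
    rw [this, ENNReal.ofReal_mul (by positivity), ENNReal.ofReal_pow (by positivity) d (p := (n b : ℝ)),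
      ENNReal.ofReal_natCast]
    ring
  have hballs : ∀ b ∈ U, c * (n b : ℝ≥0∞) ^ d ≤ ∫⁻ v in Metric.closedBall b (r b), H v := by
    intro b hb
    refine (hn b (hUS hb)).trans ?_
    rw [← lintegral_indicator (measurableSet_cube _),
      ← lintegral_indicator Metric.isClosed_closedBall.measurableSet,
      ← lintegral_add_left_eq_self (fun v => (Metric.closedBall b (r b)).indicator H v) b]
    refine lintegral_mono fun w => ?_
    by_cases hw : w ∈ cube d (n b)
    · rw [Set.indicator_of_mem hw, Set.indicator_of_mem]
      rw [Metric.mem_closedBall, dist_self_add_left]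
      refine (norm_le_of_mem_cube hw).trans ?_
      simp only [hr]
      have : (0 : ℝ) ≤ n b := Nat.cast_nonneg _
      have : (0 : ℝ) ≤ d := Nat.cast_nonneg _
      nlinarith
    · rw [Set.indicator_of_notMem hw]
      exact zero_le
  calc c * volume S ≤ c * ∑' b : U, volume (Metric.closedBall (b : E d) (5 * r b)) := by
        gcongr
        exact (measure_mono hScov).trans (measure_biUnion_le _ hUc _)
    _ = coverConst d * ∑' b : U, c * (n (b : E d) : ℝ≥0∞) ^ d := by
        simp only [hvol, ENNReal.tsum_mul_left]
        ring
    _ ≤ coverConst d * ∑' b : U, ∫⁻ v in Metric.closedBall (b : E d) (r b), H v := by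
        gcongr with b
        exact hballs b b.2
    _ = coverConst d * ∫⁻ v in ⋃ b ∈ U, Metric.closedBall (b : E d) (r b), H v := by
        rw [lintegral_biUnion hUc (fun b _ => Metric.isClosed_closedBall.measurableSet) hdisj]
    _ ≤ coverConst d * ∫⁻ v in cube d (T + 2 * ((d + 1) * L)), H v := by
        gcongr
        refine Set.iUnion₂_subset fun b hb v hv => ?_
        have h1 : ‖b - v‖ ≤ (d + 1) * L := by
          rw [← dist_eq_norm, dist_comm]
          refine (Metric.mem_closedBall.1 hv).trans ?_
          have : (n b : ℝ) ≤ L := by exact_mod_cast hnL b (hUS hb)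
          simp only [hr]; gcongr
        simpa using sub_mem_cube (hST (hUS hb)) h1

/-! ### The ergodic theorem for the intensity -/

theorem measurable_translate (u : E d) : Measurable (Config.translate u) :=
  (Config.continuous_translate u).measurable

theorem IsStationary.measurePreserving {P : Measure (Config d)} (hP : IsStationary P) (u : E d) :
    MeasurePreserving (Config.translate u) P P := ⟨measurable_translate u, hP u⟩

theorem IsStationary.lintegral_translate {P : Measure (Config d)} (hP : IsStationary P)
    {h : Config d → ℝ≥0∞} (hh : Measurable h) (u : E d) :
    ∫⁻ C, h (C.translate u) ∂P = ∫⁻ C, h C ∂P :=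
  (hP.measurePreserving u).lintegral_comp hh

theorem measurable_comp_translate {h : Config d → ℝ≥0∞} (hh : Measurable h) :
    Measurable fun z : Config d × E d => h (z.1.translate z.2) :=
  hh.comp (Config.measurable_translate_prod.comp measurable_swap)

theorem measurable_setLIntegral_translate {h : Config d → ℝ≥0∞} (hh : Measurable h)
    (A : Set (E d)) : Measurable fun C : Config d => ∫⁻ u in A, h (C.translate u) :=
  (measurable_comp_translate hh).lintegral_prod_right'

theorem IsStationary.lintegral_setLIntegral {P : Measure (Config d)} [SFinite P]
    (hP : IsStationary P) {h : Config d → ℝ≥0∞} (hh : Measurable h) (A : Set (E d)) :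
    ∫⁻ C, (∫⁻ u in A, h (C.translate u)) ∂P = volume A * ∫⁻ C, h C ∂P := by
  refine (lintegral_lintegral_swap (μ := P) (ν := volume.restrict A)
    (f := fun C u => h (C.translate u)) (measurable_comp_translate hh).aemeasurable).trans ?_
  simp only [hP.lintegral_translate hh]
  rw [setLIntegral_const, mul_comm]

/-- Classes in L² are defined only almost everywhere; by Fubini and stationarity an almost sure
property still holds at almost every point of almost every orbit, so it can be integrated over cubes
of translations. -/
theorem IsStationary.ae_ae_translate {P : Measure (Config d)} [SFinite P]
    (hP : IsStationary P) {p : Config d → Prop} (hp : ∀ᵐ C ∂P, p C) :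
    ∀ᵐ C ∂P, ∀ᵐ u : E d, p (C.translate u) := by
  obtain ⟨S, hS, hSm, hS0⟩ := exists_measurable_superset_of_null (ae_iff.1 hp)
  have h1 := hP.lintegral_setLIntegral (h := S.indicator 1) (measurable_one.indicator hSm) Set.univ
  rw [lintegral_indicator_one hSm, hS0, mul_zero, lintegral_eq_zero_iff
    (measurable_setLIntegral_translate (measurable_one.indicator hSm) _)] at h1
  filter_upwards [h1] with C hC
  simp only [Measure.restrict_univ, Pi.zero_apply] at hC
  have hC' := (lintegral_eq_zero_iff (f := fun u : E d => S.indicator (1 : Config d → ℝ≥0∞)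
    (C.translate u)) ((measurable_comp_translate
    (measurable_one.indicator hSm)).comp measurable_prodMk_left)).1 hC
  filter_upwards [hC'] with u hu
  by_contra hcon
  have : C.translate u ∈ S := hS hcon
  simp [this] at hu

/-- The weak type inequality for averages over cubes, for the action of translations. -/
theorem IsStationary.maximal_inequality {P : Measure (Config d)} [IsProbabilityMeasure P]
    (hP : IsStationary P) {h : Config d → ℝ≥0∞} (hh : Measurable h) (c : ℝ≥0∞) :
    c * P {C | ∃ n : ℕ, 1 ≤ n ∧ c * (n : ℝ≥0∞) ^ d ≤ ∫⁻ u in cube d n, h (C.translate u)} ≤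
      coverConst d * ∫⁻ C, h C ∂P := by
  -- Bounding the sides of the cubes by L makes the Vitali covering available; the bound obtained
  -- does not depend on L.
  set S : ℕ → Set (Config d) := fun L => {C | ∃ n : ℕ, 1 ≤ n ∧ n ≤ L ∧
    c * (n : ℝ≥0∞) ^ d ≤ ∫⁻ u in cube d n, h (C.translate u)} with hSdef
  have hSm : ∀ L, MeasurableSet (S L) := fun L => by
    simp only [hSdef, Set.ofPred_exists]
    refine MeasurableSet.iUnion fun n => (MeasurableSet.const _).inter ((MeasurableSet.const _).inter ?_)
    exact measurableSet_le measurable_const (measurable_setLIntegral_translate hh _)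
  have hfin : ∀ L, c * P (S L) ≤ coverConst d * ∫⁻ C, h C ∂P := by
    intro L
    -- Transference: the deterministic covering inequality is applied along the orbit of C inside a
    -- cube of side T and then averaged, each translate having the same law. The boundary term is
    -- negligible after division by T^d as T tends to infinity.
    have h1 : ∀ T : ℕ, (T : ℝ≥0∞) ^ d * (c * P (S L)) ≤
        ENNReal.ofReal (T + 2 * ((d + 1) * L)) ^ d * (coverConst d * ∫⁻ C, h C ∂P) := by
      intro T
      have h2 := hP.lintegral_setLIntegral (h := (S L).indicator 1)
        (measurable_one.indicator (hSm L)) (cube d T)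
      rw [lintegral_indicator_one (hSm L), volume_cube, ENNReal.ofReal_natCast] at h2
      rw [mul_left_comm, ← h2, ← lintegral_const_mul _
        (measurable_setLIntegral_translate (measurable_one.indicator (hSm L)) _)]
      calc _ ≤ ∫⁻ C, coverConst d *
            (∫⁻ v in cube d (T + 2 * ((d + 1) * L)), h (C.translate v)) ∂P := by
            refine lintegral_mono fun C => ?_
            have hm : MeasurableSet {u : E d | C.translate u ∈ S L} :=
              (Config.measurable_translate_prod.comp measurable_prodMk_right) (hSm L)
            have h3 : ∫⁻ u in cube d T, (S L).indicator (1 : Config d → ℝ≥0∞) (C.translate u) =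
                volume ({u : E d | C.translate u ∈ S L} ∩ cube d T) := by
              rw [← Measure.restrict_apply hm, ← lintegral_indicator_one hm]
              rfl
            rw [h3]
            refine mul_volume_le_of_large_averages (fun v => h (C.translate v)) c T L _
              Set.inter_subset_right ?_
            rintro u ⟨⟨n, hn1, hnL, hn⟩, -⟩
            refine ⟨n, hn1, hnL, hn.trans_eq ?_⟩
            simp only [Config.translate_translate]
        _ = _ := by
            rw [lintegral_const_mul _ (measurable_setLIntegral_translate hh _),
              hP.lintegral_setLIntegral hh, volume_cube]
            ring
    have ht : Tendsto (fun T : ℕ => ENNReal.ofReal ((T + 2 * ((d + 1) * L)) / T) ^ d *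
        (coverConst d * ∫⁻ C, h C ∂P)) atTop
        (𝓝 (ENNReal.ofReal 1 ^ d * (coverConst d * ∫⁻ C, h C ∂P))) := by
      refine ENNReal.Tendsto.mul_const (((ENNReal.continuous_pow d).tendsto _).comp
        ((ENNReal.continuous_ofReal.tendsto 1).comp ?_)) (Or.inl (by simp))
      have h4 : Tendsto (fun T : ℕ => 1 + 2 * ((d + 1 : ℝ) * L) / T) atTop (𝓝 (1 + 0)) :=
        (tendsto_const_nhds).add (tendsto_const_div_atTop_nhds_zero_nat _)
      rw [add_zero] at h4
      refine h4.congr' ?_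
      filter_upwards [eventually_ge_atTop 1] with T hT
      have : (T : ℝ) ≠ 0 := by positivity
      field_simp
    rw [ENNReal.ofReal_one, one_pow, one_mul] at ht
    refine ge_of_tendsto ht ?_
    filter_upwards [eventually_ge_atTop 1] with T hT
    have hT0 : (0 : ℝ) < T := by positivity
    have hT1 : (T : ℝ≥0∞) ^ d ≠ 0 := by simp; omega
    have hT2 : (T : ℝ≥0∞) ^ d ≠ ∞ := by simp
    rw [← ENNReal.mul_le_mul_iff_right hT1 hT2]
    refine (h1 T).trans_eq ?_
    rw [← mul_assoc ((T : ℝ≥0∞) ^ d), ← mul_pow, ← ENNReal.ofReal_natCast T,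
      ← ENNReal.ofReal_mul hT0.le, mul_div_cancel₀ _ hT0.ne']
  have hU : {C | ∃ n : ℕ, 1 ≤ n ∧ c * (n : ℝ≥0∞) ^ d ≤ ∫⁻ u in cube d n, h (C.translate u)} =
      ⋃ L, S L := by
    ext C
    simp only [hSdef, Set.mem_ofPred_eq, Set.mem_iUnion]
    exact ⟨fun ⟨n, h1, h2⟩ => ⟨n, n, h1, le_rfl, h2⟩, fun ⟨_, n, h1, _, h2⟩ => ⟨n, h1, h2⟩⟩
  have hmono : Monotone S := fun L L' hL C ⟨n, h1, h2, h3⟩ => ⟨n, h1, h2.trans hL, h3⟩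
  rw [hU, hmono.measure_iUnion, ENNReal.mul_iSup]
  exact iSup_le hfin

/-! ### An invariant function below the density -/

/-- The functions whose averages over cubes are controlled by the number of points, with the same
mean as `pairing (mollifier d)`. -/
def countDominated (P : Measure (Config d)) : Set (Lp ℝ 2 P) :=
  {h | ∫ C, h C ∂P = ∫ C, C.pairing (mollifier d) ∂P ∧ ∃ L : ℕ, ∀ᵐ C ∂P, ∀ n : ℕ,
    ∫⁻ u in cube d n, ENNReal.ofReal (h (C.translate u)) ≤ C.count (cube d ((n + L : ℕ) : ℝ))}

theorem measurable_ofReal_Lp {P : Measure (Config d)} (h : Lp ℝ 2 P) :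
    Measurable fun C => ENNReal.ofReal (h C) :=
  (Lp.stronglyMeasurable h).measurable.ennreal_ofReal

theorem convex_countDominated {P : Measure (Config d)} [IsProbabilityMeasure P]
    (hP : IsStationary P) : Convex ℝ (countDominated P) := by
  rintro h₁ ⟨hi₁, L₁, hL₁⟩ h₂ ⟨hi₂, L₂, hL₂⟩ a b ha hb hab
  have hco : ⇑(a • h₁ + b • h₂) =ᵐ[P] fun C => a * h₁ C + b * h₂ C := by
    filter_upwards [Lp.coeFn_add (a • h₁) (b • h₂), Lp.coeFn_smul a h₁, Lp.coeFn_smul b h₂]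
      with C e1 e2 e3
    rw [e1, Pi.add_apply, e2, e3]
    simp
  have hI : ∀ h : Lp ℝ 2 P, Integrable h P := fun h =>
    (Lp.memLp h).integrable one_le_two
  refine ⟨?_, max L₁ L₂, ?_⟩
  · rw [integral_congr_ae hco, integral_add ((hI h₁).const_mul a) ((hI h₂).const_mul b),
      integral_const_mul, integral_const_mul, hi₁, hi₂, ← add_mul, hab, one_mul]
  · filter_upwards [hP.ae_ae_translate hco, hL₁, hL₂] with C hC h1 h2 n
    have hm : ∀ h : Lp ℝ 2 P, Measurable fun u : E d => ENNReal.ofReal (h (C.translate u)) :=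
      fun h => (measurable_comp_translate (measurable_ofReal_Lp h)).comp measurable_prodMk_left
    calc ∫⁻ u in cube d n, ENNReal.ofReal ((a • h₁ + b • h₂ : Lp ℝ 2 P) (C.translate u))
        ≤ ∫⁻ u in cube d n, (ENNReal.ofReal a * ENNReal.ofReal (h₁ (C.translate u)) +
            ENNReal.ofReal b * ENNReal.ofReal (h₂ (C.translate u))) := by
          refine lintegral_mono_ae (ae_restrict_of_ae ?_)
          filter_upwards [hC] with u hu
          rw [hu, ← ENNReal.ofReal_mul ha, ← ENNReal.ofReal_mul hb]
          exact ENNReal.ofReal_add_le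
      _ = ENNReal.ofReal a * (∫⁻ u in cube d n, ENNReal.ofReal (h₁ (C.translate u))) +
            ENNReal.ofReal b * ∫⁻ u in cube d n, ENNReal.ofReal (h₂ (C.translate u)) := by
          rw [lintegral_add_left ((hm h₁).const_mul _), lintegral_const_mul _ (hm h₁),
            lintegral_const_mul _ (hm h₂)]
      _ ≤ ENNReal.ofReal a * C.count (cube d ((n + max L₁ L₂ : ℕ) : ℝ)) +
            ENNReal.ofReal b * C.count (cube d ((n + max L₁ L₂ : ℕ) : ℝ)) := by
          gcongr
          · refine (h1 n).trans (C.count_mono (cube_mono ?_))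
            exact_mod_cast Nat.add_le_add_left (le_max_left _ _) n
          · refine (h2 n).trans (C.count_mono (cube_mono ?_))
            exact_mod_cast Nat.add_le_add_left (le_max_right _ _) n
      _ = C.count (cube d ((n + max L₁ L₂ : ℕ) : ℝ)) := by
          rw [← add_mul, ← ENNReal.ofReal_add ha hb, hab, ENNReal.ofReal_one, one_mul]

/-- The action of translations on square integrable functions. -/
def koopman {P : Measure (Config d)} (hP : IsStationary P) (v : E d) :
    Lp ℝ 2 P →ₗᵢ[ℝ] Lp ℝ 2 P :=
  Lp.compMeasurePreservingₗᵢ ℝ (Config.translate v) (hP.measurePreserving v)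

theorem koopman_coeFn {P : Measure (Config d)} (hP : IsStationary P) (v : E d) (h : Lp ℝ 2 P) :
    koopman hP v h =ᵐ[P] fun C => h (C.translate v) :=
  Lp.coeFn_compMeasurePreserving h (hP.measurePreserving v)

/-- Translating by v moves a cube by at most ‖v‖ in each direction, which a margin increased by m ≥
2‖v‖ absorbs. Allowing an arbitrary margin L in the definition of the set is what makes it
invariant. -/
theorem koopman_mapsTo {P : Measure (Config d)} [IsProbabilityMeasure P] (hP : IsStationary P)
    (v : E d) : Set.MapsTo (koopman hP v) (countDominated P) (countDominated P) := by
  rintro h ⟨hi, L, hL⟩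
  obtain ⟨m, hm⟩ := exists_nat_ge (2 * ‖v‖)
  refine ⟨?_, m + L, ?_⟩
  · rw [integral_congr_ae (koopman_coeFn hP v h), ← hi]
    have h1 := integral_map (μ := P) (measurable_translate v).aemeasurable
      (f := h) (Lp.stronglyMeasurable h).aestronglyMeasurable
    rw [← h1, hP v]
  · filter_upwards [hP.ae_ae_translate (koopman_coeFn hP v h), hL] with C hC h1 n
    calc ∫⁻ u in cube d n, ENNReal.ofReal (koopman hP v h (C.translate u))
        = ∫⁻ u in cube d n, ENNReal.ofReal (h (C.translate (u + v))) := by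
          refine lintegral_congr_ae (ae_restrict_of_ae ?_)
          filter_upwards [hC] with u hu
          rw [hu, Config.translate_translate]
      _ ≤ ∫⁻ u in cube d ((n + m : ℕ) : ℝ), ENNReal.ofReal (h (C.translate u)) := by
          rw [← lintegral_indicator (measurableSet_cube _),
            ← lintegral_indicator (measurableSet_cube _),
            ← lintegral_add_right_eq_self (fun u => (cube d ((n + m : ℕ) : ℝ)).indicator
              (fun u => ENNReal.ofReal (h (C.translate u))) u) v]
          refine lintegral_mono fun u => ?_
          by_cases hu : u ∈ cube d n
          · rw [Set.indicator_of_mem hu, Set.indicator_of_mem]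
            have := sub_mem_cube hu (u := -v) (r := ‖v‖) (by simp)
            rw [sub_neg_eq_add] at this
            refine cube_mono ?_ this
            push_cast
            linarith
          · rw [Set.indicator_of_notMem hu]
            exact zero_le
      _ ≤ C.count (cube d ((n + (m + L) : ℕ) : ℝ)) := by
          rw [← add_assoc]
          exact h1 _

theorem pairing_toLp_mem_countDominated {P : Measure (Config d)} [IsProbabilityMeasure P]
    (hP : IsStationary P) (hf : MemLp (fun C : Config d => C.pairing (mollifier d)) 2 P) :
    hf.toLp ∈ countDominated P := by
  refine ⟨integral_congr_ae hf.coeFn_toLp, 1, ?_⟩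
  filter_upwards [hP.ae_ae_translate hf.coeFn_toLp] with C hC n
  calc _ = ∫⁻ u in cube d n, ENNReal.ofReal ((C.translate u).pairing (mollifier d)) := by
        refine lintegral_congr_ae (ae_restrict_of_ae ?_)
        filter_upwards [hC] with u hu
        rw [hu]
    _ ≤ _ := by
        push_cast
        exact setLIntegral_pairing_le_count C n

/-- A translation invariant function in the closure of `countDominated P`. -/
theorem exists_invariant_mem_closure {P : Measure (Config d)} [IsProbabilityMeasure P]
    (hP : IsStationary P) (hf : MemLp (fun C : Config d => C.pairing (mollifier d)) 2 P) :
    ∃ g ∈ closure (countDominated P), ∀ v, koopman hP v g = g := by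
  have hne : (closure (countDominated P)).Nonempty :=
    ⟨_, subset_closure (pairing_toLp_mem_countDominated hP hf)⟩
  have hconv := (convex_countDominated hP).closure
  -- The mean ergodic theorem by convexity: the translations are isometries preserving this closed
  -- convex set, so they fix its unique element of least norm.
  obtain ⟨g, hg, hmin⟩ := exists_norm_eq_iInf_of_complete_convex hne isClosed_closure.isComplete
    hconv 0
  refine ⟨g, hg, fun v => ?_⟩
  have hg' : koopman hP v g ∈ closure (countDominated P) :=
    map_mem_closure (koopman hP v).continuous hg (koopman_mapsTo hP v)
  have hmin' : ‖(0 : Lp ℝ 2 P) - koopman hP v g‖ =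
      ⨅ w : closure (countDominated P), ‖(0 : Lp ℝ 2 P) - w‖ := by
    rw [← hmin, zero_sub, zero_sub, norm_neg, norm_neg, LinearIsometry.norm_map]
  -- Uniqueness of the minimizer: the variational inequalities at g and at its translate add up to
  -- ‖koopman g - g‖² ≤ 0.
  have h1 := (norm_eq_iInf_iff_real_inner_le_zero hconv hg).1 hmin _ hg'
  have h2 := (norm_eq_iInf_iff_real_inner_le_zero hconv hg').1 hmin' _ hg
  rw [zero_sub, inner_neg_left] at h1 h2
  have h3 : inner ℝ (koopman hP v g - g) (koopman hP v g - g) ≤ 0 := by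
    rw [inner_sub_left]
    have h4 : inner ℝ (koopman hP v g) (koopman hP v g - g) =
        -inner ℝ (koopman hP v g) (g - koopman hP v g) := by
      rw [← inner_neg_right, neg_sub]
    rw [h4]
    linarith
  exact sub_eq_zero.1 (real_inner_self_nonpos.1 h3)

theorem lintegral_abs_sub_le {P : Measure (Config d)} [IsProbabilityMeasure P] (g h : Lp ℝ 2 P) :
    ∫⁻ C, ENNReal.ofReal |g C - h C| ∂P ≤ ENNReal.ofReal ‖g - h‖ := by
  have h1 : ∫⁻ C, ENNReal.ofReal |g C - h C| ∂P = eLpNorm (g - h : Lp ℝ 2 P) 1 P := by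
    rw [eLpNorm_one_eq_lintegral_enorm]
    refine lintegral_congr_ae ?_
    filter_upwards [Lp.coeFn_sub g h] with C hC
    rw [hC, Pi.sub_apply, ← Real.norm_eq_abs, ofReal_norm]
  rw [h1, Lp.norm_def, ENNReal.ofReal_toReal (Lp.eLpNorm_ne_top _)]
  exact eLpNorm_le_eLpNorm_of_exponent_le one_le_two (Lp.aestronglyMeasurable _)

/-- An invariant g equals its averages over cubes. Replace g by h in `countDominated` at L² distance
δ: the averages of h are asymptotically at most the density, and those of |g - h| stay below c
outside an event of probability at most `coverConst d` δ / c. Then δ, and finally c, tend to zero.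
-/
theorem ae_ofReal_le_dens {P : Measure (Config d)} [IsProbabilityMeasure P]
    (hP : IsStationary P) {g : Lp ℝ 2 P} (hg : g ∈ closure (countDominated P))
    (hinv : ∀ v, koopman hP v g = g) : ∀ᵐ C ∂P, ENNReal.ofReal (g C) ≤ dens C := by
  have hgm : Measurable g := (Lp.stronglyMeasurable g).measurable
  -- Invariance holds for each translation outside a null set depending on it; Fubini exchanges the
  -- quantifiers.
  have hae : ∀ᵐ C ∂P, ∀ᵐ u : E d, g (C.translate u) = g C := by
    refine (Measure.ae_ae_comm (p := fun (C : Config d) (u : E d) => g (C.translate u) = g C)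
      ?_).2 (ae_of_all _ fun v => ?_)
    · exact measurableSet_eq_fun
        (hgm.comp (Config.measurable_translate_prod.comp measurable_swap)) (hgm.comp measurable_fst)
    · have := koopman_coeFn hP v g
      rw [hinv v] at this
      exact this.symm
  have hlam : ∀ m : ℕ, ∀ᵐ C ∂P, ENNReal.ofReal (g C) ≤ dens C + ((m : ℝ≥0∞) + 1)⁻¹ := by
    intro m
    set c : ℝ≥0∞ := ((m : ℝ≥0∞) + 1)⁻¹ with hc
    have hc0 : c ≠ 0 := by simp [hc]
    rw [ae_iff]
    have hbound : ∀ δ : ℝ, 0 < δ → c * P {C | ¬ ENNReal.ofReal (g C) ≤ dens C + c} ≤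
        coverConst d * ENNReal.ofReal δ := by
      intro δ hδ
      obtain ⟨h, ⟨-, L, hL⟩, hgh⟩ := Metric.mem_closure_iff.1 hg δ hδ
      have hdm : Measurable fun C => ENNReal.ofReal |g C - h C| :=
        (hgm.sub (Lp.stronglyMeasurable h).measurable).abs.ennreal_ofReal
      refine le_trans ?_ ((hP.maximal_inequality hdm c).trans ?_)
      · refine mul_le_mul' le_rfl (measure_mono_ae (μ := P) ?_)
        filter_upwards [hae, hL] with C hC hCL hnot
        by_contra hcon
        apply hnot
        change ¬ ∃ n : ℕ, _ at hcon
        push Not at hcon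
        have hlim : liminf (fun n : ℕ => C.count (cube d ((n + L : ℕ) : ℝ)) / (n : ℝ≥0∞) ^ d + c)
            atTop ≤ dens C + c := by
          rw [liminf_add_const _ _ _ (by isBoundedDefault) (by isBoundedDefault)]
          gcongr
          exact liminf_count_le_dens C L
        refine le_trans (le_liminf_of_le (by isBoundedDefault) ?_) hlim
        filter_upwards [eventually_ge_atTop 1] with n hn
        have hn1 : (n : ℝ≥0∞) ^ d ≠ 0 := by simp; omega
        have hn2 : (n : ℝ≥0∞) ^ d ≠ ∞ := by simp
        rw [← ENNReal.mul_le_mul_iff_left hn1 hn2, add_mul, ENNReal.div_mul_cancel hn1 hn2]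
        calc ENNReal.ofReal (g C) * (n : ℝ≥0∞) ^ d
            = ∫⁻ u in cube d n, ENNReal.ofReal (g (C.translate u)) := by
              rw [← ENNReal.ofReal_natCast n, ← volume_cube, ← setLIntegral_const]
              refine lintegral_congr_ae (ae_restrict_of_ae ?_)
              filter_upwards [hC] with u hu
              rw [hu]
          _ ≤ ∫⁻ u in cube d n, (ENNReal.ofReal (h (C.translate u)) +
                ENNReal.ofReal |g (C.translate u) - h (C.translate u)|) := by
              refine lintegral_mono fun u => ?_
              refine le_trans (ENNReal.ofReal_le_ofReal ?_) ENNReal.ofReal_add_le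
              linarith [le_abs_self (g (C.translate u) - h (C.translate u))]
          _ = (∫⁻ u in cube d n, ENNReal.ofReal (h (C.translate u))) +
                ∫⁻ u in cube d n, ENNReal.ofReal |g (C.translate u) - h (C.translate u)| :=
              lintegral_add_left ((measurable_comp_translate
                (measurable_ofReal_Lp h)).comp measurable_prodMk_left) _
          _ ≤ _ := add_le_add (hCL n) (hcon n hn).le
      · gcongr
        refine (lintegral_abs_sub_le g h).trans (ENNReal.ofReal_le_ofReal ?_)
        rw [← dist_eq_norm]
        exact hgh.le
    have hzero : c * P {C | ¬ ENNReal.ofReal (g C) ≤ dens C + c} ≤ coverConst d * ENNReal.ofReal 0 := by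
      refine ge_of_tendsto (x := 𝓝[>] (0 : ℝ)) (ENNReal.Tendsto.const_mul
        ((ENNReal.continuous_ofReal.tendsto 0).mono_left nhdsWithin_le_nhds)
        (Or.inr coverConst_ne_top)) ?_
      filter_upwards [self_mem_nhdsWithin] with δ hδ using hbound δ hδ
    rw [ENNReal.ofReal_zero, mul_zero, nonpos_iff_eq_zero, mul_eq_zero] at hzero
    exact hzero.resolve_left hc0
  filter_upwards [ae_all_iff.2 hlam] with C hC
  have ht : Tendsto (fun m : ℕ => dens C + ((m : ℝ≥0∞) + 1)⁻¹) atTop (𝓝 (dens C + 0)) := by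
    refine tendsto_const_nhds.add ?_
    have := ENNReal.tendsto_inv_nat_nhds_zero.comp (tendsto_add_atTop_nat 1)
    simpa [Function.comp_def] using this
  rw [add_zero] at ht
  exact ge_of_tendsto' ht hC

theorem integral_le_of_mem_closure {P : Measure (Config d)} [IsProbabilityMeasure P]
    {g : Lp ℝ 2 P} (hg : g ∈ closure (countDominated P)) :
    ∫ C, C.pairing (mollifier d) ∂P ≤ ∫ C, g C ∂P := by
  refine le_of_forall_pos_le_add fun δ hδ => ?_
  obtain ⟨h, ⟨hi, -⟩, hgh⟩ := Metric.mem_closure_iff.1 hg δ hδ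
  have hI : ∀ h : Lp ℝ 2 P, Integrable h P := fun h => (Lp.memLp h).integrable one_le_two
  rw [← hi, ← sub_le_iff_le_add', ← integral_sub (hI h) (hI g)]
  have h1 : ∫ C, (h C - g C) ∂P ≤ ∫ C, |g C - h C| ∂P := by
    refine integral_mono ((hI h).sub (hI g)) ((hI g).sub (hI h)).abs fun C => ?_
    exact (neg_sub (g C) (h C)) ▸ neg_le_abs (g C - h C)
  refine h1.trans ?_
  have hI' : Integrable (fun C => |g C - h C|) P := ((hI g).sub (hI h)).abs
  rw [← ENNReal.ofReal_le_ofReal_iff hδ.le, ofReal_integral_eq_lintegral_ofReal hI' (ae_of_all _ fun _ => abs_nonneg _)]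
  refine (lintegral_abs_sub_le g h).trans (ENNReal.ofReal_le_ofReal ?_)
  rw [← dist_eq_norm]
  exact hgh.le

/-- The intensity of a stationary process with locally square integrable number of points is the
mean number of points per unit volume. -/
theorem IsStationary.intens_eq {P : Measure (Config d)} [IsProbabilityMeasure P]
    (hP : IsStationary P)
    (hf : ∫⁻ C, ENNReal.ofReal (C.pairing (mollifier d)) ^ 2 ∂P < ∞) :
    intens P = ∫⁻ C, ENNReal.ofReal (C.pairing (mollifier d)) ∂P := by
  have hmeas : Measurable fun C : Config d => C.pairing (mollifier d) :=
    (Config.continuous_pairing _).measurable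
  have hnn : ∀ C : Config d, 0 ≤ C.pairing (mollifier d) :=
    fun C => C.pairing_nonneg mollifier_nonneg
  have hL : MemLp (fun C : Config d => C.pairing (mollifier d)) 2 P := by
    refine ⟨hmeas.aestronglyMeasurable, ?_⟩
    rw [eLpNorm_lt_top_iff_lintegral_rpow_enorm_lt_top two_ne_zero ENNReal.ofNat_ne_top]
    refine lt_of_eq_of_lt (lintegral_congr fun C => ?_) hf
    rw [← ofReal_norm, Real.norm_of_nonneg (hnn C)]
    simp
  apply le_antisymm
  -- Upper bound: counts are dominated by integrals of the smoothed count over slightly larger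
  -- cubes, whose means are exact by stationarity; Fatou's lemma concludes.
  · have hm := hmeas.ennreal_ofReal
    have hF : ∀ n : ℕ, 1 ≤ n → (∫⁻ C, (∫⁻ u in cube d (n + 1),
        ENNReal.ofReal ((C.translate u).pairing (mollifier d))) / (n : ℝ≥0∞) ^ d ∂P) =
        ENNReal.ofReal ((n + 1) / n) ^ d * ∫⁻ C, ENNReal.ofReal (C.pairing (mollifier d)) ∂P := by
      intro n hn
      have hn0 : (0 : ℝ) < n := by positivity
      simp only [div_eq_mul_inv]
      rw [lintegral_mul_const _ (measurable_setLIntegral_translate hm _),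
        hP.lintegral_setLIntegral hm, volume_cube, ENNReal.ofReal_mul (by positivity),
        ENNReal.ofReal_inv_of_pos hn0, mul_pow, ENNReal.ofReal_natCast, ENNReal.inv_pow]
      ring
    calc intens P ≤ ∫⁻ C, liminf (fun n : ℕ => (∫⁻ u in cube d (n + 1),
          ENNReal.ofReal ((C.translate u).pairing (mollifier d))) / (n : ℝ≥0∞) ^ d) atTop ∂P := by
          refine lintegral_mono fun C => (dens_le_liminf_nat C).trans (liminf_le_liminf ?_)
          refine Eventually.of_forall fun n => ?_
          gcongr
          exact count_le_setLIntegral_pairing C n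
      _ ≤ liminf (fun n : ℕ => ∫⁻ C, (∫⁻ u in cube d (n + 1),
          ENNReal.ofReal ((C.translate u).pairing (mollifier d))) / (n : ℝ≥0∞) ^ d ∂P) atTop :=
          lintegral_liminf_le fun n => (measurable_setLIntegral_translate hm _).div_const _
      _ = liminf (fun n : ℕ => ENNReal.ofReal ((n + 1) / n) ^ d *
            ∫⁻ C, ENNReal.ofReal (C.pairing (mollifier d)) ∂P) atTop := by
          refine liminf_congr ?_
          filter_upwards [eventually_ge_atTop 1] with n hn using hF n hn
      _ = ENNReal.ofReal 1 ^ d * ∫⁻ C, ENNReal.ofReal (C.pairing (mollifier d)) ∂P := by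
          refine Tendsto.liminf_eq (ENNReal.Tendsto.mul_const (((ENNReal.continuous_pow d).tendsto
            _).comp ((ENNReal.continuous_ofReal.tendsto 1).comp ?_)) (Or.inl (by simp)))
          have h4 : Tendsto (fun n : ℕ => 1 + (1 : ℝ) / n) atTop (𝓝 (1 + 0)) :=
            tendsto_const_nhds.add (tendsto_const_div_atTop_nhds_zero_nat _)
          rw [add_zero] at h4
          refine h4.congr' ?_
          filter_upwards [eventually_ge_atTop 1] with n hn
          have : (n : ℝ) ≠ 0 := by positivity
          field_simp
      _ = _ := by simp
  -- Lower bound: Fatou's lemma goes the wrong way here, and the invariant function g below the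
  -- density replaces it.
  · obtain ⟨g, hg, hinv⟩ := exists_invariant_mem_closure hP hL
    have hI : Integrable g P := (Lp.memLp g).integrable one_le_two
    rw [← ofReal_integral_eq_lintegral_ofReal (hL.integrable one_le_two) (ae_of_all _ hnn)]
    calc ENNReal.ofReal (∫ C, C.pairing (mollifier d) ∂P)
        ≤ ENNReal.ofReal (∫ C, g C ∂P) := ENNReal.ofReal_le_ofReal (integral_le_of_mem_closure hg)
      _ ≤ ∫⁻ C, ENNReal.ofReal (g C) ∂P := by
          rw [integral_eq_lintegral_pos_part_sub_lintegral_neg_part hI]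
          refine (ENNReal.ofReal_le_ofReal (sub_le_self _ ENNReal.toReal_nonneg)).trans ?_
          exact ENNReal.ofReal_toReal_le
      _ ≤ intens P := lintegral_mono_ae (ae_ofReal_le_dens hP hg hinv)

/-! ### Off-diagonal sums -/

theorem tsum_iSup_of_monotone {α : Type*} {f : ℕ → α → ℝ≥0∞} (hf : Monotone f) :
    ∑' a, ⨆ n, f n a = ⨆ n, ∑' a, f n a := by
  simp only [ENNReal.tsum_eq_iSup_sum]
  rw [iSup_comm]
  exact iSup_congr fun s => ENNReal.finsetSum_iSup_of_monotone fun a _ _ h => hf h a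

/-- The test function `p ↦ ψ (p, p)`. -/
def diag (ψ : C_c(E d × E d, ℝ)) : C_c(E d, ℝ) :=
  ⟨⟨fun p => ψ (p, p), by fun_prop⟩, by
    obtain ⟨R, hR⟩ := exists_support_prod ψ
    refine HasCompactSupport.of_support_subset_isCompact (isCompact_closedBall (0 : E d) R)
      fun p hp => ?_
    by_contra h
    rw [mem_closedBall_zero_iff, not_le] at h
    exact hp (hR p p (Or.inl h))⟩

@[simp]
theorem diag_apply (ψ : C_c(E d × E d, ℝ)) (p : E d) : diag ψ p = ψ (p, p) := rfl

/-- The sum of `ψ` over ordered pairs of distinct points of `C`. -/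
def offDiag (ψ : C_c(E d × E d, ℝ)) (C : Config d) : ℝ :=
  doublePairing ψ C - C.pairing (diag ψ)

theorem continuous_offDiag (ψ : C_c(E d × E d, ℝ)) : Continuous (offDiag ψ) :=
  (continuous_doublePairing ψ).sub (Config.continuous_pairing _)

theorem ofReal_pairing_eq_tsum (C : Config d) (φ : C_c(E d, ℝ)) (hφ : ∀ p, 0 ≤ φ p) :
    ENNReal.ofReal (C.pairing φ) = ∑' p, (C.mult p : ℝ≥0∞) * ENNReal.ofReal (φ p) := by
  rw [Config.ofReal_pairing _ _ hφ, Config.lintegral_toMeasure]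

/-- On the diagonal this is m² = m (m - 1) + m, also valid for m = 0 with truncated subtraction. -/
theorem Config.mult_mul_mult (C : Config d) (p q : E d) :
    (C.mult p : ℝ≥0∞) * C.mult q = C.pairs p q + if q = p then (C.mult p : ℝ≥0∞) else 0 := by
  classical
  by_cases h : p = q
  · subst h
    simp only [Config.pairs, if_true]
    norm_cast
    rcases C.mult p with _ | m
    · simp
    · simp [Nat.mul_succ]
  · simp [Config.pairs, h, Ne.symm h]

/-- Subtracting the diagonal pairing removes one self-pair per point and keeps the pairs of distinct
points at the same location. The real expression is continuous in C; this identifies it with the sum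
defining the energy. -/
theorem ofReal_offDiag (ψ : C_c(E d × E d, ℝ)) (hψ : ∀ z, 0 ≤ ψ z) (C : Config d) :
    ENNReal.ofReal (offDiag ψ C) =
      ∑' p, ∑' q, (C.pairs p q : ℝ≥0∞) * ENNReal.ofReal (ψ (p, q)) := by
  classical
  have h1 : ENNReal.ofReal (doublePairing ψ C) =
      (∑' p, ∑' q, (C.pairs p q : ℝ≥0∞) * ENNReal.ofReal (ψ (p, q))) +
        ENNReal.ofReal (C.pairing (diag ψ)) := by
    rw [doublePairing, ofReal_pairing_eq_tsum _ _ fun p => C.pairing_nonneg fun q => hψ _,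
      ofReal_pairing_eq_tsum _ _ fun p => hψ _, ← ENNReal.tsum_add]
    refine tsum_congr fun p => ?_
    rw [integrateSnd_apply, ofReal_pairing_eq_tsum _ _ fun q => hψ _, ← ENNReal.tsum_mul_left]
    have h2 : (C.mult p : ℝ≥0∞) * ENNReal.ofReal (diag ψ p) =
        ∑' q, (if q = p then (C.mult p : ℝ≥0∞) else 0) * ENNReal.ofReal (ψ (p, q)) := by
      rw [tsum_eq_single p fun q hq => by simp [hq]]
      simp
    rw [h2, ← ENNReal.tsum_add]
    refine tsum_congr fun q => ?_
    rw [← add_mul, ← C.mult_mul_mult, mul_assoc, slice_apply]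
  rw [offDiag, ENNReal.ofReal_sub _ (C.pairing_nonneg fun p => hψ _), h1,
    ENNReal.add_sub_cancel_right ENNReal.ofReal_ne_top]

theorem offDiag_ofPoints {N : ℕ} (ψ : C_c(E d × E d, ℝ)) (x : Fin N → E d) :
    offDiag ψ (Config.ofPoints x) =
      ∑ i, ∑ j ∈ Finset.univ.filter (fun j => i ≠ j), ψ (x i, x j) := by
  classical
  simp only [offDiag, doublePairing, Config.pairing_ofPoints, integrateSnd_apply, diag_apply,
    slice_apply]
  rw [← Finset.sum_sub_distrib]
  refine Finset.sum_congr rfl fun i _ => ?_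
  rw [Finset.filter_ne, ← Finset.add_sum_erase _ _ (Finset.mem_univ i), add_sub_cancel_left]

/-! ### Truncated Riesz interaction -/

/-- A continuous function equal to one on `cube d R` and to zero outside `cube d (R + 2)`. -/
def cubeCutoff (R : ℝ) (p : E d) : ℝ := max 0 (min 1 (R / 2 + 1 - ‖WithLp.ofLp p‖))

theorem continuous_cubeCutoff (R : ℝ) : Continuous (cubeCutoff (d := d) R) := by
  unfold cubeCutoff
  have : Continuous fun p : E d => WithLp.ofLp p := PiLp.continuous_ofLp 2 _
  fun_prop

theorem cubeCutoff_nonneg (R : ℝ) (p : E d) : 0 ≤ cubeCutoff R p := le_max_left _ _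

theorem cubeCutoff_le_one (R : ℝ) (p : E d) : cubeCutoff R p ≤ 1 :=
  max_le zero_le_one (min_le_left _ _)

theorem cubeCutoff_eq_one {R : ℝ} (hR : 0 ≤ R) {p : E d} (hp : p ∈ cube d R) :
    cubeCutoff R p = 1 := by
  have : ‖WithLp.ofLp p‖ ≤ R / 2 := (pi_norm_le_iff_of_nonneg (by positivity)).2 hp
  rw [cubeCutoff, min_eq_left (by linarith), max_eq_right zero_le_one]

theorem mem_cube_of_cubeCutoff_ne_zero {R : ℝ} {p : E d} (hp : cubeCutoff R p ≠ 0) :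
    p ∈ cube d (R + 2) := by
  have h : ‖WithLp.ofLp p‖ ≤ R / 2 + 1 := by
    by_contra h
    exact hp (max_eq_left ((min_le_right _ _).trans (by linarith)))
  intro i
  have := (norm_le_pi_norm (WithLp.ofLp p) i).trans h
  rw [Real.norm_eq_abs] at this
  linarith

theorem isCompact_cube (R : ℝ) : IsCompact (cube d R) := by
  refine Metric.isCompact_of_isClosed_isBounded (isClosed_cube R) ?_
  exact (Metric.isBounded_closedBall (x := (0 : E d)) (r := d * (R / 2))).subset fun p hp =>
    mem_closedBall_zero_iff.2 (norm_le_of_mem_cube hp)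

theorem continuous_rieszKernel (s : ℝ) :
    Continuous fun z : E d × E d => rieszKernel s z.1 z.2 := by
  unfold rieszKernel
  exact (ENNReal.continuous_rpow_const).comp (continuous_fst.edist continuous_snd)

/-- The interaction `χ(p) χ(q) min(M, |p - q|^{-s})` with `χ` a cutoff on the cube of side `R`. -/
def truncKernel (s R : ℝ) (M : ℕ) : C_c(E d × E d, ℝ) :=
  ⟨⟨fun z => cubeCutoff R z.1 * cubeCutoff R z.2 *
      (min (M : ℝ≥0∞) (rieszKernel s z.1 z.2)).toReal, by
    refine (((continuous_cubeCutoff R).comp continuous_fst).mul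
      ((continuous_cubeCutoff R).comp continuous_snd)).mul ?_
    refine continuous_iff_continuousAt.2 fun z => ?_
    exact (ENNReal.tendsto_toReal (ne_top_of_le_ne_top (ENNReal.natCast_ne_top M)
      (min_le_left _ _))).comp (continuous_const.min (continuous_rieszKernel s)).continuousAt⟩, by
    refine HasCompactSupport.of_support_subset_isCompact
      ((isCompact_cube (R + 2)).prod (isCompact_cube (R + 2))) fun z hz => ?_
    replace hz : cubeCutoff R z.1 * cubeCutoff R z.2 *
      (min (M : ℝ≥0∞) (rieszKernel s z.1 z.2)).toReal ≠ 0 := hz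
    exact ⟨mem_cube_of_cubeCutoff_ne_zero (left_ne_zero_of_mul (left_ne_zero_of_mul hz)),
      mem_cube_of_cubeCutoff_ne_zero (right_ne_zero_of_mul (left_ne_zero_of_mul hz))⟩⟩

theorem truncKernel_apply (s R : ℝ) (M : ℕ) (z : E d × E d) :
    truncKernel s R M z = cubeCutoff R z.1 * cubeCutoff R z.2 *
      (min (M : ℝ≥0∞) (rieszKernel s z.1 z.2)).toReal := rfl

theorem truncKernel_nonneg (s R : ℝ) (M : ℕ) (z : E d × E d) : 0 ≤ truncKernel s R M z :=
  mul_nonneg (mul_nonneg (cubeCutoff_nonneg _ _) (cubeCutoff_nonneg _ _)) ENNReal.toReal_nonneg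

theorem ofReal_toReal_min (M : ℕ) (a : ℝ≥0∞) :
    ENNReal.ofReal (min (M : ℝ≥0∞) a).toReal = min (M : ℝ≥0∞) a :=
  ENNReal.ofReal_toReal (ne_top_of_le_ne_top (ENNReal.natCast_ne_top M) (min_le_left _ _))

theorem truncKernel_mono (s R : ℝ) (z : E d × E d) : Monotone fun M : ℕ => truncKernel s R M z := by
  intro M M' h
  have hM : (M : ℝ≥0∞) ≤ M' := by exact_mod_cast h
  simp only [truncKernel_apply]
  refine mul_le_mul_of_nonneg_left ?_ (mul_nonneg (cubeCutoff_nonneg _ _) (cubeCutoff_nonneg _ _))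
  exact ENNReal.toReal_mono (ne_top_of_le_ne_top (ENNReal.natCast_ne_top M') (min_le_left _ _))
    (min_le_min_right _ hM)

theorem ofReal_truncKernel_le (s R : ℝ) (M : ℕ) (p q : E d) :
    ENNReal.ofReal (truncKernel s R M (p, q)) ≤
      (cube d (R + 2)).indicator (fun _ => rieszKernel s p q) p := by
  by_cases hp : p ∈ cube d (R + 2)
  · rw [Set.indicator_of_mem hp]
    refine le_trans (ENNReal.ofReal_le_ofReal ?_) ((ofReal_toReal_min M _).trans_le (min_le_right _ _))
    rw [truncKernel_apply]
    exact mul_le_of_le_one_left ENNReal.toReal_nonneg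
      (mul_le_one₀ (cubeCutoff_le_one _ _) (cubeCutoff_nonneg _ _) (cubeCutoff_le_one _ _))
  · have : cubeCutoff R p = 0 := by
      by_contra h
      exact hp (mem_cube_of_cubeCutoff_ne_zero h)
    simp [truncKernel_apply, this]

/-- Monotone convergence in the truncation level. At a multiple point the truncated kernel has the
supremum of the truncation of `rieszKernel` there, so an infinite value of the kernel is recovered
as well. -/
theorem interaction_le_iSup (s : ℝ) {R : ℝ} (hR : 0 ≤ R) (C : Config d) :
    interaction s (cube d R) (cube d R) C ≤
      ⨆ M : ℕ, ENNReal.ofReal (offDiag (truncKernel s R M) C) := by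
  have hmono : ∀ p q : E d, Monotone fun M : ℕ =>
      (C.pairs p q : ℝ≥0∞) * ENNReal.ofReal (truncKernel s R M (p, q)) := fun p q M M' h =>
    mul_le_mul_right (ENNReal.ofReal_le_ofReal (truncKernel_mono s R (p, q) h)) _
  simp only [ofReal_offDiag _ (truncKernel_nonneg s R _)]
  rw [← tsum_iSup_of_monotone fun M M' h p => ENNReal.tsum_le_tsum fun q => hmono p q h]
  simp only [← tsum_iSup_of_monotone fun M M' h q => hmono _ q h]
  refine le_trans ?_ (ENNReal.tsum_comp_le_tsum_of_injective
    (Subtype.val_injective (p := fun p => p ∈ cube d R)) _)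
  refine ENNReal.tsum_le_tsum fun p => ?_
  refine le_trans ?_ (ENNReal.tsum_comp_le_tsum_of_injective
    (Subtype.val_injective (p := fun p => p ∈ cube d R)) _)
  refine ENNReal.tsum_le_tsum fun q => ?_
  simp only [truncKernel_apply, cubeCutoff_eq_one hR p.2, cubeCutoff_eq_one hR q.2, one_mul,
    ofReal_toReal_min, ← ENNReal.mul_iSup]
  refine mul_le_mul_right ?_ _
  refine le_of_forall_lt fun y hy => ?_
  obtain ⟨M, hM⟩ := ENNReal.exists_nat_gt (hy.trans_le le_top).ne
  exact lt_iSup_iff.2 ⟨M, lt_min hM hy⟩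

variable {Ω : Set (E d)}

/-! ### Estimates on the rescaled configurations -/

/-- The length scale `N^{1/d}`. -/
def scale (d N : ℕ) : ℝ := (N : ℝ) ^ (1 / d : ℝ)

theorem scale_pos {N : ℕ} (hN : 1 ≤ N) : 0 < scale d N :=
  Real.rpow_pos_of_pos (by exact_mod_cast hN) _

theorem scale_pow (hd : 1 ≤ d) (N : ℕ) : scale d N ^ d = N := by
  rw [scale, ← Real.rpow_natCast, ← Real.rpow_mul (Nat.cast_nonneg N), one_div,
    inv_mul_cancel₀ (by positivity), Real.rpow_one]

theorem tendsto_scale (hd : 1 ≤ d) : Tendsto (scale d) atTop atTop :=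
  (tendsto_rpow_atTop (by positivity)).comp tendsto_natCast_atTop_atTop

/-- The microscopic positions of the points. -/
def micro {N : ℕ} (x : Fin N → Ω) (i : Fin N) : E d := scale d N • (x i : E d)

theorem rescaled_eq {N : ℕ} (x : Fin N → Ω) : rescaled x = Config.ofPoints (micro x) := rfl

theorem lintegral_comp_scale (hd : 1 ≤ d) {N : ℕ} (hN : 1 ≤ N) (H : E d → ℝ≥0∞) :
    ∫⁻ y, H (scale d N • y) = (N : ℝ≥0∞)⁻¹ * ∫⁻ z, H z := by
  have h0 : scale d N ≠ 0 := (scale_pos hN).ne'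
  have h1 := Measure.map_addHaar_smul (volume : Measure (E d)) h0
  have h2 := lintegral_map_equiv (μ := (volume : Measure (E d))) H
    (Homeomorph.smulOfNeZero (scale d N) h0).toMeasurableEquiv
  have h3 : ⇑(Homeomorph.smulOfNeZero (α := E d) (scale d N) h0).toMeasurableEquiv =
      fun y => scale d N • y := rfl
  rw [h3] at h2
  rw [← h2]
  change ∫⁻ a, H a ∂Measure.map (scale d N • ·) volume = _
  rw [h1, lintegral_smul_measure, finrank_euclideanSpace_fin, scale_pow hd, abs_inv, Nat.abs_cast,
    ENNReal.ofReal_inv_of_pos (by exact_mod_cast hN), ENNReal.ofReal_natCast, smul_eq_mul]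

/-- The interaction energy per point at the microscopic scale. -/
def pairEnergy (s : ℝ) {N : ℕ} (x : Fin N → Ω) : ℝ≥0∞ :=
  (N : ℝ≥0∞)⁻¹ * ∑ i, ∑ j ∈ Finset.univ.filter (fun j => i ≠ j),
    rieszKernel s (micro x i) (micro x j)

theorem rieszKernel_micro (s : ℝ) {N : ℕ} (hN : 1 ≤ N) (x : Fin N → Ω) (i j : Fin N) :
    rieszKernel s (micro x i) (micro x j) =
      (N : ℝ≥0∞) ^ (-(s / d)) * rieszKernel s (x i : E d) (x j : E d) := by
  have hN0 : (0 : ℝ) < N := by exact_mod_cast hN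
  rw [rieszKernel, rieszKernel, micro, micro, edist_smul₀, ENNReal.smul_def, smul_eq_mul,
    ENNReal.mul_rpow_of_ne_top ENNReal.coe_ne_top (edist_ne_top _ _)]
  congr 1
  rw [← enorm_eq_nnnorm, ← ofReal_norm, Real.norm_of_nonneg (scale_pos hN).le,
    ENNReal.ofReal_rpow_of_pos (scale_pos hN), scale, ← Real.rpow_mul hN0.le,
    ← ENNReal.ofReal_rpow_of_pos hN0, ENNReal.ofReal_natCast]
  congr 1
  ring

/-- In the exponent 1 + s/d, the 1 produces the average over points, and s/d is absorbed by the
dilation for the pairs and by the prefactor N^{s/d} for the potential. -/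
theorem energyPerPoint_eq (s : ℝ) (V : Ω → ℝ) {N : ℕ} (hN : 1 ≤ N) (x : Fin N → Ω) :
    energyPerPoint s V x = pairEnergy s x +
      (N : ℝ≥0∞)⁻¹ * ∑ i, ENNReal.ofReal (V (x i)) := by
  have h0 : (N : ℝ≥0∞) ≠ 0 := by simp; omega
  have ht : (N : ℝ≥0∞) ≠ ∞ := ENNReal.natCast_ne_top N
  rw [energyPerPoint, hamiltonian, div_eq_mul_inv, add_mul, ← ENNReal.rpow_neg, pairEnergy]
  simp only [rieszKernel_micro s hN, ← Finset.mul_sum]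
  congr 1
  · rw [← mul_assoc, mul_comm, neg_add, ENNReal.rpow_add _ _ h0 ht, ENNReal.rpow_neg_one]
  · rw [mul_right_comm, ← ENNReal.rpow_add _ _ h0 ht, ← ENNReal.rpow_neg_one]
    congr 2
    ring

theorem lintegral_rescaled_translate {N : ℕ} (x : Fin N → Ω) (u : E d) (f : E d → ℝ≥0∞) :
    ∫⁻ p, f p ∂((rescaled x).translate u).toMeasure = ∑ i, f (micro x i - u) := by
  rw [Config.lintegral_translate, rescaled_eq, Config.lintegral_ofPoints]

/-- Each of the N points contributes ∫ φ in microscopic units, and dy carries the factor 1/N. The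
value does not depend on the points at all, and this yields tightness. -/
theorem lintegral_pairing_rescaled (hd : 1 ≤ d) {N : ℕ} (hN : 1 ≤ N) (x : Fin N → Ω)
    {φ : C_c(E d, ℝ)} (hφ : ∀ p, 0 ≤ φ p) :
    ∫⁻ y : E d, ENNReal.ofReal (((rescaled x).translate (scale d N • y)).pairing φ) =
      ∫⁻ p, ENNReal.ofReal (φ p) := by
  have h0 : (N : ℝ≥0∞) ≠ 0 := by simp; omega
  rw [lintegral_comp_scale hd hN
    (fun z => ENNReal.ofReal (((rescaled x).translate z).pairing φ))]
  simp only [Config.ofReal_pairing _ _ hφ, lintegral_rescaled_translate]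
  rw [lintegral_finsetSum' _ fun i _ => by
    have : Continuous fun u : E d => φ (micro x i - u) := by fun_prop
    exact this.measurable.ennreal_ofReal.aemeasurable]
  simp only [lintegral_sub_left_eq_self (fun u => ENNReal.ofReal (φ u))]
  rw [Finset.sum_const, Finset.card_univ, Fintype.card_fin, nsmul_eq_mul, ← mul_assoc,
    ENNReal.inv_mul_cancel h0 (ENNReal.natCast_ne_top N), one_mul]

theorem one_le_rieszKernel {s : ℝ} (hs : 0 ≤ s) {p q : E d} (h : edist p q ≤ 1) :
    1 ≤ rieszKernel s p q := by
  rw [rieszKernel, ENNReal.rpow_neg, ENNReal.one_le_inv]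
  exact ENNReal.rpow_le_one h hs

/-- A bound for the mollifier. -/
def mollifierBound (d : ℕ) : ℝ := (exists_bound (mollifier d)).choose

theorem mollifier_le (p : E d) : mollifier d p ≤ mollifierBound d :=
  (le_abs_self _).trans ((exists_bound (mollifier d)).choose_spec.2 p)

/-- The square of the smoothed count is a double sum over points within 1/2 of the tag. Such points
are at distance at most 1, so each off-diagonal term is bounded by the kernel of that pair times one
remaining bump, which has integral one. The diagonal gives the summand 1. -/
theorem lintegral_sq_pairing_rescaled_le (hd : 1 ≤ d) {s : ℝ} (hs : 0 ≤ s) {N : ℕ} (hN : 1 ≤ N)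
    (x : Fin N → Ω) :
    ∫⁻ y : E d, ENNReal.ofReal
        (((rescaled x).translate (scale d N • y)).pairing (mollifier d)) ^ 2 ≤
      ENNReal.ofReal (mollifierBound d) * (1 + pairEnergy s x) := by
  classical
  have h0 : (N : ℝ≥0∞) ≠ 0 := by simp; omega
  set B := ENNReal.ofReal (mollifierBound d)
  set e : Fin N → E d → ℝ≥0∞ := fun i u => ENNReal.ofReal (mollifier d (micro x i - u)) with he
  have hem : ∀ i, Measurable (e i) := fun i => by
    have : Continuous fun u : E d => mollifier d (micro x i - u) := by fun_prop
    exact this.measurable.ennreal_ofReal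
  have hei : ∀ i, ∫⁻ u, e i u = 1 := fun i => by
    rw [he, lintegral_sub_left_eq_self (fun u => ENNReal.ofReal (mollifier d u)),
      lintegral_mollifier]
  set w : Fin N → Fin N → ℝ≥0∞ := fun i j =>
    if i ≠ j then rieszKernel s (micro x i) (micro x j) else 1 with hw
  have hle : ∀ i j u, e i u * e j u ≤ B * w i j * e i u := by
    intro i j u
    rw [mul_comm (B * w i j)]
    by_cases hd : 1 / 2 < ‖micro x i - u‖
    · simp [he, mollifier_eq_zero hd]
    by_cases hd' : 1 / 2 < ‖micro x j - u‖
    · simp [he, mollifier_eq_zero hd']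
    gcongr
    have h1 : 1 ≤ w i j := by
      simp only [hw]
      split_ifs
      · refine one_le_rieszKernel hs ?_
        rw [edist_dist, ENNReal.ofReal_le_one]
        have := dist_triangle_right (micro x i) (micro x j) u
        rw [dist_eq_norm _ u, dist_eq_norm _ u] at this
        linarith
      · exact le_rfl
    calc e j u ≤ B := ENNReal.ofReal_le_ofReal (mollifier_le _)
      _ = B * 1 := (mul_one _).symm
      _ ≤ B * w i j := by gcongr
  rw [lintegral_comp_scale hd hN
    (fun z => ENNReal.ofReal (((rescaled x).translate z).pairing (mollifier d)) ^ 2)]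
  simp only [Config.ofReal_pairing _ _ mollifier_nonneg, lintegral_rescaled_translate]
  calc (N : ℝ≥0∞)⁻¹ * ∫⁻ u, (∑ i, e i u) ^ 2
      ≤ (N : ℝ≥0∞)⁻¹ * ∫⁻ u, ∑ i, ∑ j, B * w i j * e i u := by
        gcongr with u
        rw [sq, Finset.sum_mul_sum]
        exact Finset.sum_le_sum fun i _ => Finset.sum_le_sum fun j _ => hle i j u
    _ = (N : ℝ≥0∞)⁻¹ * ∑ i, ∑ j, B * w i j := by
        rw [lintegral_finsetSum' _ fun i _ => by fun_prop]
        congr 1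
        refine Finset.sum_congr rfl fun i _ => ?_
        rw [lintegral_finsetSum' _ fun j _ => by fun_prop]
        refine Finset.sum_congr rfl fun j _ => ?_
        rw [lintegral_const_mul _ (hem i), hei, mul_one]
    _ = (N : ℝ≥0∞)⁻¹ * ∑ i, (B * 1 + B * ∑ j ∈ Finset.univ.filter (fun j => i ≠ j),
          rieszKernel s (micro x i) (micro x j)) := by
        congr 1
        refine Finset.sum_congr rfl fun i _ => ?_
        rw [← mul_add, ← Finset.mul_sum, Finset.filter_ne,
          ← Finset.add_sum_erase _ _ (Finset.mem_univ i)]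
        congr 2
        · simp [hw]
        · refine Finset.sum_congr rfl fun j hj => ?_
          simp [hw, (Finset.ne_of_mem_erase hj).symm]
    _ = B * (1 + pairEnergy s x) := by
        rw [Finset.sum_add_distrib, ← Finset.mul_sum, ← Finset.mul_sum, pairEnergy,
          Finset.sum_const, Finset.card_univ, Fintype.card_fin, nsmul_eq_mul, mul_one, ← mul_add,
          mul_left_comm, mul_add, ENNReal.inv_mul_cancel h0 (ENNReal.natCast_ne_top N)]

/-- The interaction of a pair does not depend on the tag, and the pair contributes only when its
first point, seen from the tag, is in the cube of side R + 2: a set of tags of volume (R + 2)^d in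
microscopic units. -/
theorem lintegral_offDiag_rescaled_le (hd : 1 ≤ d) (s R : ℝ) (M : ℕ) {N : ℕ}
    (hN : 1 ≤ N) (x : Fin N → Ω) :
    ∫⁻ y : E d, ENNReal.ofReal
        (offDiag (truncKernel s R M) ((rescaled x).translate (scale d N • y))) ≤
      ENNReal.ofReal (R + 2) ^ d * pairEnergy s x := by
  rw [lintegral_comp_scale hd hN
    (fun z => ENNReal.ofReal (offDiag (truncKernel s R M) ((rescaled x).translate z)))]
  set k : Fin N → Fin N → ℝ≥0∞ := fun i j => rieszKernel s (micro x i) (micro x j) with hk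
  have hker : ∀ (p q u : E d), rieszKernel s (p - u) (q - u) = rieszKernel s p q := fun p q u => by
    rw [rieszKernel, rieszKernel, edist_sub_right]
  calc (N : ℝ≥0∞)⁻¹ * ∫⁻ u, ENNReal.ofReal
        (offDiag (truncKernel s R M) ((rescaled x).translate u))
      ≤ (N : ℝ≥0∞)⁻¹ * ∫⁻ u, ∑ i, ∑ j ∈ Finset.univ.filter (fun j => i ≠ j),
          (cube d (R + 2)).indicator (fun _ => k i j) (micro x i - u) := by
        gcongr with u
        rw [rescaled_eq, Config.translate_ofPoints, offDiag_ofPoints,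
          ENNReal.ofReal_sum_of_nonneg fun i _ =>
            Finset.sum_nonneg fun j _ => truncKernel_nonneg _ _ _ _]
        gcongr with i _
        rw [ENNReal.ofReal_sum_of_nonneg fun j _ => truncKernel_nonneg _ _ _ _]
        gcongr with j _
        refine (ofReal_truncKernel_le s R M _ _).trans_eq ?_
        rw [hker]
    _ = (N : ℝ≥0∞)⁻¹ * ∑ i, ∑ j ∈ Finset.univ.filter (fun j => i ≠ j),
          ENNReal.ofReal (R + 2) ^ d * k i j := by
        have hm : ∀ i j, Measurable fun u : E d =>
            (cube d (R + 2)).indicator (fun _ => k i j) (micro x i - u) := fun i j =>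
          (measurable_const.indicator (measurableSet_cube _)).comp (measurable_const_sub _)
        rw [lintegral_finsetSum' _ fun i _ =>
          Finset.aemeasurable_fun_sum _ fun j _ => (hm i j).aemeasurable]
        congr 1
        refine Finset.sum_congr rfl fun i _ => ?_
        rw [lintegral_finsetSum' _ fun j _ => (hm i j).aemeasurable]
        refine Finset.sum_congr rfl fun j _ => ?_
        rw [lintegral_sub_left_eq_self
          (fun u => (cube d (R + 2)).indicator (fun _ => k i j) u),
          lintegral_indicator_const (measurableSet_cube _), volume_cube, mul_comm]
    _ = ENNReal.ofReal (R + 2) ^ d * pairEnergy s x := by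
        simp only [← Finset.mul_sum, pairEnergy, hk]
        ring

/-! ### Consequences of the convergence of tagged measures -/

/-- The first marginal is the Lebesgue measure on `Ω`. -/
def HasLebMarginal (m : Measure (Ω × Config d)) : Prop := m.map Prod.fst = leb Ω

theorem hasLebMarginal_taggedEmp {N : ℕ} (x : Fin N → Ω) : HasLebMarginal (taggedEmp x) := by
  rw [HasLebMarginal, taggedEmp, Measure.map_map measurable_fst (measurable_tagged x)]
  exact Measure.map_id

theorem hasLebMarginal_toMeasure (hΩ : MeasurableSet Ω) (P : TaggedProcess Ω) :
    HasLebMarginal P.toMeasure := by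
  have := sigmaFinite_leb hΩ
  have := P.isMarkov
  exact Measure.fst_compProd _ _

theorem lintegral_leb (hΩ : MeasurableSet Ω) (H : E d → ℝ≥0∞) :
    ∫⁻ y : Ω, H y ∂leb Ω = ∫⁻ y in Ω, H y :=
  lintegral_subtype_comap hΩ H

theorem integral_leb (hΩ : MeasurableSet Ω) (H : E d → ℝ) :
    ∫ y : Ω, H y ∂leb Ω = ∫ y in Ω, H y :=
  integral_subtype_comap hΩ H

theorem integrable_leb_of_integrable (hΩ : MeasurableSet Ω) {H : E d → ℝ} (hH : Integrable H) :
    Integrable (fun y : Ω => H y) (leb Ω) := by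
  have := (MeasurableEmbedding.subtype_coe hΩ).integrable_map_iff (μ := leb Ω) (g := H)
  rw [leb, map_comap_subtype_coe hΩ] at this
  exact this.1 hH.integrableOn

theorem integrable_cutoffFun (R : ℝ) : Integrable (cutoffFun (d := d) R) :=
  (cutoff d R).continuous.integrable_of_hasCompactSupport (cutoff d R).hasCompactSupport

theorem HasLebMarginal.integrable_fst {m : Measure (Ω × Config d)} (hm : HasLebMarginal m)
    {g : Ω → ℝ} (hg : Integrable g (leb Ω)) : Integrable (fun z => g z.1) m := by
  rw [← hm] at hg
  exact hg.comp_measurable measurable_fst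

theorem HasLebMarginal.integrable_cutoff (hΩ : MeasurableSet Ω) {m : Measure (Ω × Config d)}
    (hm : HasLebMarginal m) (B R : ℝ) :
    Integrable (fun z : Ω × Config d => B * cutoffFun R (z.1 : E d)) m :=
  (hm.integrable_fst (integrable_leb_of_integrable hΩ (integrable_cutoffFun R))).const_mul B

theorem TendstoTagged.tendsto_integral (hΩ : MeasurableSet Ω) {m : ℕ → Measure (Ω × Config d)}
    {m' : Measure (Ω × Config d)} (h : TendstoTagged m m') {F : Ω × Config d → ℝ}
    (hF : Continuous F) {B R : ℝ} (hB : 0 ≤ B) (hb : ∀ z, |F z| ≤ B * cutoffFun R (z.1 : E d)) :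
    Tendsto (fun k => ∫ z, F z ∂m k) atTop (𝓝 (∫ z, F z ∂m')) :=
  h (BoundedContinuousFunction.ofNormedAddCommGroup F hF B fun z => (hb z).trans
    (mul_le_of_le_one_right hB (cutoffFun_le_one _ _)))
    ⟨fun y => B * cutoffFun R (y : E d),
      (integrable_leb_of_integrable hΩ (integrable_cutoffFun R)).const_mul B, hb⟩

/-- Lower semicontinuity of the integrals of nonnegative continuous functions. -/
theorem TendstoTagged.lintegral_le_liminf (hΩ : MeasurableSet Ω)
    {m : ℕ → Measure (Ω × Config d)} {m' : Measure (Ω × Config d)} (h : TendstoTagged m m')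
    (hm : ∀ k, HasLebMarginal (m k)) (hm' : HasLebMarginal m') {G : Ω × Config d → ℝ}
    (hG : Continuous G) (hG0 : ∀ z, 0 ≤ G z) :
    ∫⁻ z, ENNReal.ofReal (G z) ∂m' ≤ liminf (fun k => ∫⁻ z, ENNReal.ofReal (G z) ∂m k) atTop := by
  -- Capping the height and cutting off the tag gives admissible test functions increasing to G.
  set F : ℕ → Ω × Config d → ℝ := fun n z => min (G z) n * cutoffFun n (z.1 : E d) with hF
  have hFc : ∀ n, Continuous (F n) := fun n => by
    have := cutoffFun_continuous (d := d) n
    fun_prop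
  have hF0 : ∀ n z, 0 ≤ F n z := fun n z =>
    mul_nonneg (le_min (hG0 z) (Nat.cast_nonneg n)) (cutoffFun_nonneg _ _)
  have hFb : ∀ n z, |F n z| ≤ n * cutoffFun n (z.1 : E d) := fun n z => by
    rw [abs_of_nonneg (hF0 n z)]
    exact mul_le_mul_of_nonneg_right (min_le_right _ _) (cutoffFun_nonneg _ _)
  have hFi : ∀ (n : ℕ) (ν : Measure (Ω × Config d)), HasLebMarginal ν → Integrable (F n) ν :=
    fun n ν hν => (hν.integrable_cutoff hΩ n n).mono' (hFc n).aestronglyMeasurable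
      (ae_of_all _ (hFb n))
  have hFle : ∀ n z, F n z ≤ G z := fun n z =>
    (mul_le_of_le_one_right (le_min (hG0 z) (Nat.cast_nonneg n)) (cutoffFun_le_one _ _)).trans
      (min_le_left _ _)
  have hFmono : ∀ z, Monotone fun n => F n z := fun z n n' hn => by
    have h1 : (n : ℝ) ≤ n' := by exact_mod_cast hn
    exact mul_le_mul (min_le_min_left _ h1) (cutoffFun_mono h1 _) (cutoffFun_nonneg _ _)
      (le_min (hG0 z) (Nat.cast_nonneg _))
  have hsup : ∀ z, ENNReal.ofReal (G z) = ⨆ n, ENNReal.ofReal (F n z) := fun z => by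
    refine le_antisymm ?_ (iSup_le fun n => ENNReal.ofReal_le_ofReal (hFle n z))
    obtain ⟨n, hn⟩ := exists_nat_ge (max (G z) ‖(z.1 : E d)‖)
    refine le_trans (ENNReal.ofReal_le_ofReal (le_of_eq ?_))
      (le_iSup (fun n => ENNReal.ofReal (F n z)) n)
    simp only [hF]
    rw [min_eq_left ((le_max_left _ _).trans hn), cutoffFun_eq_one ((le_max_right _ _).trans hn),
      mul_one]
  simp only [fun z => (hsup z)]
  rw [lintegral_iSup (fun n => (hFc n).measurable.ennreal_ofReal)
    fun n n' hn z => ENNReal.ofReal_le_ofReal (hFmono z hn)]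
  refine iSup_le fun n => ?_
  have ht := (ENNReal.continuous_ofReal.tendsto _).comp
    (h.tendsto_integral hΩ (hFc n) (Nat.cast_nonneg n) (hFb n))
  rw [← ofReal_integral_eq_lintegral_ofReal (hFi n m' hm') (ae_of_all _ (hF0 n)),
    ← ht.liminf_eq]
  refine liminf_le_liminf (Eventually.of_forall fun k => ?_)
  simp only [Function.comp_apply]
  rw [ofReal_integral_eq_lintegral_ofReal (hFi n _ (hm k)) (ae_of_all _ (hF0 n))]
  exact lintegral_mono fun z => le_iSup (fun n => ENNReal.ofReal (F n z)) n

/-- Convergence of the integrals of functions of linear growth in the number of points, under a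
uniform bound on the second moments. -/
theorem TendstoTagged.tendsto_integral_mul (hΩ : MeasurableSet Ω)
    {m : ℕ → Measure (Ω × Config d)} {m' : Measure (Ω × Config d)} (h : TendstoTagged m m')
    (hm : ∀ k, HasLebMarginal (m k)) (hm' : HasLebMarginal m') {G : Ω × Config d → ℝ}
    (hG : Continuous G) (hG0 : ∀ z, 0 ≤ G z) {A : ℝ} (hA : 0 ≤ A)
    (hmA : ∀ k, ∫⁻ z, ENNReal.ofReal (G z) ^ 2 ∂m k ≤ ENNReal.ofReal A)
    {f : Ω → ℝ} (hf : Continuous f) {B R : ℝ} (hB : 0 ≤ B)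
    (hb : ∀ y, |f y| ≤ B * cutoffFun R (y : E d)) :
    Tendsto (fun k => ∫ z, f z.1 * G z ∂m k) atTop (𝓝 (∫ z, f z.1 * G z ∂m')) ∧
      Integrable (fun z => f z.1 * G z) m' := by
  have hG2 : ∀ z, ENNReal.ofReal (G z) ^ 2 = ENNReal.ofReal (G z ^ 2) := fun z =>
    (ENNReal.ofReal_pow (hG0 z) 2).symm
  -- The second moment bound passes to the limit by lower semicontinuity.
  have hmA' : ∫⁻ z, ENNReal.ofReal (G z) ^ 2 ∂m' ≤ ENNReal.ofReal A := by
    simp only [hG2] at hmA ⊢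
    refine (h.lintegral_le_liminf hΩ hm hm' (hG.pow 2) fun z => sq_nonneg _).trans ?_
    exact liminf_le_of_frequently_le' (Frequently.of_forall hmA)
  have hfB : ∀ y, |f y| ≤ B := fun y =>
    (hb y).trans (mul_le_of_le_one_right hB (cutoffFun_le_one _ _))
  -- Uniform integrability, stated for an arbitrary measure so as to serve both the sequence and its
  -- limit: capping G at height L costs at most B A / L.
  have hgood : ∀ ν : Measure (Ω × Config d), HasLebMarginal ν →
      ∫⁻ z, ENNReal.ofReal (G z) ^ 2 ∂ν ≤ ENNReal.ofReal A →
      Integrable (fun z => G z ^ 2) ν ∧ ∫ z, G z ^ 2 ∂ν ≤ A ∧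
      Integrable (fun z => f z.1 * G z) ν ∧
      ∀ L : ℝ, 0 < L → Integrable (fun z => f z.1 * min (G z) L) ν ∧
        |∫ z, f z.1 * G z ∂ν - ∫ z, f z.1 * min (G z) L ∂ν| ≤ B * A / L := by
    intro ν hν hνA
    simp only [hG2] at hνA
    have hi2 : Integrable (fun z => G z ^ 2) ν := by
      refine ⟨(hG.pow 2).aestronglyMeasurable, ?_⟩
      rw [hasFiniteIntegral_iff_ofReal (ae_of_all _ fun z => sq_nonneg _)]
      exact hνA.trans_lt ENNReal.ofReal_lt_top
    have hi2A : ∫ z, G z ^ 2 ∂ν ≤ A := by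
      rw [← ENNReal.ofReal_le_ofReal_iff hA,
        ofReal_integral_eq_lintegral_ofReal hi2 (ae_of_all _ fun z => sq_nonneg _)]
      exact hνA
    have hiG : Integrable (fun z => f z.1 * G z) ν := by
      refine ((hν.integrable_cutoff hΩ B R).add (hi2.const_mul B)).mono'
        ((hf.comp continuous_fst).mul hG).aestronglyMeasurable (ae_of_all _ fun z => ?_)
      rw [Real.norm_eq_abs, abs_mul, abs_of_nonneg (hG0 z), Pi.add_apply]
      have h1 : G z ≤ 1 + G z ^ 2 := by nlinarith [sq_nonneg (G z - 1)]
      calc |f z.1| * G z ≤ |f z.1| * (1 + G z ^ 2) := by gcongr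
        _ = |f z.1| + |f z.1| * G z ^ 2 := by ring
        _ ≤ _ := by gcongr; exacts [hb z.1, hfB z.1]
    refine ⟨hi2, hi2A, hiG, fun L hL => ?_⟩
    have hiL : Integrable (fun z => f z.1 * min (G z) L) ν := by
      refine hiG.norm.mono' ((hf.comp continuous_fst).mul
        (hG.min continuous_const)).aestronglyMeasurable (ae_of_all _ fun z => ?_)
      rw [norm_mul, norm_mul, Real.norm_of_nonneg (le_min (hG0 z) hL.le),
        Real.norm_of_nonneg (hG0 z)]
      gcongr
      exact min_le_left _ _
    refine ⟨hiL, ?_⟩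
    rw [← integral_sub hiG hiL]
    calc |∫ z, (f z.1 * G z - f z.1 * min (G z) L) ∂ν|
        ≤ ∫ z, |f z.1 * G z - f z.1 * min (G z) L| ∂ν := abs_integral_le_integral_abs
      _ ≤ ∫ z, B / L * G z ^ 2 ∂ν := by
          refine integral_mono (hiG.sub hiL).abs (hi2.const_mul _) fun z => ?_
          have h1 : 0 ≤ G z - min (G z) L := sub_nonneg.2 (min_le_left _ _)
          -- The excess over L is zero when G ≤ L, and otherwise at most G ≤ G² / L.
          have h2 : G z - min (G z) L ≤ G z ^ 2 / L := by
            rw [le_div_iff₀ hL]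
            rcases le_total (G z) L with h3 | h3
            · rw [min_eq_left h3]; nlinarith [sq_nonneg (G z)]
            · rw [min_eq_right h3]; nlinarith [hG0 z, mul_self_nonneg (G z)]
          dsimp only
          rw [← mul_sub, abs_mul, abs_of_nonneg h1]
          calc |f z.1| * (G z - min (G z) L) ≤ B * (G z ^ 2 / L) := by
                gcongr; exact hfB _
            _ = B / L * G z ^ 2 := by ring
      _ = B / L * ∫ z, G z ^ 2 ∂ν := integral_const_mul _ _
      _ ≤ B / L * A := by gcongr
      _ = B * A / L := by ring
  refine ⟨?_, (hgood m' hm' hmA').2.2.1⟩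
  rw [Metric.tendsto_atTop]
  intro e he
  obtain ⟨L, hL, hLe⟩ : ∃ L : ℝ, 0 < L ∧ B * A / L < e / 3 := by
    refine ⟨3 * (B * A) / e + 1, by positivity, ?_⟩
    rw [div_lt_iff₀ (by positivity)]
    have : e / 3 * (3 * (B * A) / e + 1) = B * A + e / 3 := by field_simp
    rw [this]
    linarith
  have ht := h.tendsto_integral hΩ (F := fun z => f z.1 * min (G z) L) (B := B * L) (R := R)
    (by fun_prop) (by positivity) fun z => by
      rw [abs_mul, abs_of_nonneg (le_min (hG0 z) hL.le)]
      calc |f z.1| * min (G z) L ≤ (B * cutoffFun R (z.1 : E d)) * L := by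
            gcongr
            · exact le_min (hG0 z) hL.le
            · exact mul_nonneg hB (cutoffFun_nonneg _ _)
            · exact hb _
            · exact min_le_right _ _
        _ = _ := by ring
  obtain ⟨K, hK⟩ := Metric.tendsto_atTop.1 ht (e / 3) (by positivity)
  refine ⟨K, fun k hk => ?_⟩
  have h1 := ((hgood (m k) (hm k) (hmA k)).2.2.2 L hL).2
  have h2 := ((hgood m' hm' hmA').2.2.2 L hL).2
  have h3 := hK k hk
  rw [Real.dist_eq] at h3 ⊢
  rw [abs_lt] at h3 ⊢
  rw [abs_le] at h1 h2
  constructor <;> linarith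

theorem lintegral_taggedEmp_le (hΩ : MeasurableSet Ω) {N : ℕ} (x : Fin N → Ω)
    {H : Config d → ℝ≥0∞} (hH : Measurable H) :
    ∫⁻ z, H z.2 ∂taggedEmp x ≤ ∫⁻ y : E d, H ((rescaled x).translate (scale d N • y)) := by
  have h1 : ∫⁻ z, H z.2 ∂taggedEmp x =
      ∫⁻ y : Ω, H ((rescaled x).translate (scale d N • (y : E d))) ∂leb Ω :=
    lintegral_map (f := fun z : Ω × Config d => H z.2) (hH.comp measurable_snd)
      (measurable_tagged x)
  have h2 := lintegral_leb hΩ (fun y => H ((rescaled x).translate (scale d N • y)))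
  rw [h1, h2]
  exact setLIntegral_le_lintegral _ _

theorem integral_taggedEmp (hΩ : MeasurableSet Ω) {N : ℕ} (x : Fin N → Ω) {φ : E d → ℝ}
    (hφ : Continuous φ) {γ : Config d → ℝ} (hγ : Continuous γ) :
    ∫ z, φ (z.1 : E d) * γ z.2 ∂taggedEmp x =
      ∫ y in Ω, φ y * γ ((rescaled x).translate (scale d N • y)) := by
  rw [taggedEmp, integral_map (measurable_tagged x).aemeasurable
    (by fun_prop : Continuous fun z : Ω × Config d =>
      φ (z.1 : E d) * γ z.2).aestronglyMeasurable]
  exact integral_leb hΩ (fun y => φ y * γ ((rescaled x).translate (scale d N • y)))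

/-! ### Limits of tagged empirical processes are stationary -/

/-- Continuity of translations in `L¹`. -/
theorem tendsto_integral_abs_sub_translate {h : E d → ℝ} (hh : Integrable h) :
    Tendsto (fun v : E d => ∫ y, |h (v + y) - h y|) (𝓝 0) (𝓝 0) := by
  have hm : MemLp h 1 := memLp_one_iff_integrable.2 hh
  have : Fact ((1 : ℝ≥0∞) ≠ ∞) := ⟨ENNReal.one_ne_top⟩
  have hc : Tendsto (fun v : E d => ‖(DomAddAct.mk v +ᵥ hm.toLp h) - hm.toLp h‖) (𝓝 0)
      (𝓝 ‖(DomAddAct.mk (0 : E d) +ᵥ hm.toLp h) - hm.toLp h‖) := by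
    have : Continuous fun v : E d => ‖(DomAddAct.mk v +ᵥ hm.toLp h) - hm.toLp h‖ := by
      have h1 : Continuous fun v : E d => DomAddAct.mk v +ᵥ hm.toLp h :=
        (DomAddAct.continuous_mk.vadd continuous_const)
      fun_prop
    exact this.tendsto 0
  have hnorm : ∀ v : E d, ‖(DomAddAct.mk v +ᵥ hm.toLp h) - hm.toLp h‖ = ∫ y, |h (v + y) - h y| := by
    intro v
    rw [DomAddAct.mk_vadd_toLp, ← MemLp.toLp_sub, L1.norm_eq_integral_norm]
    refine integral_congr_ae ?_
    filter_upwards [MemLp.coeFn_toLp ((hm.comp_measurePreserving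
      (measurePreserving_vadd v volume)).sub hm)] with y hy
    exact congrArg norm hy
  simpa only [hnorm, zero_add, sub_self, abs_zero, integral_zero] using hc

/-- Limits of tagged empirical processes are invariant under translations, in integrated form. -/
theorem integral_translate_eq_of_tendstoTagged (hd : 1 ≤ d) (hΩ : MeasurableSet Ω) {N : ℕ → ℕ}
    (hN1 : ∀ k, 1 ≤ N k) (hN : Tendsto N atTop atTop) (x : ∀ k, Fin (N k) → Ω)
    {m' : Measure (Ω × Config d)} (h : TendstoTagged (fun k => taggedEmp (x k)) m')
    {φ : E d → ℝ} (hφ : Continuous φ) {B R : ℝ} (hB : 0 ≤ B)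
    (hb : ∀ y, |φ y| ≤ B * cutoffFun R y) (g : Config d →ᵇ ℝ) (u : E d) :
    ∫ z, φ (z.1 : E d) * g (z.2.translate u) ∂m' = ∫ z, φ (z.1 : E d) * g z.2 ∂m' := by
  have hgu : Continuous fun C : Config d => g (C.translate u) :=
    g.continuous.comp (Config.continuous_translate u)
  have hbound : ∀ (γ : Config d → ℝ), (∀ C, |γ C| ≤ ‖g‖) → ∀ z : Ω × Config d,
      |φ (z.1 : E d) * γ z.2| ≤ (B * ‖g‖) * cutoffFun R (z.1 : E d) := fun γ hγ z => by
    rw [abs_mul]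
    calc |φ (z.1 : E d)| * |γ z.2| ≤ (B * cutoffFun R (z.1 : E d)) * ‖g‖ := by
          gcongr
          exacts [mul_nonneg hB (cutoffFun_nonneg _ _), hb _, hγ _]
      _ = _ := by ring
  have t1 := h.tendsto_integral hΩ (F := fun z => φ (z.1 : E d) * g (z.2.translate u))
    ((hφ.comp (continuous_subtype_val.comp continuous_fst)).mul (hgu.comp continuous_snd))
    (by positivity) (hbound _ fun C => g.norm_coe_le_norm _)
  have t2 := h.tendsto_integral hΩ (F := fun z => φ (z.1 : E d) * g z.2)
    (by fun_prop) (by positivity) (hbound _ fun C => g.norm_coe_le_norm _)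
  refine sub_eq_zero.1 (tendsto_nhds_unique (t1.sub t2) ?_)
  -- Extension by zero: shifting the tag may leave Ω, and translations have to act on the whole
  -- space.
  set H : E d → ℝ := Ω.indicator φ with hH
  have hφi : Integrable φ := ((integrable_cutoffFun R).const_mul B).mono'
    hφ.aestronglyMeasurable (ae_of_all _ hb)
  have hHi : Integrable H := hφi.indicator hΩ
  have key : ∀ k, |∫ z, φ (z.1 : E d) * g (z.2.translate u) ∂taggedEmp (x k) -
      ∫ z, φ (z.1 : E d) * g z.2 ∂taggedEmp (x k)| ≤
      ‖g‖ * ∫ y, |H (-((scale d (N k))⁻¹ • u) + y) - H y| := by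
    intro k
    have ha := scale_pos (d := d) (hN1 k)
    set a := scale d (N k)
    set T : E d → Config d := fun y => (rescaled (x k)).translate (a • y) with hT
    have hTc : Measurable T := Config.measurable_translate_prod.comp
      ((measurable_const_smul a).prodMk measurable_const)
    have hgT : Measurable fun y => g (T y) := g.continuous.measurable.comp hTc
    rw [integral_taggedEmp hΩ (x k) hφ hgu, integral_taggedEmp hΩ (x k) hφ g.continuous,
      ← integral_indicator hΩ, ← integral_indicator hΩ]
    have e1 : ∀ γ : Config d → ℝ, (Ω.indicator fun y => φ y * γ (T y)) =
        fun y => H y * γ (T y) := fun γ => by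
      funext y
      by_cases hy : y ∈ Ω <;> simp [hH, hy]
    have e1' := e1 (fun C => g (C.translate u))
    have e2' := e1 g
    simp only [hT] at e1' e2'
    rw [e1', e2']
    -- A microscopic translation by u is the same as moving the tag by u / a; the change of
    -- variables transfers this shift to H alone.
    have e3 : ∫ y, H y * g (((rescaled (x k)).translate (a • y)).translate u) =
        ∫ y, H (-(a⁻¹ • u) + y) * g (T y) := by
      rw [← integral_add_left_eq_self (fun y => H (-(a⁻¹ • u) + y) * g (T y)) (a⁻¹ • u)]
      refine integral_congr_ae (ae_of_all _ fun y => ?_)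
      simp only [hT]
      rw [Config.translate_translate, neg_add_cancel_left, smul_add, smul_inv_smul₀ ha.ne',
        add_comm u]
    have hHi' : Integrable fun y => H (-(a⁻¹ • u) + y) := hHi.comp_add_left _
    have hbd : ∀ᵐ y, ‖g (T y)‖ ≤ ‖g‖ := ae_of_all _ fun y => g.norm_coe_le_norm _
    rw [e3, ← integral_sub (hHi'.mul_bdd hgT.aestronglyMeasurable hbd)
      (hHi.mul_bdd hgT.aestronglyMeasurable hbd), ← integral_const_mul]
    refine abs_integral_le_integral_abs.trans (integral_mono_of_nonneg
      (ae_of_all _ fun y => abs_nonneg _) ((hHi'.sub hHi).abs.const_mul _)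
      (ae_of_all _ fun y => ?_))
    dsimp only
    rw [← sub_mul, abs_mul, mul_comm]
    exact mul_le_mul_of_nonneg_right (g.norm_coe_le_norm _) (abs_nonneg _)
  refine squeeze_zero_norm key ?_
  have ht : Tendsto (fun k => -((scale d (N k))⁻¹ • u)) atTop (𝓝 0) := by
    have := ((tendsto_inv_atTop_zero.comp ((tendsto_scale hd).comp hN)).smul_const u).neg
    simpa using this
  simpa using ((tendsto_integral_abs_sub_translate hHi).comp ht).const_mul ‖g‖

/-- A bounded continuous function on `Ω`, multiplied by a cutoff, extends to the whole space. -/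
theorem exists_extension (hΩ : IsClosed Ω) (f : Ω →ᵇ ℝ) (n : ℕ) :
    ∃ φ : E d → ℝ, Continuous φ ∧ (∀ y : Ω, φ y = f y * cutoffFun n (y : E d)) ∧
      ∀ y, |φ y| ≤ ‖f‖ * cutoffFun n y := by
  obtain ⟨ψ, hψ, hψf⟩ := BoundedContinuousFunction.exists_extension_norm_eq_of_isClosedEmbedding f
    hΩ.isClosedEmbedding_subtypeVal
  have := cutoffFun_continuous (d := d) n
  refine ⟨fun y => ψ y * cutoffFun n y, by fun_prop, fun y => ?_, fun y => ?_⟩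
  · rw [← hψf]; rfl
  · rw [abs_mul, abs_of_nonneg (cutoffFun_nonneg _ _), ← hψ]
    exact mul_le_mul_of_nonneg_right (ψ.norm_coe_le_norm y) (cutoffFun_nonneg _ _)

/-- The Lebesgue measure on `Ω` with a weight. -/
def lebWeight (Ω : Set (E d)) (w : E d → ℝ) : Measure Ω :=
  (leb Ω).withDensity fun y => ENNReal.ofReal (w (y : E d))

theorem isFiniteMeasure_lebWeight (hΩ : MeasurableSet Ω) {w : E d → ℝ} (hw : Integrable w) :
    IsFiniteMeasure (lebWeight Ω w) :=
  isFiniteMeasure_withDensity_ofReal (integrable_leb_of_integrable hΩ hw).2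

theorem ae_leb_of_ae_lebWeight {w : E d → ℝ} (hw : Continuous w) {p : Ω → Prop}
    (h : ∀ᵐ y : Ω ∂lebWeight Ω w, p y) : ∀ᵐ y : Ω ∂leb Ω, 0 < w y → p y := by
  have h1 := (ae_withDensity_iff
    (hw.comp continuous_subtype_val).measurable.ennreal_ofReal).1 h
  filter_upwards [h1] with y hy hwy
  exact hy (ENNReal.ofReal_pos.2 hwy).ne'

theorem ae_leb_of_ae_lebWeight_cutoffFun {p : Ω → Prop}
    (h : ∀ n : ℕ, ∀ᵐ y : Ω ∂lebWeight Ω (cutoffFun n), p y) : ∀ᵐ y : Ω ∂leb Ω, p y := by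
  filter_upwards [ae_all_iff.2 fun n => ae_leb_of_ae_lebWeight (cutoffFun_continuous _) (h n)]
    with y hy
  obtain ⟨n, hn⟩ := exists_nat_ge ‖(y : E d)‖
  exact hy n (by rw [cutoffFun_eq_one hn]; exact one_pos)

theorem integral_lebWeight_compProd (hΩ : MeasurableSet Ω) {w : E d → ℝ} (hw : Continuous w)
    (hwi : Integrable w) (hw0 : ∀ y, 0 ≤ w y) (κ : Kernel Ω (Config d))
    [IsMarkovKernel κ] {F : Ω × Config d → ℝ} (hF : Continuous F) {B : ℝ}
    (hB : ∀ z, |F z| ≤ B) :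
    ∫ z, F z ∂(lebWeight Ω w ⊗ₘ κ) = ∫ z, w (z.1 : E d) * F z ∂(leb Ω ⊗ₘ κ) := by
  have := sigmaFinite_leb hΩ
  have := isFiniteMeasure_lebWeight hΩ hwi
  have hmarg : HasLebMarginal (leb Ω ⊗ₘ κ) := Measure.fst_compProd _ _
  have hwm : Measurable fun y : Ω => ENNReal.ofReal (w y) :=
    (hw.comp continuous_subtype_val).measurable.ennreal_ofReal
  rw [Measure.integral_compProd, Measure.integral_compProd, lebWeight]
  · rw [integral_withDensity_eq_integral_toReal_smul hwm
      (ae_of_all _ fun _ => ENNReal.ofReal_lt_top)]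
    refine integral_congr_ae (ae_of_all _ fun y => ?_)
    dsimp only
    rw [ENNReal.toReal_ofReal (hw0 _), integral_const_mul, smul_eq_mul]
  · exact ((hmarg.integrable_fst (integrable_leb_of_integrable hΩ hwi)).mul_const B).mono'
      ((hw.comp (continuous_subtype_val.comp continuous_fst)).mul
        hF).aestronglyMeasurable (ae_of_all _ fun z => by
        rw [Real.norm_eq_abs, abs_mul, abs_of_nonneg (hw0 _)]
        exact mul_le_mul_of_nonneg_left (hB z) (hw0 _))
  · exact Integrable.of_bound hF.aestronglyMeasurable B (ae_of_all _ hB)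

/-- Each u has its own null set of tags, so only countably many translations can be treated at once;
the expectation of g(θ_u C) is continuous in u, and this reaches the others. -/
theorem isStationary_of_dense {P : Measure (Config d)} [IsProbabilityMeasure P]
    {S : Set (E d)} (hS : Dense S) (h : ∀ u ∈ S, P.map (Config.translate u) = P) :
    IsStationary P := by
  intro u
  have := Measure.isProbabilityMeasure_map (μ := P) (measurable_translate u).aemeasurable
  refine ext_of_forall_integral_eq_of_IsFiniteMeasure fun g => ?_
  rw [integral_map (measurable_translate u).aemeasurable g.continuous.aestronglyMeasurable]
  have hc : Continuous fun u : E d => ∫ C : Config d, g (C.translate u) ∂P := by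
    refine continuous_of_dominated (bound := fun _ => ‖g‖) (fun u =>
      (g.continuous.comp (Config.continuous_translate u)).aestronglyMeasurable)
      (fun u => ae_of_all _ fun C => g.norm_coe_le_norm _) (integrable_const _)
      (ae_of_all _ fun C => g.continuous.comp (Config.continuous_translate_prod.comp
        (continuous_id.prodMk continuous_const)))
  have := hc.ext_on hS continuous_const (g := fun _ => ∫ C, g C ∂P) fun v hv => by
    dsimp only
    rw [← integral_map (measurable_translate v).aemeasurable g.continuous.aestronglyMeasurable,
      h v hv]
  exact congrFun this u

/-- For fixed u, the integrated invariance tested on products f(x) g(C) identifies two measures with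
the same finite first marginal, hence their kernels almost everywhere. The cutoff weights supply
this finiteness and exhaust Ω. -/
theorem ae_isStationary_of_tendstoTagged (hd : 1 ≤ d) (hΩ : IsClosed Ω) {N : ℕ → ℕ}
    (hN1 : ∀ k, 1 ≤ N k) (hN : Tendsto N atTop atTop) (x : ∀ k, Fin (N k) → Ω)
    (P : TaggedProcess Ω) (h : TendstoTagged (fun k => taggedEmp (x k)) P.toMeasure) :
    ∀ᵐ y ∂leb Ω, IsStationary (P.fiber y) := by
  have hΩm := hΩ.measurableSet
  have := sigmaFinite_leb hΩm
  have := P.isMarkov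
  have hu : ∀ u : E d, ∀ᵐ y ∂leb Ω, (P.fiber y).map (Config.translate u) = P.fiber y := by
    intro u
    refine ae_leb_of_ae_lebWeight_cutoffFun fun n => ?_
    have := isFiniteMeasure_lebWeight hΩm (integrable_cutoffFun (d := d) n)
    have hmt := measurable_translate u
    have : IsMarkovKernel (P.fiber.map (Config.translate u)) := Kernel.IsMarkovKernel.map _ hmt
    have heq : lebWeight Ω (cutoffFun n) ⊗ₘ P.fiber.map (Config.translate u) =
        lebWeight Ω (cutoffFun n) ⊗ₘ P.fiber := by
      refine Measure.ext_of_integral_mul_boundedContinuousFunction fun f g => ?_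
      obtain ⟨φ, hφ, hφf, hφb⟩ := exists_extension hΩ f n
      have hfg : ∀ γ : Config d → ℝ, (∀ C, |γ C| ≤ ‖g‖) → ∀ z : Ω × Config d,
          |f z.1 * γ z.2| ≤ ‖f‖ * ‖g‖ := fun γ hγ z => by
        rw [abs_mul]
        exact mul_le_mul (f.norm_coe_le_norm _) (hγ _) (abs_nonneg _) (norm_nonneg _)
      have hgu : Continuous fun C : Config d => g (C.translate u) :=
        g.continuous.comp (Config.continuous_translate u)
      have e0 : ∫ z, f z.1 * g z.2
          ∂(lebWeight Ω (cutoffFun n) ⊗ₘ P.fiber.map (Config.translate u)) =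
          ∫ z, f z.1 * g (z.2.translate u) ∂(lebWeight Ω (cutoffFun n) ⊗ₘ P.fiber) := by
        rw [Measure.compProd_map hmt, integral_map (by fun_prop)
          (by fun_prop : Continuous fun z : Ω × Config d => f z.1 * g z.2).aestronglyMeasurable]
        rfl
      rw [e0, integral_lebWeight_compProd hΩm (cutoffFun_continuous n)
          (integrable_cutoffFun n) (cutoffFun_nonneg n) P.fiber
          (F := fun z => f z.1 * g (z.2.translate u))
        ((f.continuous.comp continuous_fst).mul (hgu.comp continuous_snd))
        (hfg _ fun C => g.norm_coe_le_norm _),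
        integral_lebWeight_compProd hΩm (cutoffFun_continuous n)
          (integrable_cutoffFun n) (cutoffFun_nonneg n) P.fiber (F := fun z => f z.1 * g z.2)
        (by fun_prop) (hfg _ fun C => g.norm_coe_le_norm _)]
      have := integral_translate_eq_of_tendstoTagged hd hΩm hN1 hN x h hφ (norm_nonneg f) hφb g u
      simp only [hφf, TaggedProcess.toMeasure] at this
      simpa only [mul_comm, mul_left_comm, mul_assoc] using this
    have := Kernel.ae_eq_of_compProd_eq heq
    filter_upwards [this] with y hy
    exact (Kernel.map_apply _ hmt y).symm.trans hy
  obtain ⟨S, hSc, hSd⟩ := TopologicalSpace.exists_countable_dense (E d)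
  have := (ae_ball_iff hSc).2 fun u (_ : u ∈ S) => hu u
  filter_upwards [this] with y hy
  exact isStationary_of_dense hSd hy

/-! ### The intensity of the limit -/

theorem continuous_pairing_mollifier_snd :
    Continuous fun z : Ω × Config d => z.2.pairing (mollifier d) :=
  (Config.continuous_pairing _).comp continuous_snd

theorem measurable_pairing_mollifier_snd :
    Measurable fun z : Ω × Config d => ENNReal.ofReal (z.2.pairing (mollifier d)) :=
  continuous_pairing_mollifier_snd.measurable.ennreal_ofReal

/-- The intensity measure of a stationary process is the first marginal of the process weighted by
the local number of points. -/
theorem TaggedProcess.intensity_eq (hΩ : MeasurableSet Ω) (P : TaggedProcess Ω)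
    (hst : ∀ᵐ y ∂leb Ω, IsStationary (P.fiber y))
    (h2 : ∫⁻ z, ENNReal.ofReal (z.2.pairing (mollifier d)) ^ 2 ∂P.toMeasure < ∞) :
    P.intensity = (P.toMeasure.withDensity
      fun z => ENNReal.ofReal (z.2.pairing (mollifier d))).map Prod.fst := by
  have := sigmaFinite_leb hΩ
  have := P.isMarkov
  have hm := measurable_pairing_mollifier_snd (Ω := Ω)
  -- The ergodic theorem is applied fiber by fiber and needs a second moment on almost every fiber.
  have hfin : ∀ᵐ y ∂leb Ω,
      ∫⁻ C, ENNReal.ofReal (C.pairing (mollifier d)) ^ 2 ∂P.fiber y < ∞ := by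
    rw [TaggedProcess.toMeasure, Measure.lintegral_compProd (hm.pow_const 2)] at h2
    exact ae_lt_top (hm.pow_const 2).lintegral_kernel_prod_right' h2.ne
  have hae : (fun y => intens (P.fiber y)) =ᵐ[leb Ω]
      fun y => ∫⁻ C, ENNReal.ofReal (C.pairing (mollifier d)) ∂P.fiber y := by
    filter_upwards [hst, hfin] with y hy hy2
    exact hy.intens_eq hy2
  rw [TaggedProcess.intensity, withDensity_congr_ae hae]
  ext A hA
  rw [withDensity_apply _ hA, Measure.map_apply measurable_fst hA,
    withDensity_apply _ (measurable_fst hA), ← Set.prod_univ, TaggedProcess.toMeasure,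
    Measure.setLIntegral_compProd hm hA MeasurableSet.univ]
  simp

theorem TaggedProcess.integral_intensity (hΩ : MeasurableSet Ω) (P : TaggedProcess Ω)
    (hst : ∀ᵐ y ∂leb Ω, IsStationary (P.fiber y))
    (h2 : ∫⁻ z, ENNReal.ofReal (z.2.pairing (mollifier d)) ^ 2 ∂P.toMeasure < ∞)
    {f : Ω → ℝ} (hf : Continuous f) :
    ∫ y, f y ∂P.intensity = ∫ z, f z.1 * z.2.pairing (mollifier d) ∂P.toMeasure := by
  rw [P.intensity_eq hΩ hst h2, integral_map measurable_fst.aemeasurable hf.aestronglyMeasurable,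
    integral_withDensity_eq_integral_toReal_smul measurable_pairing_mollifier_snd
      (ae_of_all _ fun _ => ENNReal.ofReal_lt_top)]
  refine integral_congr_ae (ae_of_all _ fun z => ?_)
  dsimp only
  rw [ENNReal.toReal_ofReal (z.2.pairing_nonneg mollifier_nonneg), smul_eq_mul, mul_comm]

/-! ### Comparison of the empirical measure with the smoothed one -/

theorem hasCompactSupport_of_le_cutoffFun {φ : E d → ℝ} {B R : ℝ}
    (hb : ∀ y, |φ y| ≤ B * cutoffFun R y) : HasCompactSupport φ := by
  refine HasCompactSupport.intro (isCompact_closedBall (0 : E d) (R + 1)) fun y hy => ?_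
  rw [mem_closedBall_zero_iff, not_le] at hy
  have := hb y
  rwa [cutoffFun_eq_zero hy.le, mul_zero, abs_nonpos_iff] at this

theorem lintegral_mollifier_scale (hd : 1 ≤ d) {N : ℕ} (hN : 1 ≤ N) (p : E d) :
    ∫⁻ y : E d, ENNReal.ofReal (mollifier d (scale d N • p - scale d N • y)) =
      (N : ℝ≥0∞)⁻¹ := by
  rw [lintegral_comp_scale hd hN
    (fun z => ENNReal.ofReal (mollifier d (scale d N • p - z))),
    lintegral_sub_left_eq_self (fun u => ENNReal.ofReal (mollifier d u)), lintegral_mollifier,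
    mul_one]

theorem continuous_mollifier_scale (N : ℕ) (p : E d) :
    Continuous fun y : E d => mollifier d (scale d N • p - scale d N • y) := by fun_prop

theorem integrable_mollifier_scale (hd : 1 ≤ d) {N : ℕ} (hN : 1 ≤ N) (p : E d) :
    Integrable fun y : E d => mollifier d (scale d N • p - scale d N • y) := by
  refine ⟨(continuous_mollifier_scale N p).aestronglyMeasurable, ?_⟩
  rw [hasFiniteIntegral_iff_ofReal (ae_of_all _ fun y => mollifier_nonneg _),
    lintegral_mollifier_scale hd hN]
  simp only [ENNReal.inv_lt_top]
  exact_mod_cast hN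

theorem integral_mollifier_scale (hd : 1 ≤ d) {N : ℕ} (hN : 1 ≤ N) (p : E d) :
    ∫ y : E d, mollifier d (scale d N • p - scale d N • y) = (N : ℝ)⁻¹ := by
  rw [integral_eq_lintegral_of_nonneg_ae (ae_of_all _ fun y => mollifier_nonneg _)
    (continuous_mollifier_scale N p).aestronglyMeasurable, lintegral_mollifier_scale hd hN]
  simp

theorem pairing_mollifier_rescaled {N : ℕ} (x : Fin N → Ω) (u : E d) :
    ((rescaled x).translate u).pairing (mollifier d) = ∑ i, mollifier d (micro x i - u) := by
  rw [rescaled_eq, Config.translate_ofPoints, Config.pairing_ofPoints]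

theorem mollifier_scale_eq_zero {N : ℕ} (hN : 1 ≤ N) {p y : E d}
    (h : (scale d N)⁻¹ < ‖p - y‖) : mollifier d (scale d N • p - scale d N • y) = 0 := by
  have ha := scale_pos (d := d) hN
  refine mollifier_eq_zero ?_
  rw [← smul_sub, norm_smul, Real.norm_of_nonneg ha.le]
  have : 1 < scale d N * ‖p - y‖ := by
    calc 1 = scale d N * (scale d N)⁻¹ := (mul_inv_cancel₀ ha.ne').symm
      _ < _ := by gcongr
  linarith

/-- On the whole space, smoothing changes the empirical averages by at most the modulus of
continuity of the test function. -/
theorem abs_average_sub_integral_le (hd : 1 ≤ d) {N : ℕ} (hN : 1 ≤ N) (x : Fin N → Ω)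
    {φ : E d → ℝ} (hφ : Continuous φ) {B : ℝ} (hb : ∀ y, |φ y| ≤ B) {ω : ℝ}
    (hω : ∀ p y, ‖p - y‖ ≤ (scale d N)⁻¹ → |φ p - φ y| ≤ ω) :
    |(N : ℝ)⁻¹ * ∑ i, φ (x i) -
      ∫ y : E d, φ y * ((rescaled x).translate (scale d N • y)).pairing (mollifier d)| ≤ ω := by
  have hN0 : (0 : ℝ) < N := by exact_mod_cast hN
  have hi : ∀ i, Integrable fun y : E d =>
      φ y * mollifier d (scale d N • (x i : E d) - scale d N • y) := fun i =>
    (integrable_mollifier_scale hd hN _).bdd_mul hφ.aestronglyMeasurable (ae_of_all _ hb)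
  simp only [pairing_mollifier_rescaled, micro, Finset.mul_sum]
  rw [integral_finsetSum _ fun i _ => hi i, ← Finset.sum_sub_distrib]
  -- Point by point: the mass 1/N of an atom is spread by the bump over a ball of radius at most
  -- N^{-1/d}, where φ varies by at most ω.
  have hterm : ∀ i, |(N : ℝ)⁻¹ * φ (x i) -
      ∫ y : E d, φ y * mollifier d (scale d N • (x i : E d) - scale d N • y)| ≤ ω * (N : ℝ)⁻¹ := by
    intro i
    have hm := integrable_mollifier_scale hd hN (x i : E d)
    rw [← integral_mollifier_scale hd hN (x i : E d), mul_comm _ (φ _), ← integral_const_mul,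
      ← integral_sub (hm.const_mul _) (hi i), ← integral_const_mul]
    refine abs_integral_le_integral_abs.trans (integral_mono_of_nonneg
      (ae_of_all _ fun y => abs_nonneg _) (hm.const_mul _) (ae_of_all _ fun y => ?_))
    dsimp only
    rw [← sub_mul, abs_mul, abs_of_nonneg (mollifier_nonneg _)]
    rcases le_or_gt ‖(x i : E d) - y‖ (scale d N)⁻¹ with h | h
    · exact mul_le_mul_of_nonneg_right (hω _ _ h) (mollifier_nonneg _)
    · rw [mollifier_scale_eq_zero hN h, mul_zero, mul_zero]
  calc _ ≤ ∑ i : Fin N, ω * (N : ℝ)⁻¹ :=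
        (Finset.abs_sum_le_sum_abs _ _).trans (Finset.sum_le_sum fun i _ => hterm i)
    _ = ω := by
        rw [Finset.sum_const, Finset.card_univ, Fintype.card_fin, nsmul_eq_mul]
        field_simp

/-- The complement of a closed set in its neighborhoods has small volume. -/
theorem tendsto_volume_cthickening_diff (hΩ : IsClosed Ω) (R : ℝ) :
    Tendsto (fun r => volume ((Metric.cthickening r Ω \ Ω) ∩ Metric.closedBall (0 : E d) R))
      (𝓝 0) (𝓝 0) := by
  set μ := (volume : Measure (E d)).restrict (Metric.closedBall 0 R) with hμ
  have : IsFiniteMeasure μ := ⟨by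
    rw [hμ, Measure.restrict_apply_univ]
    exact measure_closedBall_lt_top⟩
  have h := tendsto_measure_cthickening_of_isClosed (μ := μ)
    ⟨1, one_pos, measure_ne_top _ _⟩ hΩ
  have h2 := ENNReal.Tendsto.sub h (tendsto_const_nhds (x := μ Ω)) (Or.inl (measure_ne_top μ Ω))
  rw [tsub_self] at h2
  refine h2.congr fun r => ?_
  rw [← measure_sdiff (Metric.self_subset_cthickening Ω) hΩ.measurableSet.nullMeasurableSet
    (measure_ne_top _ _), hμ, Measure.restrict_apply
    (Metric.isClosed_cthickening.measurableSet.diff hΩ.measurableSet)]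

/-- The smoothed empirical measure gives small mass to the complement of `Ω`. -/
theorem lintegral_compl_le (hΩ : IsClosed Ω) {N : ℕ} (hN : 1 ≤ N) (x : Fin N → Ω) (R : ℝ)
    {A : ℝ≥0∞} (hA : ∫⁻ y : E d, ENNReal.ofReal
        (((rescaled x).translate (scale d N • y)).pairing (mollifier d)) ^ 2 ≤ A) :
    ∫⁻ y in Ωᶜ ∩ Metric.closedBall 0 R, ENNReal.ofReal
        (((rescaled x).translate (scale d N • y)).pairing (mollifier d)) ≤
      A ^ (1 / 2 : ℝ) * volume ((Metric.cthickening (scale d N)⁻¹ Ω \ Ω) ∩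
        Metric.closedBall (0 : E d) R) ^ (1 / 2 : ℝ) := by
  set G : E d → ℝ≥0∞ := fun y => ENNReal.ofReal
    (((rescaled x).translate (scale d N • y)).pairing (mollifier d)) with hG
  set S := (Metric.cthickening (scale d N)⁻¹ Ω \ Ω) ∩ Metric.closedBall (0 : E d) R with hS
  have hSm : MeasurableSet S := (Metric.isClosed_cthickening.measurableSet.diff
    hΩ.measurableSet).inter Metric.isClosed_closedBall.measurableSet
  have hGm : Measurable G := by
    simp only [hG, pairing_mollifier_rescaled]
    have : Continuous fun y : E d => ∑ i, mollifier d (micro x i - scale d N • y) := by fun_prop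
    exact this.measurable.ennreal_ofReal
  -- The points lie in Ω, so a tag farther than N^{-1/d} from Ω sees none of them.
  have hG0 : ∀ y, y ∉ Metric.cthickening (scale d N)⁻¹ Ω → G y = 0 := by
    intro y hy
    simp only [hG, pairing_mollifier_rescaled]
    rw [Finset.sum_eq_zero, ENNReal.ofReal_zero]
    intro i _
    refine mollifier_scale_eq_zero hN (lt_of_not_ge fun h => hy ?_)
    refine Metric.mem_cthickening_of_dist_le y (x i) _ _ (x i).2 ?_
    rwa [dist_comm, dist_eq_norm]
  have h1 : ∫⁻ y in Ωᶜ ∩ Metric.closedBall 0 R, G y ≤ ∫⁻ y in S, G y := by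
    rw [← lintegral_indicator (hΩ.measurableSet.compl.inter
      Metric.isClosed_closedBall.measurableSet), ← lintegral_indicator hSm]
    refine lintegral_mono fun y => ?_
    by_cases hy : y ∈ S
    · rw [Set.indicator_of_mem hy]
      exact Set.indicator_le_self _ _ _
    · refine Set.indicator_apply_le' (fun hy' => ?_) fun _ => zero_le
      rw [hG0 y fun h => hy ⟨⟨h, hy'.1⟩, hy'.2⟩]
      exact zero_le
  refine h1.trans ?_
  -- Cauchy–Schwarz against the constant 1: a bounded second moment prevents concentration on a set
  -- of small volume.
  have h2 := ENNReal.lintegral_mul_le_Lp_mul_Lq (volume.restrict S)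
    Real.HolderConjugate.two_two (f := G) (g := fun _ => 1)
    hGm.aemeasurable aemeasurable_const
  simp only [Pi.mul_apply, mul_one, ENNReal.rpow_two, one_pow, lintegral_one,
    Measure.restrict_apply_univ] at h2
  refine h2.trans ?_
  gcongr
  exact (setLIntegral_le_lintegral _ _).trans hA

/-- The averages over the points and over the smoothed measure on `Ω` have the same limits. -/
theorem tendsto_average_sub (hd : 1 ≤ d) (hΩ : IsClosed Ω) {N : ℕ → ℕ}
    (hN1 : ∀ k, 1 ≤ N k) (hN : Tendsto N atTop atTop) (x : ∀ k, Fin (N k) → Ω)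
    {A : ℝ≥0∞} (hAt : A ≠ ∞) (hA : ∀ k, ∫⁻ y : E d, ENNReal.ofReal
        (((rescaled (x k)).translate (scale d (N k) • y)).pairing (mollifier d)) ^ 2 ≤ A)
    {φ : E d → ℝ} (hφ : Continuous φ) {B R : ℝ} (hB : 0 ≤ B)
    (hb : ∀ y, |φ y| ≤ B * cutoffFun R y) :
    Tendsto (fun k => (N k : ℝ)⁻¹ * ∑ i, φ (x k i) -
      ∫ z, φ (z.1 : E d) * z.2.pairing (mollifier d) ∂taggedEmp (x k)) atTop (𝓝 0) := by
  have hφB : ∀ y, |φ y| ≤ B := fun y =>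
    (hb y).trans (mul_le_of_le_one_right hB (cutoffFun_le_one _ _))
  have hε : Tendsto (fun k => (scale d (N k))⁻¹) atTop (𝓝 0) :=
    tendsto_inv_atTop_zero.comp ((tendsto_scale hd).comp hN)
  set G : ∀ k, E d → ℝ := fun k y =>
    ((rescaled (x k)).translate (scale d (N k) • y)).pairing (mollifier d) with hG
  have hG0 : ∀ k y, 0 ≤ G k y := fun k y => Config.pairing_nonneg _ mollifier_nonneg
  have hGc : ∀ k, Continuous (G k) := fun k => by
    simp only [hG, pairing_mollifier_rescaled]
    fun_prop
  have hφG : ∀ k, Integrable fun y => φ y * G k y := fun k => by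
    simp only [hG, pairing_mollifier_rescaled, Finset.mul_sum, micro]
    exact integrable_finsetSum _ fun i _ =>
      (integrable_mollifier_scale hd (hN1 k) _).bdd_mul hφ.aestronglyMeasurable (ae_of_all _ hφB)
  have h1 : Tendsto (fun k => (N k : ℝ)⁻¹ * ∑ i, φ (x k i) - ∫ y, φ y * G k y) atTop (𝓝 0) := by
    have huc := (hasCompactSupport_of_le_cutoffFun hb).uniformContinuous_of_continuous hφ
    rw [Metric.tendsto_atTop]
    intro e he
    obtain ⟨δ, hδ, hδe⟩ := Metric.uniformContinuous_iff.1 huc (e / 2) (half_pos he)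
    obtain ⟨K, hK⟩ := Metric.tendsto_atTop.1 hε δ hδ
    refine ⟨K, fun k hk => ?_⟩
    rw [dist_zero_right]
    refine (abs_average_sub_integral_le hd (hN1 k) (x k) hφ hφB (ω := e / 2)
      fun p y hpy => ?_).trans_lt (half_lt_self he)
    have := hK k hk
    rw [dist_zero_right, Real.norm_of_nonneg (inv_nonneg.2 (scale_pos (hN1 k)).le)] at this
    refine (hδe (a := p) (b := y) ?_).le
    rw [dist_eq_norm]
    exact hpy.trans_lt this
  -- Tags range over Ω only, so the smoothed mass just outside Ω is missing from the tagged
  -- integral; it vanishes with the volume of the thin shell.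
  have h2 : Tendsto (fun k => ∫ y in Ωᶜ, φ y * G k y) atTop (𝓝 0) := by
    rw [tendsto_zero_iff_enorm_tendsto_zero]
    have hlim : Tendsto (fun k => ENNReal.ofReal B * (A ^ (1 / 2 : ℝ) *
        volume ((Metric.cthickening (scale d (N k))⁻¹ Ω \ Ω) ∩
          Metric.closedBall (0 : E d) (R + 1)) ^ (1 / 2 : ℝ))) atTop (𝓝 0) := by
      have h3 := (ENNReal.continuous_rpow_const (y := (1 / 2 : ℝ))).tendsto 0 |>.comp
        ((tendsto_volume_cthickening_diff hΩ (R + 1)).comp hε)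
      rw [ENNReal.zero_rpow_of_pos (by norm_num)] at h3
      have hA2 : A ^ (1 / 2 : ℝ) ≠ ∞ := ENNReal.rpow_ne_top_of_nonneg (by norm_num) hAt
      have h4 := ENNReal.Tendsto.const_mul (a := ENNReal.ofReal B)
        (ENNReal.Tendsto.const_mul h3 (Or.inr hA2)) (Or.inr ENNReal.ofReal_ne_top)
      rw [mul_zero, mul_zero] at h4
      exact h4
    refine tendsto_of_tendsto_of_tendsto_of_le_of_le tendsto_const_nhds hlim
      (fun _ => zero_le) fun k => ?_
    refine (enorm_integral_le_lintegral_enorm _).trans ?_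
    refine le_trans ?_ (mul_le_mul_right (lintegral_compl_le hΩ (hN1 k) (x k) (R + 1) (hA k)) _)
    rw [← lintegral_const_mul _ (hGc k).measurable.ennreal_ofReal,
      ← lintegral_indicator hΩ.measurableSet.compl,
      ← lintegral_indicator (hΩ.measurableSet.compl.inter
        Metric.isClosed_closedBall.measurableSet)]
    refine lintegral_mono fun y => ?_
    refine Set.indicator_apply_le' (fun hy => ?_) fun _ => zero_le
    rcases le_or_gt ‖y‖ (R + 1) with hy' | hy'
    · have hm : y ∈ Ωᶜ ∩ Metric.closedBall 0 (R + 1) := ⟨hy, mem_closedBall_zero_iff.2 hy'⟩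
      rw [Set.indicator_of_mem hm, enorm_mul,
        ← ofReal_norm, ← ofReal_norm, Real.norm_of_nonneg (hG0 k y)]
      exact mul_le_mul_left (ENNReal.ofReal_le_ofReal (hφB y)) _
    · have := hb y
      rw [cutoffFun_eq_zero hy'.le, mul_zero, abs_nonpos_iff] at this
      simp [this]
  have h3 := h1.add h2
  rw [add_zero] at h3
  refine h3.congr fun k => ?_
  rw [integral_taggedEmp hΩ.measurableSet (x k) hφ (Config.continuous_pairing (mollifier d)),
    ← integral_add_compl hΩ.measurableSet (hφG k)]
  simp only [hG]
  ring

/-! ### Lower semicontinuity of the energy -/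

theorem offDiag_truncKernel_mono (s R : ℝ) (C : Config d) :
    Monotone fun M : ℕ => ENNReal.ofReal (offDiag (truncKernel s R M) C) := by
  intro M M' h
  simp only [ofReal_offDiag _ (truncKernel_nonneg s R _)]
  exact ENNReal.tsum_le_tsum fun p => ENNReal.tsum_le_tsum fun q =>
    mul_le_mul_right (ENNReal.ofReal_le_ofReal (truncKernel_mono s R (p, q) h)) _

theorem measurable_offDiag (s R : ℝ) (M : ℕ) :
    Measurable fun C : Config d => ENNReal.ofReal (offDiag (truncKernel s R M) C) :=
  (continuous_offDiag _).measurable.ennreal_ofReal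

/-- Integer sides and suprema of continuous truncations give measurable integrands, as Fatou's lemma
over the tag requires. -/
theorem rieszW_le_liminf_nat (s : ℝ) (P : Measure (Config d)) :
    rieszW s P ≤ liminf (fun n : ℕ => (∫⁻ C, ⨆ M : ℕ,
      ENNReal.ofReal (offDiag (truncKernel s n M) C) ∂P) / (n : ℝ≥0∞) ^ d) atTop := by
  have h : rieszW s P ≤ liminf (fun R : ℝ =>
      (∫⁻ C, interaction s (cube d R) (cube d R) C ∂P) / ENNReal.ofReal R ^ d)
      (map (Nat.cast : ℕ → ℝ) atTop) := liminf_le_liminf_of_le tendsto_natCast_atTop_atTop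
  have h' : rieszW s P ≤ liminf (fun n : ℕ =>
      (∫⁻ C, interaction s (cube d n) (cube d n) C ∂P) / (n : ℝ≥0∞) ^ d) atTop := by
    simpa [liminf, limsInf, Filter.map_map, Function.comp_def, ENNReal.ofReal_natCast] using h
  refine h'.trans (liminf_le_liminf (Eventually.of_forall fun n => ?_))
  exact ENNReal.div_le_div_right
    (lintegral_mono fun C => interaction_le_iSup s (Nat.cast_nonneg n) C) _

theorem tendsto_add_two_div_pow (d : ℕ) :
    Tendsto (fun n : ℕ => ENNReal.ofReal ((n : ℝ) + 2) ^ d / (n : ℝ≥0∞) ^ d) atTop (𝓝 1) := by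
  have h1 : Tendsto (fun n : ℕ => ((1 : ℝ) + 2 * ((n : ℝ))⁻¹) ^ d) atTop (𝓝 1) := by
    have := (((tendsto_inv_atTop_zero.comp tendsto_natCast_atTop_atTop).const_mul
      (2 : ℝ)).const_add 1).pow d
    simpa using this
  have h2 := (ENNReal.continuous_ofReal.tendsto _).comp h1
  rw [ENNReal.ofReal_one] at h2
  refine h2.congr' ?_
  filter_upwards [eventually_gt_atTop 0] with n hn
  have hn' : (0 : ℝ) < n := by exact_mod_cast hn
  rw [Function.comp_apply, ← ENNReal.ofReal_natCast, ← ENNReal.ofReal_pow (by positivity),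
    ← ENNReal.ofReal_pow hn'.le, ← ENNReal.ofReal_div_of_pos (by positivity), ← div_pow]
  congr 2
  field_simp

/-- For a fixed window and truncation the bound is lower semicontinuity. Monotone convergence
removes the truncation, and Fatou's lemma in the window size handles the liminf in the definition;
the excess factor (n + 2)^d / n^d tends to 1. -/
theorem TaggedProcess.rieszW_le_liminf (hd : 1 ≤ d) (hΩ : MeasurableSet Ω) (s : ℝ) {N : ℕ → ℕ}
    (hN1 : ∀ k, 1 ≤ N k) (x : ∀ k, Fin (N k) → Ω) (P : TaggedProcess Ω)
    (h : TendstoTagged (fun k => taggedEmp (x k)) P.toMeasure) :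
    P.rieszW s ≤ liminf (fun k => pairEnergy s (x k)) atTop := by
  have := sigmaFinite_leb hΩ
  have := P.isMarkov
  set L := liminf (fun k => pairEnergy s (x k)) atTop with hL
  have hstep : ∀ n M : ℕ, ∫⁻ y, ∫⁻ C, ENNReal.ofReal (offDiag (truncKernel s n M) C)
      ∂P.fiber y ∂leb Ω ≤ ENNReal.ofReal ((n : ℝ) + 2) ^ d * L := by
    intro n M
    have hm := measurable_offDiag (d := d) s n M
    -- The maximum with zero provides the pointwise nonnegativity required, and `ENNReal.ofReal`
    -- does not see it.
    have h1 := h.lintegral_le_liminf hΩ (fun k => hasLebMarginal_taggedEmp (x k))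
      (hasLebMarginal_toMeasure hΩ P) (G := fun z => max (offDiag (truncKernel s n M) z.2) 0)
      (((continuous_offDiag _).comp continuous_snd).max continuous_const)
      fun z => le_max_right _ _
    simp only [ENNReal.ofReal_max, ENNReal.ofReal_zero, zero_le, sup_of_le_left] at h1
    rw [TaggedProcess.toMeasure, Measure.lintegral_compProd
      (f := fun z : Ω × Config d => ENNReal.ofReal (offDiag (truncKernel s n M) z.2))
      (hm.comp measurable_snd)] at h1
    refine h1.trans ?_
    rw [hL, ← ENNReal.liminf_const_mul_of_ne_zero_of_ne_top
      (pow_ne_zero _ (by simp; positivity)) (ENNReal.pow_ne_top ENNReal.ofReal_ne_top)]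
    refine liminf_le_liminf (Eventually.of_forall fun k => ?_)
    exact (lintegral_taggedEmp_le hΩ (x k) hm).trans
      (lintegral_offDiag_rescaled_le hd s n M (hN1 k) (x k))
  have hsup : ∀ n : ℕ, ∫⁻ y, ∫⁻ C, ⨆ M : ℕ, ENNReal.ofReal (offDiag (truncKernel s n M) C)
      ∂P.fiber y ∂leb Ω ≤ ENNReal.ofReal ((n : ℝ) + 2) ^ d * L := by
    intro n
    have e1 : ∀ y, ∫⁻ C, ⨆ M : ℕ, ENNReal.ofReal (offDiag (truncKernel s n M) C) ∂P.fiber y =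
        ⨆ M : ℕ, ∫⁻ C, ENNReal.ofReal (offDiag (truncKernel s n M) C) ∂P.fiber y := fun y =>
      lintegral_iSup (fun M => measurable_offDiag s n M)
        fun M M' hM C => offDiag_truncKernel_mono s n C hM
    simp only [e1]
    rw [lintegral_iSup (fun M => (measurable_offDiag s n M).lintegral_kernel)
      fun M M' hM y => lintegral_mono fun C => offDiag_truncKernel_mono s n C hM]
    exact iSup_le (hstep n)
  rcases eq_or_ne L ∞ with hLt | hLt
  · rw [hLt]; exact le_top
  have hmeas : ∀ n : ℕ, Measurable fun y => (∫⁻ C, ⨆ M : ℕ,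
      ENNReal.ofReal (offDiag (truncKernel s n M) C) ∂P.fiber y) / (n : ℝ≥0∞) ^ d := fun n =>
    ((Measurable.iSup fun M => measurable_offDiag s n M).lintegral_kernel).div_const _
  calc P.rieszW s ≤ ∫⁻ y, liminf (fun n : ℕ => (∫⁻ C, ⨆ M : ℕ,
        ENNReal.ofReal (offDiag (truncKernel s n M) C) ∂P.fiber y) / (n : ℝ≥0∞) ^ d) atTop ∂leb Ω :=
        lintegral_mono fun y => rieszW_le_liminf_nat s (P.fiber y)
    _ ≤ liminf (fun n : ℕ => ∫⁻ y, (∫⁻ C, ⨆ M : ℕ,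
        ENNReal.ofReal (offDiag (truncKernel s n M) C) ∂P.fiber y) / (n : ℝ≥0∞) ^ d ∂leb Ω)
        atTop := lintegral_liminf_le hmeas
    _ ≤ liminf (fun n : ℕ => ENNReal.ofReal ((n : ℝ) + 2) ^ d / (n : ℝ≥0∞) ^ d * L) atTop := by
        refine liminf_le_liminf (Eventually.of_forall fun n => ?_)
        simp only [div_eq_mul_inv]
        rw [lintegral_mul_const _
          (Measurable.iSup fun M => measurable_offDiag s n M).lintegral_kernel, mul_right_comm]
        exact mul_le_mul_left (hsup n) _
    _ = L := by
        have := ENNReal.Tendsto.mul_const (b := L) (tendsto_add_two_div_pow d) (Or.inr hLt)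
        rw [one_mul] at this
        exact this.liminf_eq

theorem lintegral_le_liminf_of_tendstoWeakly {α : Type*} [TopologicalSpace α] [MeasurableSpace α]
    [OpensMeasurableSpace α] {m : ℕ → Measure α} {m' : Measure α} [∀ k, IsFiniteMeasure (m k)]
    [IsFiniteMeasure m'] (h : TendstoWeakly m m') {V : α → ℝ} (hV : Continuous V)
    (hV0 : ∀ a, 0 ≤ V a) :
    ∫⁻ a, ENNReal.ofReal (V a) ∂m' ≤ liminf (fun k => ∫⁻ a, ENNReal.ofReal (V a) ∂m k) atTop := by
  set f : ℕ → (α →ᵇ ℝ) := fun n => BoundedContinuousFunction.ofNormedAddCommGroup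
    (fun a => min (V a) n) (by fun_prop) n fun a => by
      rw [Real.norm_of_nonneg (le_min (hV0 a) (Nat.cast_nonneg n))]
      exact min_le_right _ _ with hf
  have hf0 : ∀ n a, 0 ≤ f n a := fun n a => le_min (hV0 a) (Nat.cast_nonneg n)
  have hfV : ∀ n a, f n a ≤ V a := fun n a => min_le_left _ _
  have hsup : ∀ a, ENNReal.ofReal (V a) = ⨆ n, ENNReal.ofReal (f n a) := fun a => by
    refine le_antisymm ?_ (iSup_le fun n => ENNReal.ofReal_le_ofReal (hfV n a))
    obtain ⟨n, hn⟩ := exists_nat_ge (V a)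
    refine le_trans (ENNReal.ofReal_le_ofReal (le_of_eq (min_eq_left hn).symm))
      (le_iSup (fun n => ENNReal.ofReal (f n a)) n)
  have hof : ∀ (n : ℕ) (ν : Measure α) [IsFiniteMeasure ν],
      ENNReal.ofReal (∫ a, f n a ∂ν) = ∫⁻ a, ENNReal.ofReal (f n a) ∂ν := fun n ν _ =>
    ofReal_integral_eq_lintegral_ofReal ((f n).integrable ν) (ae_of_all _ (hf0 n))
  calc ∫⁻ a, ENNReal.ofReal (V a) ∂m' = ⨆ n, ∫⁻ a, ENNReal.ofReal (f n a) ∂m' := by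
        rw [← lintegral_iSup (fun n => (f n).continuous.measurable.ennreal_ofReal)
          fun n n' hn a => ENNReal.ofReal_le_ofReal
            (min_le_min_left _ (by exact_mod_cast hn : (n : ℝ) ≤ n'))]
        exact lintegral_congr hsup
    _ ≤ _ := by
        refine iSup_le fun n => ?_
        have ht := (ENNReal.continuous_ofReal.tendsto _).comp (h (f n))
        rw [← hof, ← ht.liminf_eq]
        refine liminf_le_liminf (Eventually.of_forall fun k => ?_)
        simp only [Function.comp_apply]
        rw [hof]
        exact lintegral_mono fun a => ENNReal.ofReal_le_ofReal (hfV n a)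

/-! ### From vague to weak convergence -/

/-- `cutoffFun` as a bounded continuous function on `Ω`. -/
def cutoffOn (Ω : Set (E d)) (n : ℕ) : Ω →ᵇ ℝ :=
  BoundedContinuousFunction.ofNormedAddCommGroup (fun y : Ω => cutoffFun n (y : E d))
    ((cutoffFun_continuous _).comp continuous_subtype_val) 1 fun y => by
      rw [Real.norm_of_nonneg (cutoffFun_nonneg _ _)]
      exact cutoffFun_le_one _ _

theorem cutoffOn_apply (n : ℕ) (y : Ω) : cutoffOn Ω n y = cutoffFun n (y : E d) := rfl

theorem abs_integral_sub_cutoff_le (ν : Measure Ω) [IsProbabilityMeasure ν] (f : Ω →ᵇ ℝ) (n : ℕ)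
    {ε : ℝ} (hε : 1 - ε ≤ ∫ y, cutoffOn Ω n y ∂ν) :
    |∫ y, f y ∂ν - ∫ y, (f * cutoffOn Ω n) y ∂ν| ≤ ‖f‖ * ε := by
  rw [← integral_sub (f.integrable ν) ((f * cutoffOn Ω n).integrable ν)]
  have hi : Integrable (fun y => 1 - cutoffOn Ω n y) ν :=
    (integrable_const 1).sub ((cutoffOn Ω n).integrable ν)
  refine (abs_integral_le_integral_abs.trans (integral_mono_of_nonneg
    (ae_of_all _ fun y => abs_nonneg _) (hi.const_mul ‖f‖) (ae_of_all _ fun y => ?_))).trans ?_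
  · have h1 : 0 ≤ 1 - cutoffOn Ω n y := sub_nonneg.2 (cutoffFun_le_one _ _)
    have h2 : f y - (f * cutoffOn Ω n) y = f y * (1 - cutoffOn Ω n y) := by
      rw [BoundedContinuousFunction.mul_apply]; ring
    dsimp only
    rw [h2, abs_mul, abs_of_nonneg h1]
    exact mul_le_mul_of_nonneg_right (f.norm_coe_le_norm y) h1
  · rw [integral_const_mul, integral_sub (integrable_const 1) ((cutoffOn Ω n).integrable ν)]
    refine mul_le_mul_of_nonneg_left ?_ (norm_nonneg f)
    simp
    linarith

/-- Convergence against compactly cut-off functions plus uniform tightness. The limit is not assumed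
finite: tightness shows that the masses of its cutoffs tend to exactly one. -/
theorem tendstoWeakly_of_tendsto_cutoff {m : ℕ → Measure Ω} [∀ k, IsProbabilityMeasure (m k)]
    {ν : Measure Ω}
    (hv : ∀ (f : Ω →ᵇ ℝ) (n : ℕ), Tendsto (fun k => ∫ y, (f * cutoffOn Ω n) y ∂m k) atTop
      (𝓝 (∫ y, (f * cutoffOn Ω n) y ∂ν)))
    (ht : ∀ ε : ℝ, 0 < ε → ∃ n₀ : ℕ, ∀ n, n₀ ≤ n → ∀ k, 1 - ε ≤ ∫ y, cutoffOn Ω n y ∂m k) :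
    IsProbabilityMeasure ν ∧ TendstoWeakly m ν := by
  have hv1 : ∀ n : ℕ, Tendsto (fun k => ∫ y, cutoffOn Ω n y ∂m k) atTop
      (𝓝 (∫ y, cutoffOn Ω n y ∂ν)) := fun n => by simpa using hv 1 n
  have hlow : ∀ ε : ℝ, 0 < ε → ∃ n₀ : ℕ, ∀ n, n₀ ≤ n → 1 - ε ≤ ∫ y, cutoffOn Ω n y ∂ν := by
    intro ε hε
    obtain ⟨n₀, hn₀⟩ := ht ε hε
    exact ⟨n₀, fun n hn => ge_of_tendsto' (hv1 n) (hn₀ n hn)⟩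
  have hup : ∀ n, ∫ y, cutoffOn Ω n y ∂ν ≤ 1 := fun n => by
    refine le_of_tendsto' (hv1 n) fun k => ?_
    have := integral_mono ((cutoffOn Ω n).integrable (m k)) (integrable_const (1 : ℝ))
      fun y => cutoffFun_le_one _ _
    simpa using this
  have hc0 : ∀ n y, 0 ≤ cutoffOn Ω n y := fun n y => cutoffFun_nonneg _ _
  have hsup : ν Set.univ = ⨆ n, ∫⁻ y, ENNReal.ofReal (cutoffOn Ω n y) ∂ν := by
    rw [← lintegral_iSup (fun n => (cutoffOn Ω n).continuous.measurable.ennreal_ofReal)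
      fun n n' hn y => ENNReal.ofReal_le_ofReal
        (cutoffFun_mono (by exact_mod_cast hn : (n : ℝ) ≤ n') _), ← lintegral_one]
    refine lintegral_congr fun y => le_antisymm ?_ (iSup_le fun n => ?_)
    · obtain ⟨n, hn⟩ := exists_nat_ge ‖(y : E d)‖
      refine le_trans (le_of_eq ?_) (le_iSup (fun n => ENNReal.ofReal (cutoffOn Ω n y)) n)
      rw [cutoffOn_apply, cutoffFun_eq_one hn, ENNReal.ofReal_one]
    · exact ENNReal.ofReal_le_one.2 (cutoffFun_le_one _ _)
  have hmono : Monotone fun n => ∫⁻ y, ENNReal.ofReal (cutoffOn Ω n y) ∂ν := fun n n' hn =>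
    lintegral_mono fun y => ENNReal.ofReal_le_ofReal
      (cutoffFun_mono (by exact_mod_cast hn : (n : ℝ) ≤ n') _)
  have hprob : IsProbabilityMeasure ν := by
    refine ⟨le_antisymm ?_ ?_⟩
    · obtain ⟨n₀, hn₀⟩ := hlow (1 / 2) (by norm_num)
      rw [hsup]
      refine iSup_le fun n => (hmono (le_max_left n n₀)).trans ?_
      have h1 := hn₀ _ (le_max_right n n₀)
      -- The integral of a nonintegrable function is 0 by convention, which the lower bound
      -- excludes.
      have hi : Integrable (cutoffOn Ω (max n n₀)) ν := by
        by_contra hni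
        rw [integral_undef hni] at h1
        norm_num at h1
      dsimp only
      rw [← ofReal_integral_eq_lintegral_ofReal hi (ae_of_all _ (hc0 _))]
      exact ENNReal.ofReal_le_one.2 (hup _)
    · refine ENNReal.le_of_forall_pos_le_add fun ε hε _ => ?_
      obtain ⟨n₀, hn₀⟩ := hlow (min ε (1 / 2)) (by positivity)
      have h1 := hn₀ _ le_rfl
      have hi : Integrable (cutoffOn Ω n₀) ν := by
        by_contra hni
        rw [integral_undef hni] at h1
        have := min_le_right (ε : ℝ) (1 / 2)
        linarith
      have h2 : ENNReal.ofReal (∫ y, cutoffOn Ω n₀ y ∂ν) ≤ ν Set.univ := by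
        rw [ofReal_integral_eq_lintegral_ofReal hi (ae_of_all _ (hc0 _)), hsup]
        exact le_iSup (fun n => ∫⁻ y, ENNReal.ofReal (cutoffOn Ω n y) ∂ν) n₀
      refine le_trans ?_ (add_le_add_left h2 _)
      have h3 : 0 ≤ ∫ y, cutoffOn Ω n₀ y ∂ν := integral_nonneg (hc0 n₀)
      rw [← ENNReal.ofReal_coe_nnreal, ← ENNReal.ofReal_add h3 (NNReal.coe_nonneg ε),
        ← ENNReal.ofReal_one]
      refine ENNReal.ofReal_le_ofReal ?_
      have := min_le_left (ε : ℝ) (1 / 2)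
      linarith
  refine ⟨hprob, fun f => ?_⟩
  rw [Metric.tendsto_atTop]
  intro e he
  have hε : 0 < e / (3 * (‖f‖ + 1)) := by positivity
  have hfε : ‖f‖ * (e / (3 * (‖f‖ + 1))) < e / 3 := by
    rw [mul_div_assoc', div_lt_div_iff₀ (by positivity) (by norm_num)]
    nlinarith [norm_nonneg f]
  obtain ⟨n₀, hn₀⟩ := ht _ hε
  obtain ⟨n₁, hn₁⟩ := hlow _ hε
  set n := max n₀ n₁
  obtain ⟨K, hK⟩ := Metric.tendsto_atTop.1 (hv f n) (e / 3) (by positivity)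
  refine ⟨K, fun k hk => ?_⟩
  have h1 := abs_integral_sub_cutoff_le (m k) f n (hn₀ n (le_max_left _ _) k)
  have h2 := abs_integral_sub_cutoff_le ν f n (hn₁ n (le_max_right _ _))
  have h3 := hK k hk
  rw [Real.dist_eq] at h3 ⊢
  rw [abs_lt] at h3 ⊢
  rw [abs_le] at h1 h2
  constructor <;> linarith

/-- The confinement makes the empirical measures tight. -/
theorem exists_one_sub_le_integral_cutoffOn {V : Ω → ℝ} (hV : Continuous V)
    (hV0 : ∀ y, 0 ≤ V y) (hVinf : ¬ Bornology.IsBounded Ω →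
      Tendsto V (comap (fun y : Ω => ‖(y : E d)‖) atTop) atTop)
    {m : ℕ → Measure Ω} [∀ k, IsProbabilityMeasure (m k)] {A : ℝ} (hA : 0 ≤ A)
    (hm : ∀ k, ∫⁻ y, ENNReal.ofReal (V y) ∂m k ≤ ENNReal.ofReal A) {ε : ℝ} (hε : 0 < ε) :
    ∃ n₀ : ℕ, ∀ n, n₀ ≤ n → ∀ k, 1 - ε ≤ ∫ y, cutoffOn Ω n y ∂m k := by
  -- Chebyshev's level: the mass of the region where V ≥ L is at most A / L.
  obtain ⟨L, hL, hLε⟩ : ∃ L : ℝ, 0 < L ∧ A / L ≤ ε := by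
    refine ⟨A / ε + 1, by positivity, ?_⟩
    rw [div_le_iff₀ (by positivity)]
    have : ε * (A / ε + 1) = A + ε := by field_simp
    linarith
  obtain ⟨r, hr⟩ : ∃ r : ℝ, ∀ y : Ω, r ≤ ‖(y : E d)‖ → L ≤ V y := by
    by_cases hb : Bornology.IsBounded Ω
    · obtain ⟨r, hr⟩ := hb.subset_closedBall 0
      -- For bounded Ω the claim is vacuous, since no point of Ω has norm at least r + 1.
      refine ⟨r + 1, fun y hy => ?_⟩
      have := mem_closedBall_zero_iff.1 (hr y.2)
      linarith
    · have h1 := (hVinf hb).eventually_ge_atTop L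
      obtain ⟨r, hr⟩ := eventually_atTop.1 (eventually_comap.1 h1)
      exact ⟨r, fun y hy => hr _ hy y rfl⟩
  obtain ⟨n₀, hn₀⟩ := exists_nat_ge r
  refine ⟨n₀, fun n hn k => ?_⟩
  have hn' : (n₀ : ℝ) ≤ n := by exact_mod_cast hn
  have hVi : Integrable V (m k) := ⟨hV.aestronglyMeasurable, by
    rw [hasFiniteIntegral_iff_ofReal (ae_of_all _ hV0)]
    exact (hm k).trans_lt ENNReal.ofReal_lt_top⟩
  have hVA : ∫ y, V y ∂m k ≤ A := by
    rw [← ENNReal.ofReal_le_ofReal_iff hA,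
      ofReal_integral_eq_lintegral_ofReal hVi (ae_of_all _ hV0)]
    exact hm k
  have h1 : ∫ y, (1 - cutoffOn Ω n y) ∂m k ≤ ∫ y, L⁻¹ * V y ∂m k := by
    refine integral_mono ((integrable_const 1).sub ((cutoffOn Ω n).integrable (m k)))
      (hVi.const_mul _) fun y => ?_
    dsimp only
    rw [cutoffOn_apply]
    rcases le_or_gt ‖(y : E d)‖ n with hy | hy
    · rw [cutoffFun_eq_one hy, sub_self]
      exact mul_nonneg (inv_nonneg.2 hL.le) (hV0 y)
    · have h2 : 1 ≤ L⁻¹ * V y := by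
        rw [inv_mul_eq_div, one_le_div hL]
        exact hr y ((hn₀.trans hn').trans hy.le)
      have := cutoffFun_nonneg (n : ℝ) (y : E d)
      linarith
  rw [integral_sub (integrable_const 1) ((cutoffOn Ω n).integrable (m k)),
    integral_const_mul] at h1
  have h3 : L⁻¹ * ∫ y, V y ∂m k ≤ A / L := by
    rw [inv_mul_eq_div]
    gcongr
  simp only [integral_const, probReal_univ, smul_eq_mul, mul_one] at h1
  linarith

/-! ### Properties of the limits -/

theorem isProbabilityMeasure_emp {N : ℕ} (hN : 1 ≤ N) (x : Fin N → Ω) :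
    IsProbabilityMeasure (emp x) := ⟨by
  have h0 : (N : ℝ≥0∞) ≠ 0 := by simp; omega
  simp [emp, ENNReal.inv_mul_cancel h0 (ENNReal.natCast_ne_top N)]⟩

theorem integral_emp {N : ℕ} (x : Fin N → Ω) (f : Ω →ᵇ ℝ) :
    ∫ y, f y ∂emp x = (N : ℝ)⁻¹ * ∑ i, f (x i) := by
  rw [emp, integral_smul_measure, integral_finsetSum_measure fun i _ => f.integrable _]
  simp

theorem lintegral_emp {N : ℕ} (x : Fin N → Ω) (f : Ω → ℝ≥0∞) (hf : Measurable f) :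
    ∫⁻ y, f y ∂emp x = (N : ℝ≥0∞)⁻¹ * ∑ i, f (x i) := by
  rw [emp, lintegral_smul_measure, lintegral_finsetSum_measure, smul_eq_mul]
  simp only [lintegral_dirac' _ hf]

theorem liminf_add_liminf_le (u v : ℕ → ℝ≥0∞) :
    liminf u atTop + liminf v atTop ≤ liminf (fun k => u k + v k) atTop := by
  have hmono : ∀ w : ℕ → ℝ≥0∞, Monotone fun n => ⨅ k, ⨅ (_ : k ≥ n), w k := fun w n n' hn =>
    le_iInf₂ fun k hk => iInf₂_le k (hn.trans hk)
  simp only [liminf_eq_iSup_iInf_of_nat]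
  rw [ENNReal.iSup_add_iSup_of_monotone (hmono u) (hmono v)]
  exact iSup_mono fun n => le_iInf₂ fun k hk => add_le_add (iInf₂_le k hk) (iInf₂_le k hk)

/-- Limits of tagged empirical processes with bounded energy: stationarity, convergence of the
empirical measures to the intensity, and the lower bound on the energy. -/
theorem limit_properties (hd : 1 ≤ d) {s : ℝ} (hs : 0 ≤ s) (hΩ : IsClosed Ω) {V : Ω → ℝ}
    (hV : Continuous V) (hV0 : ∀ y, 0 ≤ V y)
    (hVinf : ¬ Bornology.IsBounded Ω →
      Tendsto V (comap (fun y : Ω => ‖(y : E d)‖) atTop) atTop)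
    {N : ℕ → ℕ} (hN1 : ∀ k, 1 ≤ N k) (hN : Tendsto N atTop atTop) (x : ∀ k, Fin (N k) → Ω)
    (P : TaggedProcess Ω) (h : TendstoTagged (fun k => taggedEmp (x k)) P.toMeasure)
    {A : ℝ} (hA : 0 ≤ A) (hxA : ∀ k, energyPerPoint s V (x k) ≤ ENNReal.ofReal A) :
    P.IsStationaryOne ∧ IsProbabilityMeasure P.intensity ∧
      TendstoWeakly (fun k => emp (x k)) P.intensity ∧
      P.rieszW s + P.potential V ≤ liminf (fun k => energyPerPoint s V (x k)) atTop := by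
  have hΩm := hΩ.measurableSet
  have hst := ae_isStationary_of_tendstoTagged hd hΩ hN1 hN x P h
  have := fun k => isProbabilityMeasure_emp (hN1 k) (x k)
  have hVm : Measurable fun y => ENNReal.ofReal (V y) := hV.measurable.ennreal_ofReal
  have hen : ∀ k, energyPerPoint s V (x k) =
      pairEnergy s (x k) + ∫⁻ y, ENNReal.ofReal (V y) ∂emp (x k) := fun k => by
    rw [energyPerPoint_eq s V (hN1 k), lintegral_emp _ _ hVm]
  have hpA : ∀ k, pairEnergy s (x k) ≤ ENNReal.ofReal A := fun k =>
    le_self_add.trans ((hen k).symm.trans_le (hxA k))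
  have hVA : ∀ k, ∫⁻ y, ENNReal.ofReal (V y) ∂emp (x k) ≤ ENNReal.ofReal A := fun k =>
    le_add_self.trans ((hen k).symm.trans_le (hxA k))
  -- The uniform second moment of the smoothed count given by the energy bound; the maximum with 0
  -- provides the sign.
  set A₂ : ℝ := max 0 (mollifierBound d) * (1 + A) with hA₂
  have hA₂0 : 0 ≤ A₂ := by positivity
  have hsq : ∀ k, ∫⁻ y : E d, ENNReal.ofReal
      (((rescaled (x k)).translate (scale d (N k) • y)).pairing (mollifier d)) ^ 2 ≤
      ENNReal.ofReal A₂ := fun k => by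
    refine (lintegral_sq_pairing_rescaled_le hd hs (hN1 k) (x k)).trans ?_
    rw [hA₂, ENNReal.ofReal_mul (le_max_left _ _), ENNReal.ofReal_add zero_le_one hA,
      ENNReal.ofReal_one]
    gcongr
    exacts [le_max_right _ _, hpA k]
  have hm := measurable_pairing_mollifier_snd (Ω := Ω)
  have hsqT : ∀ k, ∫⁻ z, ENNReal.ofReal (z.2.pairing (mollifier d)) ^ 2 ∂taggedEmp (x k) ≤
      ENNReal.ofReal A₂ := fun k =>
    (lintegral_taggedEmp_le hΩm (x k) (H := fun C => ENNReal.ofReal (C.pairing (mollifier d)) ^ 2)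
      ((Config.continuous_pairing _).measurable.ennreal_ofReal.pow_const 2)).trans (hsq k)
  have hG0 : ∀ z : Ω × Config d, 0 ≤ z.2.pairing (mollifier d) := fun z =>
    z.2.pairing_nonneg mollifier_nonneg
  have hmarg : ∀ k, HasLebMarginal (taggedEmp (x k)) := fun k => hasLebMarginal_taggedEmp (x k)
  have hmargP := hasLebMarginal_toMeasure hΩm P
  have hsqP : ∫⁻ z, ENNReal.ofReal (z.2.pairing (mollifier d)) ^ 2 ∂P.toMeasure < ∞ := by
    have h1 := h.lintegral_le_liminf hΩm hmarg hmargP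
      (G := fun z => z.2.pairing (mollifier d) ^ 2)
      (continuous_pairing_mollifier_snd.pow 2) fun z => sq_nonneg _
    simp only [fun z : Ω × Config d => ENNReal.ofReal_pow (hG0 z) 2] at h1
    exact (h1.trans (liminf_le_of_frequently_le' (Frequently.of_forall hsqT))).trans_lt
      ENNReal.ofReal_lt_top
  have hv : ∀ (f : Ω →ᵇ ℝ) (n : ℕ), Tendsto (fun k => ∫ y, (f * cutoffOn Ω n) y ∂emp (x k)) atTop
      (𝓝 (∫ y, (f * cutoffOn Ω n) y ∂P.intensity)) := by
    intro f n
    obtain ⟨φ, hφ, hφf, hφb⟩ := exists_extension hΩ f n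
    have h1 := (h.tendsto_integral_mul hΩm hmarg hmargP continuous_pairing_mollifier_snd hG0 hA₂0
      hsqT (f := fun y => φ (y : E d)) (hφ.comp continuous_subtype_val) (norm_nonneg f)
      fun y => hφb y).1
    -- The average over the points equals the smoothed integral plus a vanishing error, and the
    -- latter converges to an integral against the intensity.
    have h2 := (tendsto_average_sub hd hΩ hN1 hN x ENNReal.ofReal_ne_top hsq hφ (norm_nonneg f)
      hφb).add h1
    simp only [sub_add_cancel, zero_add] at h2
    rw [P.integral_intensity hΩm hst hsqP (f * cutoffOn Ω n).continuous]
    simp only [integral_emp]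
    simp only [hφf] at h2
    exact h2
  obtain ⟨hprob, hweak⟩ := tendstoWeakly_of_tendsto_cutoff hv fun ε hε =>
    exists_one_sub_le_integral_cutoffOn hV hV0 hVinf hA hVA hε
  refine ⟨⟨hst, ?_⟩, hprob, hweak, ?_⟩
  · have := hprob.measure_univ
    rwa [TaggedProcess.intensity, withDensity_apply _ MeasurableSet.univ,
      Measure.restrict_univ] at this
  · simp only [hen]
    exact (add_le_add (P.rieszW_le_liminf hd hΩm s hN1 x h)
      (lintegral_le_liminf_of_tendstoWeakly hweak hV hV0)).trans (liminf_add_liminf_le _ _)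

/-! ### Compactness of tagged empirical processes -/

/-- Markov's inequality on each ball, with thresholds chosen so that the exceptional probabilities
sum to at most ε. -/
theorem isTightMeasureSet_of_lintegral_pairing_le {S : Set (Measure (Config d))}
    {J : ℕ → ℝ≥0∞} (hJ : ∀ n, J n ≠ ∞)
    (h : ∀ μ ∈ S, ∀ n : ℕ, ∫⁻ C, ENNReal.ofReal (C.pairing (cutoff d n)) ∂μ ≤ J n) :
    IsTightMeasureSet S := by
  rw [isTightMeasureSet_iff_exists_isCompact_measure_compl_le]
  intro ε hε
  obtain ⟨δ, hδ, hδε⟩ := ENNReal.exists_pos_sum_of_countable hε.ne' ℕ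
  have hδ0 : ∀ n, (δ n : ℝ≥0∞) ≠ 0 := fun n => by simpa using (hδ n).ne'
  -- With this threshold `J n ≤ δ n * t n`; the added 1 keeps it nonzero, as Markov's inequality
  -- requires.
  set t : ℕ → ℝ≥0∞ := fun n => J n / δ n + 1 with ht
  have htt : ∀ n, t n ≠ ∞ := fun n =>
    ENNReal.add_ne_top.2 ⟨(ENNReal.div_lt_top (hJ n) (hδ0 n)).ne, ENNReal.one_ne_top⟩
  refine ⟨_, isCompact_setOf_pairing_le fun n => (t n).toReal, fun μ hμ => ?_⟩
  have hsub : {C : Config d | ∀ n : ℕ, C.pairing (cutoff d n) ≤ (t n).toReal}ᶜ ⊆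
      ⋃ n : ℕ, {C : Config d | t n ≤ ENNReal.ofReal (C.pairing (cutoff d n))} := by
    intro C hC
    simp only [Set.mem_compl_iff, Set.mem_ofPred_eq, not_forall, not_le] at hC
    obtain ⟨n, hn⟩ := hC
    exact Set.mem_iUnion.2 ⟨n, (ENNReal.le_ofReal_iff_toReal_le (htt n)
      (C.pairing_nonneg (cutoffFun_nonneg _))).2 hn.le⟩
  calc μ _ ≤ ∑' n : ℕ, μ {C : Config d | t n ≤ ENNReal.ofReal (C.pairing (cutoff d n))} :=
        (measure_mono hsub).trans (measure_iUnion_le _)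
    _ ≤ ∑' n, (δ n : ℝ≥0∞) := by
        refine ENNReal.tsum_le_tsum fun n => ?_
        refine (meas_ge_le_lintegral_div
          (Config.continuous_pairing _).measurable.ennreal_ofReal.aemeasurable
          (by simp [ht]) (htt n)).trans ?_
        refine ENNReal.div_le_of_le_mul ((h μ hμ n).trans ?_)
        rw [ht, mul_add, ENNReal.mul_div_cancel (hδ0 n) ENNReal.coe_ne_top]
        exact le_self_add
    _ ≤ ε := hδε.le

/-- Ω may have infinite volume, whereas Prokhorov's theorem concerns probability measures.
Positivity of the weight allows it to be divided out again; the decay exponent d + 1 exceeds the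
dimension, and the positive volume of Ω makes the normalization possible. -/
theorem exists_weight (hΩ : MeasurableSet Ω) (hpos : 0 < volume Ω) :
    ∃ w : E d → ℝ, Continuous w ∧ Integrable w ∧ (∀ y, 0 < w y) ∧ (∃ B, ∀ y, w y ≤ B) ∧
      IsProbabilityMeasure (lebWeight Ω w) := by
  set w₀ : E d → ℝ := fun y => (1 + ‖y‖) ^ (-((d : ℝ) + 1)) with hw₀
  have hc : Continuous w₀ :=
    (by fun_prop : Continuous fun y : E d => 1 + ‖y‖).rpow_const fun y =>
      Or.inl (by positivity)
  have hi : Integrable w₀ := integrable_one_add_norm (by simp)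
  have h0 : ∀ y, 0 < w₀ y := fun y => Real.rpow_pos_of_pos (by positivity) _
  have h1 : ∀ y, w₀ y ≤ 1 := fun y =>
    Real.rpow_le_one_of_one_le_of_nonpos (by linarith [norm_nonneg y])
      (by linarith [(Nat.cast_nonneg d : (0 : ℝ) ≤ d)])
  set Z : ℝ≥0∞ := ∫⁻ y in Ω, ENNReal.ofReal (w₀ y) with hZ
  have hZ0 : Z ≠ 0 := by
    refine (setLIntegral_pos_iff hc.measurable.ennreal_ofReal).2 ?_ |>.ne'
    have : Function.support (fun y => ENNReal.ofReal (w₀ y)) = Set.univ := by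
      ext y; simp [h0 y]
    rwa [this, Set.univ_inter]
  have hZt : Z ≠ ∞ := by
    have := hi.2
    rw [hasFiniteIntegral_iff_ofReal (ae_of_all _ fun y => (h0 y).le)] at this
    exact ((setLIntegral_le_lintegral _ _).trans_lt this).ne
  have hZr : 0 < Z.toReal := ENNReal.toReal_pos hZ0 hZt
  refine ⟨fun y => Z.toReal⁻¹ * w₀ y, by fun_prop, hi.const_mul _, fun y => by
    have := h0 y; positivity, ⟨Z.toReal⁻¹ * 1, fun y =>
      mul_le_mul_of_nonneg_left (h1 y) (inv_nonneg.2 hZr.le)⟩, ⟨?_⟩⟩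
  rw [lebWeight, withDensity_apply _ MeasurableSet.univ, Measure.restrict_univ,
    lintegral_leb hΩ (fun y => ENNReal.ofReal (Z.toReal⁻¹ * w₀ y))]
  simp only [ENNReal.ofReal_mul (inv_nonneg.2 hZr.le)]
  rw [lintegral_const_mul _ hc.measurable.ennreal_ofReal, ← hZ, ENNReal.ofReal_inv_of_pos hZr,
    ENNReal.ofReal_toReal hZt, ENNReal.inv_mul_cancel hZ0 hZt]

theorem tendsto_integral_mul_one_sub_cutoffFun {g : Ω → ℝ} (hg : Integrable g (leb Ω)) :
    Tendsto (fun n : ℕ => ∫ y, |g y| * (1 - cutoffFun n (y : E d)) ∂leb Ω) atTop (𝓝 0) := by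
  have hcc := fun n : ℕ => (cutoffFun_continuous (d := d) n)
  have h := tendsto_integral_of_dominated_convergence (μ := leb Ω)
    (F := fun (n : ℕ) y => |g y| * (1 - cutoffFun n (y : E d))) (f := fun _ => 0)
    (fun y => |g y|) (fun n => hg.abs.aestronglyMeasurable.mul
      (continuous_const.sub ((hcc n).comp continuous_subtype_val)).aestronglyMeasurable)
    hg.abs (fun n => ae_of_all _ fun y => ?_) (ae_of_all _ fun y => ?_)
  · simpa using h
  · have h1 := cutoffFun_le_one (n : ℝ) (y : E d)
    have h2 := cutoffFun_nonneg (n : ℝ) (y : E d)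
    rw [Real.norm_of_nonneg (mul_nonneg (abs_nonneg _) (by linarith))]
    exact mul_le_of_le_one_right (abs_nonneg _) (by linarith)
  · refine tendsto_const_nhds.congr' ?_
    obtain ⟨n₀, hn₀⟩ := exists_nat_ge ‖(y : E d)‖
    filter_upwards [eventually_ge_atTop n₀] with n hn
    rw [cutoffFun_eq_one (hn₀.trans (by exact_mod_cast hn)), sub_self, mul_zero]

/-- Weak convergence for a finite weight implies the convergence of tagged measures. -/
theorem tendstoTagged_of_lebWeight (hΩ : MeasurableSet Ω) {w : E d → ℝ} (hw : Continuous w)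
    (hwi : Integrable w) (hw0 : ∀ y, 0 < w y) {κ : ℕ → Kernel Ω (Config d)}
    [∀ k, IsMarkovKernel (κ k)] {κ' : Kernel Ω (Config d)} [IsMarkovKernel κ']
    (h : TendstoWeakly (fun k => lebWeight Ω w ⊗ₘ κ k) (lebWeight Ω w ⊗ₘ κ')) :
    TendstoTagged (fun k => leb Ω ⊗ₘ κ k) (leb Ω ⊗ₘ κ') := by
  have := sigmaFinite_leb hΩ
  rintro F ⟨g, hg, hFg⟩
  have hcut : ∀ n : ℕ, Continuous fun z : Ω × Config d => cutoffFun n (z.1 : E d) := fun n =>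
    (cutoffFun_continuous n).comp (continuous_subtype_val.comp continuous_fst)
  have hcutoff : ∀ n : ℕ, Tendsto
      (fun k => ∫ z, cutoffFun n (z.1 : E d) * F z ∂(leb Ω ⊗ₘ κ k)) atTop
      (𝓝 (∫ z, cutoffFun n (z.1 : E d) * F z ∂(leb Ω ⊗ₘ κ'))) := by
    intro n
    -- The weight is removed by dividing by it, which is harmless on the compact support of the
    -- cutoff.
    have hqc : Continuous fun y : E d => cutoffFun n y / w y :=
      (cutoffFun_continuous n).div hw fun y => (hw0 y).ne'
    obtain ⟨B, hB⟩ := hqc.bounded_above_of_compact_support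
      (HasCompactSupport.intro (isCompact_closedBall (0 : E d) (n + 1)) fun y hy => by
        rw [mem_closedBall_zero_iff, not_le] at hy
        rw [cutoffFun_eq_zero hy.le, zero_div])
    have hFc : Continuous fun z : Ω × Config d => cutoffFun n (z.1 : E d) / w z.1 * F z :=
      (hqc.comp (continuous_subtype_val.comp continuous_fst)).mul F.continuous
    have hFb : ∀ z : Ω × Config d, |cutoffFun n (z.1 : E d) / w z.1 * F z| ≤ B * ‖F‖ :=
      fun z => by
        rw [abs_mul]
        exact mul_le_mul (hB _) (F.norm_coe_le_norm z) (abs_nonneg _)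
          ((norm_nonneg _).trans (hB 0))
    have e : ∀ (κ : Kernel Ω (Config d)) [IsMarkovKernel κ],
        ∫ z, cutoffFun n (z.1 : E d) / w z.1 * F z ∂(lebWeight Ω w ⊗ₘ κ) =
          ∫ z, cutoffFun n (z.1 : E d) * F z ∂(leb Ω ⊗ₘ κ) := fun κ _ => by
      rw [integral_lebWeight_compProd hΩ hw hwi (fun y => (hw0 y).le) κ hFc hFb]
      refine integral_congr_ae (ae_of_all _ fun z => ?_)
      have := (hw0 z.1).ne'
      field_simp
    have ht := h (BoundedContinuousFunction.ofNormedAddCommGroup _ hFc _ hFb)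
    simp only [BoundedContinuousFunction.coe_ofNormedAddCommGroup] at ht
    rw [e κ'] at ht
    exact ht.congr fun k => e (κ k)
  -- The tails depend only on the first marginal, which is the same for all the kernels: the bound
  -- is uniform along the sequence.
  have htail : ∀ (κ : Kernel Ω (Config d)) [IsMarkovKernel κ] (n : ℕ),
      |∫ z, F z ∂(leb Ω ⊗ₘ κ) - ∫ z, cutoffFun n (z.1 : E d) * F z ∂(leb Ω ⊗ₘ κ)| ≤
        ∫ y, |g y| * (1 - cutoffFun n (y : E d)) ∂leb Ω := by
    intro κ _ n
    have hmarg : HasLebMarginal (leb Ω ⊗ₘ κ) := Measure.fst_compProd _ _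
    have hi : Integrable F (leb Ω ⊗ₘ κ) := (hmarg.integrable_fst hg).mono'
      F.continuous.aestronglyMeasurable (ae_of_all _ hFg)
    have hb : ∀ z : Ω × Config d, ‖cutoffFun n (z.1 : E d)‖ ≤ 1 := fun z => by
      rw [Real.norm_of_nonneg (cutoffFun_nonneg _ _)]
      exact cutoffFun_le_one _ _
    have hi2 : Integrable (fun z => cutoffFun n (z.1 : E d) * F z) (leb Ω ⊗ₘ κ) :=
      hi.bdd_mul (hcut n).aestronglyMeasurable (ae_of_all _ hb)
    have hgi : Integrable (fun y => |g y| * (1 - cutoffFun n (y : E d))) (leb Ω) :=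
      hg.abs.mul_bdd (c := 1) (continuous_const.sub ((cutoffFun_continuous n).comp
        continuous_subtype_val)).aestronglyMeasurable (ae_of_all _ fun y => by
          have h1 := cutoffFun_le_one (n : ℝ) (y : E d)
          have h2 := cutoffFun_nonneg (n : ℝ) (y : E d)
          rw [Real.norm_of_nonneg (by linarith)]
          linarith)
    have e : ∫ y, |g y| * (1 - cutoffFun n (y : E d)) ∂leb Ω =
        ∫ z, |g z.1| * (1 - cutoffFun n (z.1 : E d)) ∂(leb Ω ⊗ₘ κ) := by
      have h1 := hgi.aestronglyMeasurable
      rw [← hmarg] at h1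
      rw [← hmarg, integral_map measurable_fst.aemeasurable h1]
      rw [hmarg]
    rw [e, ← integral_sub hi hi2]
    refine abs_integral_le_integral_abs.trans (integral_mono (hi.sub hi2).abs
      (hmarg.integrable_fst hgi) fun z => ?_)
    have h1 := cutoffFun_le_one (n : ℝ) (z.1 : E d)
    have h2 : F z - cutoffFun n (z.1 : E d) * F z = F z * (1 - cutoffFun n (z.1 : E d)) := by ring
    dsimp only
    rw [h2, abs_mul, abs_of_nonneg (sub_nonneg.2 h1)]
    exact mul_le_mul_of_nonneg_right ((hFg z).trans (le_abs_self _)) (sub_nonneg.2 h1)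
  rw [Metric.tendsto_atTop]
  intro e he
  obtain ⟨n, hn⟩ := ((tendsto_integral_mul_one_sub_cutoffFun hg).eventually_lt_const
    (by positivity : 0 < e / 3)).exists
  obtain ⟨K, hK⟩ := Metric.tendsto_atTop.1 (hcutoff n) (e / 3) (by positivity)
  refine ⟨K, fun k hk => ?_⟩
  have h1 := htail (κ k) n
  have h2 := htail κ' n
  have h3 := hK k hk
  rw [Real.dist_eq] at h3 ⊢
  rw [abs_lt] at h3 ⊢
  rw [abs_le] at h1 h2
  constructor <;> linarith

theorem measurable_translate_rescaled {N : ℕ} (x : Fin N → Ω) :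
    Measurable fun y : Ω => (rescaled x).translate (scale d N • (y : E d)) :=
  measurable_snd.comp (measurable_tagged x)

/-- The law of the configuration seen from a given point. -/
def empKernel {N : ℕ} (x : Fin N → Ω) : Kernel Ω (Config d) :=
  Kernel.deterministic _ (measurable_translate_rescaled x)

instance {N : ℕ} (x : Fin N → Ω) : IsMarkovKernel (empKernel x) := by
  unfold empKernel; infer_instance

theorem taggedEmp_eq_compProd (hΩ : MeasurableSet Ω) {N : ℕ} (x : Fin N → Ω) :
    taggedEmp x = leb Ω ⊗ₘ empKernel x := by
  have := sigmaFinite_leb hΩ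
  rw [empKernel, Measure.compProd_deterministic]
  rfl

/-- Every sequence of tagged empirical processes has a convergent subsequence. -/
theorem exists_tendstoTagged (hd : 1 ≤ d) (hΩ : IsClosed Ω) (hpos : 0 < volume Ω) {N : ℕ → ℕ}
    (hN1 : ∀ k, 1 ≤ N k) (x : ∀ k, Fin (N k) → Ω) :
    ∃ φ : ℕ → ℕ, StrictMono φ ∧ ∃ P : TaggedProcess Ω,
      TendstoTagged (fun k => taggedEmp (x (φ k))) P.toMeasure := by
  have hΩm := hΩ.measurableSet
  have : PolishSpace Ω := hΩ.polishSpace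
  have := sigmaFinite_leb hΩm
  obtain ⟨w, hw, hwi, hw0, ⟨B, hB⟩, hprob⟩ := exists_weight hΩm hpos
  set q : ℕ → ProbabilityMeasure (Ω × Config d) := fun k =>
    ⟨lebWeight Ω w ⊗ₘ empKernel (x k), inferInstance⟩ with hq
  -- The first marginals are one fixed measure; the second are tight because the mean number of
  -- points in a ball is bounded uniformly in k.
  have htight : IsTightMeasureSet
      {((μ : ProbabilityMeasure (Ω × Config d)) : Measure (Ω × Config d)) | μ ∈ Set.range q} := by
    refine IsTightMeasureSet.prodMk ?_ ?_
    · refine (isTightMeasureSet_singleton (μ := lebWeight Ω w)).subset ?_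
      rintro _ ⟨_, ⟨_, ⟨k, rfl⟩, rfl⟩, rfl⟩
      exact Measure.fst_compProd _ _
    · refine isTightMeasureSet_of_lintegral_pairing_le
        (J := fun n : ℕ => ENNReal.ofReal B * ∫⁻ p, ENNReal.ofReal (cutoff d n p))
        (fun n => ENNReal.mul_ne_top ENNReal.ofReal_ne_top ?_) ?_
      · have := (integrable_cutoffFun (d := d) n).2
        rw [hasFiniteIntegral_iff_ofReal (ae_of_all _ (cutoffFun_nonneg _))] at this
        exact this.ne
      · rintro _ ⟨_, ⟨_, ⟨k, rfl⟩, rfl⟩, rfl⟩ n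
        have hm : Measurable fun C : Config d => ENNReal.ofReal (C.pairing (cutoff d n)) :=
          (Config.continuous_pairing _).measurable.ennreal_ofReal
        have hm' : Measurable fun y : Ω => ENNReal.ofReal (((rescaled (x k)).translate
            (scale d (N k) • (y : E d))).pairing (cutoff d n)) :=
          hm.comp (measurable_translate_rescaled (x k))
        have hm2 : Measurable fun z : Ω × Config d => ENNReal.ofReal (z.2.pairing (cutoff d n)) :=
          hm.comp measurable_snd
        have hwm : Measurable fun y : Ω => ENNReal.ofReal (w y) :=
          (hw.comp continuous_subtype_val).measurable.ennreal_ofReal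
        calc ∫⁻ C, ENNReal.ofReal (C.pairing (cutoff d n)) ∂(q k : Measure (Ω × Config d)).snd
            = ∫⁻ y : Ω, ENNReal.ofReal (w y) * ENNReal.ofReal (((rescaled (x k)).translate
                (scale d (N k) • (y : E d))).pairing (cutoff d n)) ∂leb Ω := by
              rw [Measure.snd, lintegral_map hm measurable_snd, hq]
              simp only [ProbabilityMeasure.coe_mk]
              rw [Measure.lintegral_compProd hm2, lebWeight,
                lintegral_withDensity_eq_lintegral_mul _ hwm
                  hm2.lintegral_kernel_prod_right']
              refine lintegral_congr fun y => ?_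
              rw [Pi.mul_apply, empKernel, Kernel.lintegral_deterministic' _ hm]
          _ ≤ ∫⁻ y : Ω, ENNReal.ofReal B * ENNReal.ofReal (((rescaled (x k)).translate
                (scale d (N k) • (y : E d))).pairing (cutoff d n)) ∂leb Ω := by
              refine lintegral_mono fun y => ?_
              gcongr
              exact hB y
          _ = ENNReal.ofReal B * ∫⁻ y in Ω, ENNReal.ofReal (((rescaled (x k)).translate
                (scale d (N k) • y)).pairing (cutoff d n)) := by
              rw [lintegral_const_mul _ hm', ← lintegral_leb hΩm (fun y => ENNReal.ofReal
                (((rescaled (x k)).translate (scale d (N k) • y)).pairing (cutoff d n)))]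
          _ ≤ _ := by
              refine mul_le_mul_right ((setLIntegral_le_lintegral _ _).trans_eq ?_) _
              exact lintegral_pairing_rescaled hd (hN1 k) (x k) (cutoffFun_nonneg _)
  obtain ⟨Q, -, φ, hφ, hQ⟩ := (isCompact_closure_of_isTightMeasureSet htight).isSeqCompact
    (x := q) fun k => subset_closure ⟨k, rfl⟩
  have hQt := ProbabilityMeasure.tendsto_iff_forall_integral_tendsto.1 hQ
  -- The constant first marginal passes to the limit, so that disintegrating Q gives fibers over the
  -- weighted Lebesgue measure.
  have hfst : (Q : Measure (Ω × Config d)).fst = lebWeight Ω w := by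
    refine ext_of_forall_integral_eq_of_IsFiniteMeasure fun f => ?_
    have h1 := hQt (f.compContinuous ⟨Prod.fst, continuous_fst⟩)
    have h2 : ∀ ν : Measure (Ω × Config d),
        ∫ z, (f.compContinuous ⟨Prod.fst, continuous_fst⟩) z ∂ν = ∫ y, f y ∂ν.fst := fun ν => by
      rw [Measure.fst, integral_map measurable_fst.aemeasurable f.continuous.aestronglyMeasurable]
      rfl
    simp only [h2] at h1
    refine tendsto_nhds_unique h1 (tendsto_const_nhds.congr fun k => ?_)
    have h3 : ((q ∘ φ) k : Measure (Ω × Config d)).fst = lebWeight Ω w := Measure.fst_compProd _ _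
    rw [h3]
  have : Nonempty (Config d) := ⟨⟨fun _ => 0, fun r => by simp⟩⟩
  set κ := (Q : Measure (Ω × Config d)).condKernel
  have hdis : lebWeight Ω w ⊗ₘ κ = Q := by
    rw [← hfst]
    exact Measure.disintegrate _ _
  refine ⟨φ, hφ, ⟨κ, inferInstance⟩, ?_⟩
  simp only [taggedEmp_eq_compProd hΩm, TaggedProcess.toMeasure]
  refine tendstoTagged_of_lebWeight hΩm hw hwi hw0 fun f => ?_
  rw [hdis]
  exact hQt f

/-! ### Extraction of subsequences -/

/-- Besides approaching the liminf, the values are bounded at every index and the indices are at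
least 1, as the estimates for each individual N demand. -/
theorem exists_subseq_le_liminf {e : ℕ → ℝ≥0∞} (h : liminf e atTop ≠ ∞) :
    ∃ φ : ℕ → ℕ, StrictMono φ ∧ ∀ n : ℕ, 1 ≤ φ n ∧
      e (φ n) ≤ liminf e atTop + ((n : ℝ≥0∞) + 1)⁻¹ := by
  refine extraction_forall_of_frequently
    (P := fun n k => 1 ≤ k ∧ e k ≤ liminf e atTop + ((n : ℝ≥0∞) + 1)⁻¹) fun n => ?_
  have h1 : liminf e atTop < liminf e atTop + ((n : ℝ≥0∞) + 1)⁻¹ :=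
    ENNReal.lt_add_right h (by simp)
  exact ((frequently_lt_of_liminf_lt (by isBoundedDefault) h1).and_eventually
    (eventually_ge_atTop 1)).mono fun k hk => ⟨hk.2, hk.1.le⟩

theorem liminf_subseq_le {e : ℕ → ℝ≥0∞} {L : ℝ≥0∞} {ψ : ℕ → ℕ} (hψ : StrictMono ψ)
    (h : ∀ n : ℕ, e n ≤ L + ((n : ℝ≥0∞) + 1)⁻¹) : liminf (fun k => e (ψ k)) atTop ≤ L := by
  have ht : Tendsto (fun n : ℕ => L + ((n : ℝ≥0∞) + 1)⁻¹) atTop (𝓝 L) := by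
    have h1 : Tendsto (fun n : ℕ => ((n : ℝ≥0∞) + 1)⁻¹) atTop (𝓝 0) := by
      have := ENNReal.tendsto_inv_nat_nhds_zero.comp (tendsto_add_atTop_nat 1)
      simpa [Function.comp_def] using this
    simpa using tendsto_const_nhds.add h1
  rw [← (ht.comp hψ.tendsto_atTop).liminf_eq]
  exact liminf_le_liminf (Eventually.of_forall fun k => h (ψ k))

theorem le_add_one_of_le_add_inv {a L : ℝ≥0∞} {n : ℕ} (h : a ≤ L + ((n : ℝ≥0∞) + 1)⁻¹) :
    a ≤ L + 1 :=
  h.trans (add_le_add_right (ENNReal.inv_le_one.2 le_add_self) _)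

end RieszGas

end

/-! ### The main theorem -/

theorem mainTheorem8 (d : ℕ) (hd : 1 ≤ d) (s : ℝ) (hs : (d : ℝ) < s)
    (Ω : Set (RieszGas.E d)) (hΩ : IsClosed Ω) (hΩpos : 0 < volume Ω)
    (hΩC1 : RieszGas.HasC1Boundary Ω)
    (V : Ω → ℝ) (hV : Continuous V) (hV0 : ∀ x, 0 ≤ V x)
    (hVinf : ¬ Bornology.IsBounded Ω →
      Tendsto V (comap (fun x : Ω => ‖(x : RieszGas.E d)‖) atTop) atTop)
    (hVint : ¬ Bornology.IsBounded Ω →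
      ∃ M : ℝ, 0 < M ∧ (∫⁻ x, ENNReal.ofReal (Real.exp (-(M * V x))) ∂(RieszGas.leb Ω)) < ⊤)
    (X : (N : ℕ) → Fin N → Ω)
    (hX : liminf (fun N => RieszGas.energyPerPoint s V (X N)) atTop < ⊤) :
    (∃ φ : ℕ → ℕ, StrictMono φ ∧ ∃ μ : Measure Ω, IsProbabilityMeasure μ ∧
      ∃ P : RieszGas.TaggedProcess Ω,
        RieszGas.TendstoWeakly (fun k => RieszGas.emp (X (φ k))) μ ∧
        RieszGas.TendstoTagged (fun k => RieszGas.taggedEmp (X (φ k))) P.toMeasure ∧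
        P.IsStationaryOne ∧
        P.intensity = μ ∧
        P.rieszW s + P.potential V ≤
          liminf (fun N => RieszGas.energyPerPoint s V (X N)) atTop) ∧
    (∀ φ : ℕ → ℕ, StrictMono φ → ∀ P : RieszGas.TaggedProcess Ω,
      RieszGas.TendstoTagged (fun k => RieszGas.taggedEmp (X (φ k))) P.toMeasure →
        P.rieszW s + P.potential V ≤
          liminf (fun k => RieszGas.energyPerPoint s V (X (φ k))) atTop) := by
  have hs0 : 0 ≤ s := (Nat.cast_nonneg d).trans hs.le
  have hbound : ∀ {a L : ℝ≥0∞} {n : ℕ}, L ≠ ⊤ → a ≤ L + ((n : ℝ≥0∞) + 1)⁻¹ →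
      a ≤ ENNReal.ofReal (L + 1).toReal := fun hL h => by
    rw [ENNReal.ofReal_toReal (ENNReal.add_ne_top.2 ⟨hL, ENNReal.one_ne_top⟩)]
    exact RieszGas.le_add_one_of_le_add_inv h
  refine ⟨?_, fun φ hφ P h => ?_⟩
  -- The energies are first brought down to the liminf over all N. Extracting again by compactness
  -- keeps them there, so the bound along the final subsequence is the stated one.
  · obtain ⟨φ, hφ, hφe⟩ := RieszGas.exists_subseq_le_liminf hX.ne
    obtain ⟨ψ, hψ, P, h⟩ := RieszGas.exists_tendstoTagged hd hΩ hΩpos (N := φ)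
      (fun k => (hφe k).1) fun k => X (φ k)
    obtain ⟨h1, h2, h3, h4⟩ := RieszGas.limit_properties hd hs0 hΩ hV hV0 hVinf
      (N := fun k => φ (ψ k)) (fun k => (hφe _).1) (hφ.comp hψ).tendsto_atTop
      (fun k => X (φ (ψ k))) P h ENNReal.toReal_nonneg fun k => hbound hX.ne (hφe (ψ k)).2
    exact ⟨fun k => φ (ψ k), hφ.comp hψ, P.intensity, h2, P, h3, h, h1, rfl,
      h4.trans (RieszGas.liminf_subseq_le
        (e := fun k => RieszGas.energyPerPoint s V (X (φ k))) hψ fun n => (hφe n).2)⟩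
  -- An infinite liminf leaves nothing to prove; otherwise the energies are bounded along a further
  -- subsequence, and the tagged convergence is inherited.
  · rcases eq_or_ne (liminf (fun k => RieszGas.energyPerPoint s V (X (φ k))) atTop) ⊤ with hL | hL
    · rw [hL]
      exact le_top
    · obtain ⟨ψ, hψ, hψe⟩ := RieszGas.exists_subseq_le_liminf hL
      -- The particle number is φ (ψ k), at least ψ k and hence at least 1, because a strictly
      -- increasing map of the naturals dominates the identity.
      have h4 := (RieszGas.limit_properties hd hs0 hΩ hV hV0 hVinf
        (N := fun k => φ (ψ k)) (fun k => (hψe k).1.trans (hφ.id_le _))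
        (hφ.comp hψ).tendsto_atTop (fun k => X (φ (ψ k))) P
        (fun F hF => (h F hF).comp hψ.tendsto_atTop) ENNReal.toReal_nonneg
        fun k => hbound hL (hψe k).2).2.2.2
      exact h4.trans (RieszGas.liminf_subseq_le
        (e := fun k => RieszGas.energyPerPoint s V (X (φ (ψ k)))) strictMono_id fun n => (hψe n).2)
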